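/- Let $H\in(\tfrac12,1)$, let $(\Omega,\mathcal F,\mathbb P)$ be a probability space, and let $B^H=(B^H_t)_{t\in[0,1]}$ be a $d$-dimensional fractional Brownian motion on it with Hurst parameter $H$, i.e. a centered Gaussian process with $\mathbb E(B^{H,i}_sB^{H,j}_t)=\tfrac12(s^{2H}+t^{2H}-|t-s|^{2H})\delta_{i,j}$, with a.s. continuous paths. Let $x_0\in\mathbb R^m$, let $|\cdot|$ denote the Euclidean norm of vectors and the norm $|A|=(\sum_{i,j}|a^{i,j}|^2)^{1/2}$ of matrices, and assume the following. (i) $\sigma:[0,1]\times\mathbb R^m\to\mathbb R^{m\times d}$ is differentiable in $x\in\mathbb R^m$, and there are constants $M>0$, $1-H<\lambda\le 1$, $\frac1H-1<\gamma\le1$ and, for every $N>0$, a constant $M_N>0$ such that, for $k=1,\dots,m$, $$|\sigma(t,x)-\sigma(t,y)|\le M|x-y|\quad\text{for all } t\in[0,1],\ x,y\in\mathbb R^m,$$ $$|\partial_{x_k}\sigma(t,x)-\partial_{x_k}\sigma(t,y)|\le M_N|x-y|^\gamma\quad\text{for all } t\in[0,1],\ |x|\vee|y|\le N,$$ $$|\sigma(t,x)-\sigma(s,x)|+|\partial_{x_k}\sigma(t,x)-\partial_{x_k}\sigma(s,x)|\le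 M|t-s|^\lambda\quad\text{for all } s,t\in[0,1],\ x\in\mathbb R^m.$$ (ii) $b:[0,1]\times\mathbb R^m\to\mathbb R^m$ is measurable in $t$, and there is $L>0$ such that $|b(t,x)-b(t,y)|\le L|x-y|$ and $|b(t,x)|\le L(1+|x|)$ for all $t\in[0,1]$, $x,y\in\mathbb R^m$. For $\varepsilon>0$ consider the equation $$X^\varepsilon_t=x_0+\int_0^t b(s,X^\varepsilon_s)\,ds+\sqrt\varepsilon\int_0^t\sigma(s,X^\varepsilon_s)\,dB^H_s,\qquad t\in[0,1],\tag{1}$$ where the last integral is, coordinate by coordinate, a pathwise Riemann–Stieltjes integral. For $0<\alpha<1$ let $W_0^{\alpha,\infty}([0,1]:\mathbb R^m)$ be the space of measurable $f:[0,1]\to\mathbb R^m$ with $\sup_{0\le t\le1}\big\{|f(t)|+\int_0^t\frac{|f(t)-f(s)|}{(t-s)^{\alpha+1}}ds\big\}<\infty$, and for $0<\beta<1$ let $\|f\|_{\beta}=\sup_{0\le\theta<r\le1}\frac{|f(r)-f(\theta)|}{|r-\theta|^{\beta}}$. Then for every $\alpha\in\big(1-H,\min\{\tfrac12,\lambda,\tfrac{\gamma}{1+\gamma}\}\big)$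 the following hold. (a) For every $\varepsilon>0$ there is a process $X^\varepsilon=(X^\varepsilon_t)_{t\in[0,1]}$, with each $X^\varepsilon_t$ measurable and, up to $\mathbb P$-null sets, $\sigma(B^H_s:0\le s\le t)$-measurable, such that for $\mathbb P$-almost every $\omega$ the path $X^\varepsilon(\omega)$ is the unique element of $W_0^{\alpha,\infty}([0,1]:\mathbb R^m)$ satisfying (1) with driving path $B^H(\omega)$. Moreover, for $\mathbb P$-almost every $\omega$, $X^\varepsilon(\omega)$ is $(1-\alpha)$-Hölder continuous. (b) The solutions satisfy $\sup_{\varepsilon\in(0,1)}\mathbb E\|X^\varepsilon\|_{1-\alpha}^p<\infty$ for every $p\ge1$, where $\|X^\varepsilon\|_{1-\alpha}$ is measurable up to null sets. -/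

import Mathlib

open MeasureTheory ProbabilityTheory Set
open scoped ENNReal NNReal

namespace FBMSDE

/-- `I` is the Riemann-Stieltjes integral of `f` against `g` over `[a, b]`: the Riemann-Stieltjes
sums over all tagged partitions of `[a, b]` converge to `I` as the mesh tends to zero. -/
def HasRSIntegral (f g : ℝ → ℝ) (a b I : ℝ) : Prop :=
  ∀ η > 0, ∃ δ > 0, ∀ (n : ℕ) (τ ξ : ℕ → ℝ), τ 0 = a → τ n = b →
    (∀ k < n, τ k ≤ τ (k + 1) ∧ ξ k ∈ Icc (τ k) (τ (k + 1)) ∧ τ (k + 1) - τ k < δ) →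
    |∑ k ∈ Finset.range n, f (ξ k) * (g (τ (k + 1)) - g (τ k)) - I| < η

/-- The norm `sup_{0 ≤ t ≤ 1} (|f(t)| + ∫_0^t |f(t) - f(s)| / (t - s)^(α + 1) ds)`, with values
in `[0, ∞]`. Only the restriction of `f` to `[0, 1]` matters. -/
noncomputable def sobolevNorm {n : ℕ} (α : ℝ) (f : ℝ → EuclideanSpace ℝ (Fin n)) : ℝ≥0∞ :=
  ⨆ t ∈ Icc (0 : ℝ) 1,
    (‖f t‖ₑ + ∫⁻ s in Ioo 0 t, ‖f t - f s‖ₑ / ENNReal.ofReal ((t - s) ^ (α + 1)))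

/-- Membership in the space `W_0^{α,∞}([0,1] : ℝⁿ)`: Lebesgue measurable on `[0, 1]`
and of finite norm. -/
def MemW {n : ℕ} (α : ℝ) (f : ℝ → EuclideanSpace ℝ (Fin n)) : Prop :=
  AEMeasurable f (volume.restrict (Icc (0 : ℝ) 1)) ∧ sobolevNorm α f < ∞

/-- The Hölder seminorm `sup_{0 ≤ θ < r ≤ 1} |f(r) - f(θ)| / |r - θ|^β`, with values
in `[0, ∞]`. -/
noncomputable def holderSeminorm {n : ℕ} (β : ℝ) (f : ℝ → EuclideanSpace ℝ (Fin n)) : ℝ≥0∞ :=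
  ⨆ (θ : ℝ) (r : ℝ) (_ : 0 ≤ θ ∧ θ < r ∧ r ≤ 1), ‖f r - f θ‖ₑ / ENNReal.ofReal ((r - θ) ^ β)

/-- `(B_t)_{0 ≤ t ≤ 1}` is a `d`-dimensional fractional Brownian motion with Hurst parameter `H`:
a centered Gaussian process with covariance
`E[B_s^i B_t^j] = (s^{2H} + t^{2H} - |t - s|^{2H}) / 2` if `i = j` and `0` otherwise. -/
structure IsFBM {Ω : Type*} [MeasurableSpace Ω] {d : ℕ} (H : ℝ)
    (B : ℝ → Ω → EuclideanSpace ℝ (Fin d)) (P : Measure Ω) : Prop where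
  measurable : ∀ t ∈ Icc (0 : ℝ) 1, Measurable (B t)
  gaussian : IsGaussianProcess (fun (t : Icc (0 : ℝ) 1) (ω : Ω) => B t ω) P
  centered : ∀ t ∈ Icc (0 : ℝ) 1, ∀ i, ∫ ω, B t ω i ∂P = 0
  covariance : ∀ s ∈ Icc (0 : ℝ) 1, ∀ t ∈ Icc (0 : ℝ) 1, ∀ i j,
    ∫ ω, B s ω i * B t ω j ∂P =
      1 / 2 * (s ^ (2 * H) + t ^ (2 * H) - |t - s| ^ (2 * H)) * (if i = j then 1 else 0)

/-- The σ-algebra generated by `B_s`, `0 ≤ s ≤ t`. -/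
@[reducible] def pastSigma {Ω : Type*} {d : ℕ} (B : ℝ → Ω → EuclideanSpace ℝ (Fin d)) (t : ℝ) :
    MeasurableSpace Ω :=
  ⨆ s ∈ Icc (0 : ℝ) t, MeasurableSpace.comap (B s) inferInstance

/-- The norm `|A| = (∑ |a^{i,j}|²)^{1/2}` of a matrix. -/
noncomputable def matNorm {m d : ℕ} (A : Matrix (Fin m) (Fin d) ℝ) : ℝ :=
  Real.sqrt (∑ i, ∑ j, (A i j) ^ 2)

/-- The matrix `∂_{x_k} σ(t, x)` of partial derivatives in the space variable. -/
noncomputable def partialX {m d : ℕ}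
    (σ : ℝ → EuclideanSpace ℝ (Fin m) → Matrix (Fin m) (Fin d) ℝ) (k : Fin m) (t : ℝ)
    (x : EuclideanSpace ℝ (Fin m)) : Matrix (Fin m) (Fin d) ℝ :=
  Matrix.of fun i j => fderiv ℝ (fun y => σ t y i j) x (EuclideanSpace.single k 1)

/-- The conditions on the diffusion coefficient. -/
structure DiffusionAssumption {m d : ℕ} (H lam γ : ℝ)
    (σ : ℝ → EuclideanSpace ℝ (Fin m) → Matrix (Fin m) (Fin d) ℝ) : Prop where
  lam_mem : lam ∈ Ioc (1 - H) 1
  gamma_mem : γ ∈ Ioc (1 / H - 1) 1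
  differentiable : ∀ t ∈ Icc (0 : ℝ) 1, ∀ i j, Differentiable ℝ (fun x => σ t x i j)
  bounds : ∃ M > 0,
    (∀ t ∈ Icc (0 : ℝ) 1, ∀ x y, matNorm (σ t x - σ t y) ≤ M * ‖x - y‖) ∧
    (∀ N > 0, ∃ MN > 0, ∀ t ∈ Icc (0 : ℝ) 1, ∀ x y, max ‖x‖ ‖y‖ ≤ N → ∀ k,
      matNorm (partialX σ k t x - partialX σ k t y) ≤ MN * ‖x - y‖ ^ γ) ∧
    (∀ s ∈ Icc (0 : ℝ) 1, ∀ t ∈ Icc (0 : ℝ) 1, ∀ x, ∀ k,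
      matNorm (σ t x - σ s x) + matNorm (partialX σ k t x - partialX σ k s x)
        ≤ M * |t - s| ^ lam)

/-- The conditions on the drift coefficient. -/
structure DriftAssumption {m : ℕ}
    (b : ℝ → EuclideanSpace ℝ (Fin m) → EuclideanSpace ℝ (Fin m)) : Prop where
  measurable : ∀ x, AEMeasurable (fun t => b t x) (volume.restrict (Icc (0 : ℝ) 1))
  bounds : ∃ L > 0, ∀ t ∈ Icc (0 : ℝ) 1,
    (∀ x y, ‖b t x - b t y‖ ≤ L * ‖x - y‖) ∧ (∀ x, ‖b t x‖ ≤ L * (1 + ‖x‖))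

/-- The path `x` belongs to `W_0^{α,∞}` and solves, for all `t ∈ [0, 1]` and each coordinate `i`,
`x_t^i = x₀^i + ∫_0^t b^i(s, x_s) ds + √ε ∑_j ∫_0^t σ^{i,j}(s, x_s) dg_s^j`,
the last integrals being Riemann-Stieltjes integrals. -/
structure IsSolution {m d : ℕ} (b : ℝ → EuclideanSpace ℝ (Fin m) → EuclideanSpace ℝ (Fin m))
    (σ : ℝ → EuclideanSpace ℝ (Fin m) → Matrix (Fin m) (Fin d) ℝ)
    (x₀ : EuclideanSpace ℝ (Fin m)) (α ε : ℝ) (g : ℝ → EuclideanSpace ℝ (Fin d))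
    (x : ℝ → EuclideanSpace ℝ (Fin m)) : Prop where
  mem : MemW α x
  equation : ∀ t ∈ Icc (0 : ℝ) 1, ∃ J : Fin m → Fin d → ℝ,
    (∀ i j, HasRSIntegral (fun s => σ s (x s) i j) (fun s => g s j) 0 t (J i j)) ∧
    ∀ i, IntervalIntegrable (fun s => b s (x s) i) volume 0 t ∧
      x t i = x₀ i + (∫ s in (0 : ℝ)..t, b s (x s) i) + Real.sqrt ε * ∑ j, J i j

end FBMSDE

/-!
The equation is solved pathwise, as a Young differential equation driven by `√ε B^H(ω)`.

*Pathwise theory.* Fix `β` with `1 - α < β < H` and a `β`-Hölder driver `g`. Davie's notion of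
solution (`IsYoungSolution`) asks that a `β`-Hölder path `x` satisfy `x_v - x_u = ∫_u^v b(r, x_r) dr
+ S(u, x_u) (g_v - g_u) + O((v - u) ^ (κ + β))`, where `κ + β > 1` and both `S` and its space
derivative are `κ`-Hölder along `β`-Hölder paths. The upper bounds `1 / 2`, `lam` and `γ / (1 + γ)`
on `α` are what makes `κ = min β (min lam (γ β))` admissible. The sewing inequality (`sewing_bound`;
on grids `discrete_sewing`) bounds the remainder by the additivity defect of the germ, which is
governed by the Hölder constants of `S(·, x)` and `g`. Since `S` is Lipschitz, on an interval of
length `h ~ Q ^ (-1/β)`, with `Q` affine in the Hölder constant of `g`, the Hölder constant of `x`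
is at most `2 Q (1 + ‖x_s‖)`; so `1 + ‖x‖` doubles at most `~ 1/h` times, and the Hölder constant of
`x` is of order `exp (c Q ^ (1/β)) (1 + ‖x₀‖)` (`IsSewn.global_bound`). The same estimate for
differences, with the four-point inequality for `S`, gives uniqueness (`IsYoungSolution.unique`).
Existence is by compactness: Euler schemes satisfy the a priori bounds on their grids uniformly in
the step (`euler_bounds`), their limits along ultrafilters are solutions, and by uniqueness all
these limits agree, so that the schemes converge (`exists_isYoungSolution_tendsto`). The convergence
also shows that the solution at time `t` is a measurable function of the driver up to time `t`.

*Solutions in `W_0^{α,∞}`.* The Sobolev norm bounds the `α`-Hölder constant of a path away from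
time `0`, but does not see the value at `0` (`MemW.exists_holder_modification`). As `α + β > 1`,
the modified path has Young integrals, which are Riemann-Stieltjes integrals, and these do not
depend on the value of the integrand at `0` (`HasRSIntegral.unique_of_eq_off_zero`). Hence every
solution in `W_0^{α,∞}` is `β`-Hölder and a Young solution (`IsSolution.isYoungSolution`);
the converse is `IsYoungSolution.isSolution`.

*Moments.* The `β`-Hölder constant of a continuous path of `B^H` is at most a multiple of the
supremum of its normalised dyadic increments (`holder_of_dyadicSup`), which has exponential moments
of every order `q < 2` (`IsFBM.lintegral_exp_dyadicSup`). Since `β > 1 - α > 1/2`, the order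
`1/β` that appears in the a priori bound is less than `2`, so all moments of the `(1 - α)`-Hölder
seminorm of the solution are finite, uniformly in `ε ∈ (0, 1)`.
-/

namespace FBMSDE

open Filter Topology

/-! ### Sewing inequalities -/

/-- The constant of the sewing inequality with exponent `θ > 1`. -/
noncomputable def sewC (θ : ℝ) : ℝ := 2 ^ θ / (1 - 2 ^ (1 - θ))

lemma two_rpow_one_sub_lt {θ : ℝ} (hθ : 1 < θ) : (2 : ℝ) ^ (1 - θ) < 1 :=
  Real.rpow_lt_one_of_one_lt_of_neg (by norm_num) (by linarith)

lemma sewC_pos {θ : ℝ} (hθ : 1 < θ) : 0 < sewC θ :=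
  div_pos (by positivity) (by linarith [two_rpow_one_sub_lt hθ])

lemma sewC_eq {θ : ℝ} (hθ : 1 < θ) : sewC θ * 2 ^ (1 - θ) + 2 ^ θ = sewC θ := by
  have := two_rpow_one_sub_lt hθ
  have h : (1 - (2 : ℝ) ^ (1 - θ)) ≠ 0 := by linarith
  rw [sewC]
  field_simp
  ring

lemma norm_le_add_three {E : Type*} [SeminormedAddCommGroup E] (x y z : E) :
    ‖x‖ ≤ ‖x - y - z‖ + ‖y‖ + ‖z‖ := by
  calc ‖x‖ = ‖x - y - z + y + z‖ := by congr 1; abel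
    _ ≤ _ := norm_add₃_le

/-- Sewing inequality on a uniform grid: a two-parameter family that vanishes on neighbouring
points and is additive up to `K (k - i) ^ θ` is bounded by a multiple of `K (k - i) ^ θ`.
The induction halves the interval; both halves of an interval with `n` steps satisfy
`n' - 1 ≤ (n - 1) / 2`, which is why the bound is proved with `n - 1` in place of `n`. -/
lemma discrete_sewing {E : Type*} [SeminormedAddCommGroup E] {R : ℕ → ℕ → E} {θ K : ℝ}
    (hθ : 1 < θ) (hK : 0 ≤ K) {a b : ℕ} (h1 : ∀ k, a ≤ k → k < b → R k (k + 1) = 0)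
    (hδ : ∀ i j k, a ≤ i → i ≤ j → j ≤ k → k ≤ b →
      ‖R i k - R i j - R j k‖ ≤ K * ((k : ℝ) - i) ^ θ) :
    ∀ i k, a ≤ i → i ≤ k → k ≤ b → ‖R i k‖ ≤ sewC θ * K * ((k : ℝ) - i) ^ θ := by
  have main : ∀ n i, a ≤ i → i + (n + 1) ≤ b →
      ‖R i (i + (n + 1))‖ ≤ sewC θ * K * (n : ℝ) ^ θ := by
    intro n
    induction n using Nat.strong_induction_on with
    | _ n ih =>
      intro i hi hb
      rcases Nat.eq_zero_or_pos n with rfl | hn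
      · rw [h1 i hi (by omega)]
        simp [Real.zero_rpow (by linarith : θ ≠ 0)]
      obtain ⟨p, q, hpq, hp, hq⟩ : ∃ p q, p + q + 1 = n ∧ 2 * p ≤ n ∧ 2 * q ≤ n :=
        ⟨(n - 1) / 2, n - 1 - (n - 1) / 2, by omega, by omega, by omega⟩
      have e1 := ih p (by omega) i hi (by omega)
      have e2 := ih q (by omega) (i + (p + 1)) (by omega) (by omega)
      have e : i + (p + 1) + (q + 1) = i + (n + 1) := by omega
      rw [e] at e2
      have e3 := hδ i (i + (p + 1)) (i + (n + 1)) hi (by omega) (by omega) hb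
      have hnr : (1 : ℝ) ≤ n := by exact_mod_cast hn
      have half : ∀ r : ℕ, 2 * r ≤ n → (r : ℝ) ^ θ ≤ 2 ^ (-θ) * (n : ℝ) ^ θ := by
        intro r hr
        have : (r : ℝ) ≤ 2⁻¹ * n := by
          have : (2 : ℝ) * r ≤ n := by exact_mod_cast hr
          linarith
        calc (r : ℝ) ^ θ ≤ (2⁻¹ * n) ^ θ := Real.rpow_le_rpow (by positivity) this (by linarith)
          _ = 2 ^ (-θ) * (n : ℝ) ^ θ := by
            rw [Real.mul_rpow (by norm_num) (by positivity), Real.rpow_neg (by norm_num),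
              Real.inv_rpow (by norm_num)]
      have e4 : (((i + (n + 1) : ℕ) : ℝ) - i) ^ θ ≤ 2 ^ θ * (n : ℝ) ^ θ := by
        rw [← Real.mul_rpow (by norm_num) (by positivity)]
        apply Real.rpow_le_rpow
        · push_cast; linarith
        · push_cast; linarith
        · linarith
      have e5 : ‖R i (i + (n + 1))‖ ≤ ‖R i (i + (n + 1)) - R i (i + (p + 1))
          - R (i + (p + 1)) (i + (n + 1))‖ + ‖R i (i + (p + 1))‖
          + ‖R (i + (p + 1)) (i + (n + 1))‖ := by
        exact norm_le_add_three _ _ _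
      have hC := (sewC_pos hθ).le
      have hCK : 0 ≤ sewC θ * K := by positivity
      have f1 := e1.trans (mul_le_mul_of_nonneg_left (half p hp) hCK)
      have f2 := e2.trans (mul_le_mul_of_nonneg_left (half q hq) hCK)
      have f3 := e3.trans (mul_le_mul_of_nonneg_left e4 hK)
      have key := sewC_eq hθ
      have h2 : (2 : ℝ) ^ (1 - θ) = 2 * 2 ^ (-θ) := by
        rw [sub_eq_add_neg, Real.rpow_add (by norm_num), Real.rpow_one]
      calc ‖R i (i + (n + 1))‖
          ≤ K * (2 ^ θ * (n : ℝ) ^ θ) + sewC θ * K * (2 ^ (-θ) * (n : ℝ) ^ θ)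
            + sewC θ * K * (2 ^ (-θ) * (n : ℝ) ^ θ) := by linarith
        _ = (sewC θ * 2 ^ (1 - θ) + 2 ^ θ) * K * (n : ℝ) ^ θ := by rw [h2]; ring
        _ = sewC θ * K * (n : ℝ) ^ θ := by rw [key]
  intro i k hi hik hk
  rcases hik.eq_or_lt with rfl | hlt
  · have := hδ i i i hi le_rfl le_rfl hk
    simp only [sub_self, zero_sub, norm_neg, Real.zero_rpow (by linarith : θ ≠ 0), mul_zero]
      at this ⊢
    exact this
  · obtain ⟨n, rfl⟩ : ∃ n, k = i + (n + 1) := ⟨k - i - 1, by omega⟩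
    refine (main n i hi hk).trans (mul_le_mul_of_nonneg_left ?_ ?_)
    · apply Real.rpow_le_rpow (by positivity) _ (by linarith)
      push_cast; linarith
    · exact mul_nonneg (sewC_pos hθ).le hK

/-- A bound that improves from `X` to `a + r X` with `r < 1` improves to the fixed point
`a / (1 - r)`. -/
lemma bound_of_self_improving {ι : Type*} {F w : ι → ℝ} (hw : ∀ i, 0 ≤ w i) {a r X₀ : ℝ}
    (ha : 0 ≤ a) (hr : 0 ≤ r) (hr1 : r < 1) (hX₀ : 0 ≤ X₀) (h0 : ∀ i, F i ≤ X₀ * w i)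
    (hstep : ∀ X, 0 ≤ X → (∀ i, F i ≤ X * w i) → ∀ i, F i ≤ (a + r * X) * w i) :
    ∀ i, F i ≤ a / (1 - r) * w i := by
  set s : Set ℝ := {X | 0 ≤ X ∧ ∀ i, F i ≤ X * w i}
  have hs : s.Nonempty := ⟨X₀, hX₀, h0⟩
  have hbdd : BddBelow s := ⟨0, fun X hX => hX.1⟩
  have hc0 : 0 ≤ sInf s := le_csInf hs fun X hX => hX.1
  have hc : sInf s ∈ s := by
    refine ⟨hc0, fun i => ?_⟩
    rcases (hw i).eq_or_lt with h | h
    · have := h0 i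
      rw [← h] at this ⊢
      simpa using this
    · rw [← div_le_iff₀ h]
      refine le_csInf hs fun X hX => ?_
      rw [div_le_iff₀ h]
      exact hX.2 i
  have h2 : a + r * sInf s ∈ s := ⟨by positivity, hstep _ hc0 hc.2⟩
  have h3 : sInf s ≤ a + r * sInf s := csInf_le hbdd h2
  have h4 : sInf s ≤ a / (1 - r) := by
    rw [le_div_iff₀ (by linarith)]; linarith
  intro i
  exact (hc.2 i).trans (mul_le_mul_of_nonneg_right h4 (hw i))

/-- Sewing inequality in continuous time: a family of order `(v - u) ^ θ`, `θ > 1`, with any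
constant, has a constant governed by its additivity defect alone. -/
lemma sewing_bound {E : Type*} [SeminormedAddCommGroup E] {R : ℝ → ℝ → E} {θ K C₀ a b : ℝ}
    (hθ : 1 < θ) (hK : 0 ≤ K) (hC₀ : ∀ u v, a ≤ u → u ≤ v → v ≤ b → ‖R u v‖ ≤ C₀ * (v - u) ^ θ)
    (hδ : ∀ u w v, a ≤ u → u ≤ w → w ≤ v → v ≤ b →
      ‖R u v - R u w - R w v‖ ≤ K * (v - u) ^ θ) :
    ∀ u v, a ≤ u → u ≤ v → v ≤ b → ‖R u v‖ ≤ sewC θ * K * (v - u) ^ θ := by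
  have hlt := two_rpow_one_sub_lt hθ
  have key := bound_of_self_improving
    (ι := {p : ℝ × ℝ // a ≤ p.1 ∧ p.1 ≤ p.2 ∧ p.2 ≤ b})
    (F := fun p => ‖R p.1.1 p.1.2‖) (w := fun p => (p.1.2 - p.1.1) ^ θ)
    (fun p => Real.rpow_nonneg (by linarith [p.2.2.1]) _) (a := K) (r := 2 ^ (1 - θ))
    (X₀ := |C₀|) hK (by positivity) hlt (abs_nonneg _) ?_ ?_
  · intro u v hu huv hv
    refine (key ⟨(u, v), hu, huv, hv⟩).trans ?_
    apply mul_le_mul_of_nonneg_right _ (Real.rpow_nonneg (by linarith) _)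
    rw [sewC, div_mul_eq_mul_div]
    apply div_le_div_of_nonneg_right _ (by linarith)
    have : (1 : ℝ) ≤ 2 ^ θ := Real.one_le_rpow (by norm_num) (by linarith)
    nlinarith
  · rintro ⟨⟨u, v⟩, hu, huv, hv⟩
    exact (hC₀ u v hu huv hv).trans
      (mul_le_mul_of_nonneg_right (le_abs_self _) (Real.rpow_nonneg (sub_nonneg.2 huv) _))
  · rintro X hX hP ⟨⟨u, v⟩, hu, huv, hv⟩
    dsimp only at hu huv hv ⊢
    set w := (u + v) / 2 with hw
    have e1 := hP ⟨(u, w), hu, by simp only; linarith, by simp only; linarith⟩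
    have e2 := hP ⟨(w, v), by simp only; linarith, by simp only; linarith, hv⟩
    have e3 := hδ u w v hu (by linarith) (by linarith) hv
    dsimp only at e1 e2
    have hh : ((v - u) / 2) ^ θ = 2 ^ (-θ) * (v - u) ^ θ := by
      rw [Real.div_rpow (by linarith) (by norm_num), Real.rpow_neg (by norm_num)]
      field_simp
    have h2 : (2 : ℝ) ^ (1 - θ) = 2 * 2 ^ (-θ) := by
      rw [sub_eq_add_neg, Real.rpow_add (by norm_num), Real.rpow_one]
    rw [show w - u = (v - u) / 2 by rw [hw]; ring, hh] at e1
    rw [show v - w = (v - u) / 2 by rw [hw]; ring, hh] at e2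
    have e5 : ‖R u v‖ ≤ ‖R u v - R u w - R w v‖ + ‖R u w‖ + ‖R w v‖ := by
      exact norm_le_add_three _ _ _
    rw [h2]
    nlinarith

lemma eq_of_norm_sub_le_rpow {E : Type*} [NormedAddCommGroup E] {φ : ℝ → E} {θ C a b : ℝ}
    (hθ : 1 < θ) (h : ∀ u v, a ≤ u → u ≤ v → v ≤ b → ‖φ v - φ u‖ ≤ C * (v - u) ^ θ) :
    ∀ u v, a ≤ u → u ≤ v → v ≤ b → φ v = φ u := by
  intro u v hu huv hv
  have := sewing_bound (R := fun u v => φ v - φ u) hθ le_rfl h (by intros; simp) u v hu huv hv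
  simpa [sub_eq_zero] using this

/-! ### Riemann-Stieltjes integrals and the Young estimate -/

/-- The sums of a monotone partition of mesh `≤ δ` of quantities `≤ (τ_{k+1} - τ_k) ^ θ` are at
most `δ ^ (θ - 1)` times the length. -/
lemma sum_rpow_le {θ δ a b : ℝ} (hθ : 1 < θ) {n : ℕ} {τ : ℕ → ℝ}
    (h0 : τ 0 = a) (hn : τ n = b) (hτ : ∀ k < n, τ k ≤ τ (k + 1) ∧ τ (k + 1) - τ k ≤ δ) :
    ∑ k ∈ Finset.range n, (τ (k + 1) - τ k) ^ θ ≤ δ ^ (θ - 1) * (b - a) := by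
  calc ∑ k ∈ Finset.range n, (τ (k + 1) - τ k) ^ θ
      ≤ ∑ k ∈ Finset.range n, δ ^ (θ - 1) * (τ (k + 1) - τ k) := by
        apply Finset.sum_le_sum
        intro k hk
        obtain ⟨h1, h2⟩ := hτ k (Finset.mem_range.1 hk)
        rcases h1.eq_or_lt with h | h
        · simp [h, Real.zero_rpow (by linarith : θ ≠ 0)]
        · have hp : 0 < τ (k + 1) - τ k := by linarith
          calc (τ (k + 1) - τ k) ^ θ = (τ (k + 1) - τ k) ^ (θ - 1) * (τ (k + 1) - τ k) := by
                rw [← Real.rpow_add_one hp.ne']; ring_nf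
            _ ≤ _ := by gcongr
    _ = δ ^ (θ - 1) * (b - a) := by rw [← Finset.mul_sum, Finset.sum_range_sub, h0, hn]

lemma partition_mem {a b : ℝ} {n : ℕ} {τ : ℕ → ℝ} (h0 : τ 0 = a) (hn : τ n = b)
    (hτ : ∀ k < n, τ k ≤ τ (k + 1)) : ∀ k ≤ n, τ k ∈ Icc a b := by
  intro k hk
  constructor
  · induction k with
    | zero => exact h0.ge
    | succ k ih => exact (ih (by omega)).trans (hτ k hk)
  · induction hk using Nat.decreasingInduction with
    | self => exact hn.le
    | of_succ k hk ih => exact (hτ k hk).trans ih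

/-- A function whose increments are `f_u (g_v - g_u)` up to order `(v - u) ^ (κ + β)`,
`κ + β > 1`, is the indefinite Riemann-Stieltjes integral of `f` against `g`. -/
lemma hasRSIntegral_of_young {f g I : ℝ → ℝ} {κ β Kf Kg C T : ℝ} (hκ : 0 < κ) (hβ : 0 < β)
    (hκβ : 1 < κ + β)
    (hf : ∀ u v, 0 ≤ u → u ≤ v → v ≤ T → |f v - f u| ≤ Kf * (v - u) ^ κ)
    (hg : ∀ u v, 0 ≤ u → u ≤ v → v ≤ T → |g v - g u| ≤ Kg * (v - u) ^ β)
    (hKf : 0 ≤ Kf) (hKg : 0 ≤ Kg) (hC : 0 ≤ C)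
    (hI : ∀ u v, 0 ≤ u → u ≤ v → v ≤ T →
      |I v - I u - f u * (g v - g u)| ≤ C * (v - u) ^ (κ + β)) (hT : 0 ≤ T) :
    HasRSIntegral f g 0 T (I T - I 0) := by
  intro η hη
  set A := (C + Kf * Kg) * T + 1 with hA
  have hA0 : 0 < A := by positivity
  set δ : ℝ := (η / (2 * A)) ^ ((κ + β - 1)⁻¹) with hδ
  have hδ0 : 0 < δ := by positivity
  have hδA : δ ^ (κ + β - 1) = η / (2 * A) := by
    rw [hδ, ← Real.rpow_mul (by positivity), inv_mul_cancel₀ (by linarith), Real.rpow_one]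
  refine ⟨δ, hδ0, fun n τ ξ h0 hn h => ?_⟩
  have hmem := partition_mem h0 hn fun k hk => (h k hk).1
  have e1 : I T - I 0 = ∑ k ∈ Finset.range n, (I (τ (k + 1)) - I (τ k)) := by
    rw [Finset.sum_range_sub (fun k => I (τ k)), h0, hn]
  rw [e1, ← Finset.sum_sub_distrib]
  calc |∑ k ∈ Finset.range n, (f (ξ k) * (g (τ (k + 1)) - g (τ k)) - (I (τ (k + 1)) - I (τ k)))|
      ≤ ∑ k ∈ Finset.range n,
        |f (ξ k) * (g (τ (k + 1)) - g (τ k)) - (I (τ (k + 1)) - I (τ k))| :=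
        Finset.abs_sum_le_sum_abs _ _
    _ ≤ ∑ k ∈ Finset.range n, (C + Kf * Kg) * (τ (k + 1) - τ k) ^ (κ + β) := by
        apply Finset.sum_le_sum
        intro k hk
        have hk := Finset.mem_range.1 hk
        obtain ⟨h1, ⟨h2, h2'⟩, h3⟩ := h k hk
        have m1 := hmem k hk.le
        have m2 := hmem (k + 1) hk
        have a1 := hI _ _ m1.1 h1 m2.2
        have a2 := hf _ _ m1.1 h2 (h2'.trans m2.2)
        have a3 := hg _ _ m1.1 h1 m2.2
        have a4 : Kf * (ξ k - τ k) ^ κ ≤ Kf * (τ (k + 1) - τ k) ^ κ := by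
          gcongr
        have a5 : |(f (ξ k) - f (τ k)) * (g (τ (k + 1)) - g (τ k))|
            ≤ Kf * (τ (k + 1) - τ k) ^ κ * (Kg * (τ (k + 1) - τ k) ^ β) := by
          rw [abs_mul]
          gcongr
          exact a2.trans a4
        have a6 : (τ (k + 1) - τ k) ^ (κ + β) =
            (τ (k + 1) - τ k) ^ κ * (τ (k + 1) - τ k) ^ β :=
          Real.rpow_add_of_nonneg (by linarith) hκ.le hβ.le
        calc |f (ξ k) * (g (τ (k + 1)) - g (τ k)) - (I (τ (k + 1)) - I (τ k))|
            = |(f (ξ k) - f (τ k)) * (g (τ (k + 1)) - g (τ k)) -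
                (I (τ (k + 1)) - I (τ k) - f (τ k) * (g (τ (k + 1)) - g (τ k)))| := by
              congr 1; ring
          _ ≤ _ := abs_sub _ _
          _ ≤ _ := by rw [a6] at a1 ⊢; linarith
    _ ≤ (C + Kf * Kg) * (δ ^ (κ + β - 1) * (T - 0)) := by
        rw [← Finset.mul_sum]
        gcongr
        exact sum_rpow_le hκβ h0 hn fun k hk => ⟨(h k hk).1, (h k hk).2.2.le⟩
    _ < η := by
        rw [hδA, sub_zero]
        have : (C + Kf * Kg) * T < 2 * A := by linarith
        calc (C + Kf * Kg) * (η / (2 * A) * T) = η * ((C + Kf * Kg) * T / (2 * A)) := by ring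
          _ < η * 1 := by
            gcongr
            rw [div_lt_one (by positivity)]
            exact this
          _ = η := mul_one _

/-- Riemann-Stieltjes integrals over `[0, T]` of integrands that agree off `0` agree: sums
tagged at right end points do not see the value at `0`. -/
lemma HasRSIntegral.unique_of_eq_off_zero {f f' g : ℝ → ℝ} {T J J' : ℝ} (hT : 0 ≤ T)
    (h : HasRSIntegral f g 0 T J) (h' : HasRSIntegral f' g 0 T J')
    (hff : ∀ t, 0 < t → t ≤ T → f t = f' t) : J = J' := by
  by_contra hne
  have hη : 0 < |J - J'| / 2 := by
    have := abs_pos.2 (sub_ne_zero.2 hne); positivity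
  obtain ⟨δ, hδ, H⟩ := h _ hη
  obtain ⟨δ', hδ', H'⟩ := h' _ hη
  obtain ⟨n, hn⟩ := exists_nat_gt (T / min δ δ' + 1)
  have hmin : 0 < min δ δ' := lt_min hδ hδ'
  have hn1 : (1 : ℝ) < n := by
    have : 0 ≤ T / min δ δ' := by positivity
    linarith
  have hn0 : (0 : ℝ) < n := by linarith
  have hmesh : T / n < min δ δ' := by
    rw [div_lt_iff₀ hn0]
    have : T / min δ δ' < n := by linarith
    rw [div_lt_iff₀ hmin] at this
    linarith
  have hstep : ∀ k : ℕ, T * ((k + 1 : ℕ) : ℝ) / n - T * k / n = T / n := by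
    intro k; push_cast; field_simp; ring
  have hTn : 0 ≤ T / n := by positivity
  have A := H n (fun k => T * k / n) (fun k => T * ((k + 1 : ℕ) : ℝ) / n) (by simp)
    (by field_simp) fun k _ => ⟨by linarith [hstep k], ⟨by linarith [hstep k], le_rfl⟩,
      by rw [hstep]; exact hmesh.trans_le (min_le_left _ _)⟩
  have A' := H' n (fun k => T * k / n) (fun k => T * ((k + 1 : ℕ) : ℝ) / n) (by simp)
    (by field_simp) fun k _ => ⟨by linarith [hstep k], ⟨by linarith [hstep k], le_rfl⟩,
      by rw [hstep]; exact hmesh.trans_le (min_le_right _ _)⟩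
  have hsum : ∑ k ∈ Finset.range n, f (T * ((k + 1 : ℕ) : ℝ) / n) *
        (g (T * ((k + 1 : ℕ) : ℝ) / n) - g (T * k / n)) =
      ∑ k ∈ Finset.range n, f' (T * ((k + 1 : ℕ) : ℝ) / n) *
        (g (T * ((k + 1 : ℕ) : ℝ) / n) - g (T * k / n)) := by
    apply Finset.sum_congr rfl
    intro k hk
    rcases hT.eq_or_lt with h0 | hpos
    · simp [← h0]
    · have hk1 : ((k + 1 : ℕ) : ℝ) ≤ n := by exact_mod_cast Finset.mem_range.1 hk
      rw [hff _ (by positivity)]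
      rw [div_le_iff₀ hn0]
      gcongr
  rw [hsum] at A
  have e : |J - J'| < |J - J'| / 2 + |J - J'| / 2 := by
    refine (abs_lt.2 ⟨?_, ?_⟩)
    · linarith [(abs_lt.1 A).2, (abs_lt.1 A').1]
    · linarith [(abs_lt.1 A).1, (abs_lt.1 A').2]
  linarith

/-! ### Coefficients and exponents -/

section Abstract

variable {E V : Type*} [NormedAddCommGroup E] [NormedSpace ℝ E] [NormedAddCommGroup V]
  [NormedSpace ℝ V]

/-- The exponents of a Young equation: the driver is `β`-Hölder, the coefficient `lam`-Hölder in
time with a `γ`-Hölder space derivative, and `κ` is an exponent complementary to `β` with which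
both the coefficient along a `β`-Hölder path and the increments of its derivative are Hölder. -/
structure YoungExponents (β κ lam γ : ℝ) : Prop where
  kappa_pos : 0 < κ
  kappa_le : κ ≤ β
  beta_le : β ≤ 1
  kappa_le_lam : κ ≤ lam
  kappa_le_gamma : κ ≤ γ * β
  one_lt : 1 < κ + β

/-- Conditions on the drift `b` and the diffusion coefficient `S` of a Young equation. The
regularity of the space derivative of `S` enters only through the four-point inequality
`four_point`. -/
structure YoungCoefficients (b : ℝ → E → E) (S : ℝ → E → V →L[ℝ] E) (L M lam γ : ℝ) : Prop where
  L_nonneg : 0 ≤ L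
  M_nonneg : 0 ≤ M
  drift_meas : ∀ x, AEStronglyMeasurable (fun t => b t x) (volume.restrict (Icc (0 : ℝ) 1))
  drift_lip : ∀ t ∈ Icc (0 : ℝ) 1, ∀ x y, ‖b t x - b t y‖ ≤ L * ‖x - y‖
  drift_growth : ∀ t ∈ Icc (0 : ℝ) 1, ∀ x, ‖b t x‖ ≤ L * (1 + ‖x‖)
  space : ∀ t ∈ Icc (0 : ℝ) 1, ∀ x y, ‖S t x - S t y‖ ≤ M * ‖x - y‖
  time : ∀ s ∈ Icc (0 : ℝ) 1, ∀ t ∈ Icc (0 : ℝ) 1, ∀ x, ‖S t x - S s x‖ ≤ M * |t - s| ^ lam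
  growth : ∀ t ∈ Icc (0 : ℝ) 1, ∀ x, ‖S t x‖ ≤ M * (1 + ‖x‖)
  four_point : ∀ N : ℝ, ∃ C, 0 ≤ C ∧ ∀ s ∈ Icc (0 : ℝ) 1, ∀ t ∈ Icc (0 : ℝ) 1, ∀ x y x' y',
    ‖x‖ ≤ N → ‖y‖ ≤ N → ‖x'‖ ≤ N → ‖y'‖ ≤ N →
    ‖(S t x - S t y) - (S s x' - S s y')‖ ≤
      C * (‖(x - y) - (x' - y')‖ + ‖x' - y'‖ * (|t - s| ^ lam + ‖y - y'‖ ^ γ))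

lemma YoungExponents.beta_pos {β κ lam γ : ℝ} (h : YoungExponents β κ lam γ) : 0 < β :=
  h.kappa_pos.trans_le h.kappa_le

lemma rpow_le_rpow_of_le_one {x a c : ℝ} (hx : 0 ≤ x) (hx1 : x ≤ 1) (ha : 0 < a) (h : a ≤ c) :
    x ^ c ≤ x ^ a := by
  rcases hx.eq_or_lt with rfl | hx
  · rw [Real.zero_rpow ha.ne', Real.zero_rpow (by linarith)]
  · exact Real.rpow_le_rpow_of_exponent_ge hx hx1 h

/-- For `l ≤ h`, the power `l ^ c` is at most `h ^ (c - a) * l ^ a`. -/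
lemma rpow_le_rpow_sub_mul {l h a c : ℝ} (hl : 0 ≤ l) (hlh : l ≤ h) (ha : 0 ≤ a) (hac : a ≤ c) :
    l ^ c ≤ h ^ (c - a) * l ^ a := by
  calc l ^ c = l ^ (c - a) * l ^ a := by
        rw [← Real.rpow_add_of_nonneg hl (by linarith) ha]; ring_nf
    _ ≤ _ := by gcongr

/-! ### The a priori estimate -/

/-- A path on a set `T` of times whose increments are those of a drift `D` of linear growth plus
those of a rough part `J` that satisfies the sewing inequality with respect to the germ
`S(u, x_u) (g_v - g_u)`. Solutions of the equation (with `T = [0, 1]`) and Euler schemes (with `T`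
a grid) are both of this form. -/
structure IsSewn (T : Set ℝ) (S : ℝ → E → V →L[ℝ] E) (g : ℝ → V) (x D J : ℝ → E)
    (κ β C L G : ℝ) : Prop where
  sub : T ⊆ Icc 0 1
  decomp : ∀ u ∈ T, ∀ v ∈ T, u ≤ v → x v - x u = (D v - D u) + (J v - J u)
  drift : ∀ u ∈ T, ∀ v ∈ T, u ≤ v → ∀ R, 0 ≤ R → (∀ w ∈ T, u ≤ w → w ≤ v → ‖x w‖ ≤ R) →
    ‖D v - D u‖ ≤ L * (1 + R) * (v - u)
  sew : ∀ u ∈ T, ∀ v ∈ T, u ≤ v → ∀ K, 0 ≤ K →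
    (∀ p ∈ T, ∀ q ∈ T, u ≤ p → p ≤ q → q ≤ v → ‖S q (x q) - S p (x p)‖ ≤ K * (q - p) ^ κ) →
    ‖J v - J u - S u (x u) (g v - g u)‖ ≤ C * K * G * (v - u) ^ (κ + β)

lemma YoungCoefficients.norm_along_le {b : ℝ → E → E} {S : ℝ → E → V →L[ℝ] E}
    {L M lam γ β κ : ℝ} (hS : YoungCoefficients b S L M lam γ) (he : YoungExponents β κ lam γ)
    {x : ℝ → E} {X h p q : ℝ} (hp : p ∈ Icc (0 : ℝ) 1) (hq : q ∈ Icc (0 : ℝ) 1) (hpq : p ≤ q)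
    (hqh : q - p ≤ h) (hX : 0 ≤ X) (hx : ‖x q - x p‖ ≤ X * (q - p) ^ β) :
    ‖S q (x q) - S p (x p)‖ ≤ M * (1 + X * h ^ (β - κ)) * (q - p) ^ κ := by
  have h1 : ‖S q (x q) - S p (x q)‖ ≤ M * (q - p) ^ κ := by
    refine (hS.time p hp q hq _).trans (mul_le_mul_of_nonneg_left ?_ hS.M_nonneg)
    rw [abs_of_nonneg (sub_nonneg.2 hpq)]
    exact rpow_le_rpow_of_le_one (by linarith) (by linarith [hp.1, hq.2]) he.kappa_pos
      he.kappa_le_lam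
  have h2 : ‖S p (x q) - S p (x p)‖ ≤ M * (X * (h ^ (β - κ) * (q - p) ^ κ)) := by
    refine (hS.space p hp _ _).trans (mul_le_mul_of_nonneg_left (hx.trans ?_) hS.M_nonneg)
    exact mul_le_mul_of_nonneg_left
      (rpow_le_rpow_sub_mul (by linarith) hqh he.kappa_pos.le he.kappa_le) hX
  calc ‖S q (x q) - S p (x p)‖ ≤ ‖S q (x q) - S p (x q)‖ + ‖S p (x q) - S p (x p)‖ :=
        norm_sub_le_norm_sub_add_norm_sub _ _ _
    _ ≤ _ := by linarith

/-- On an interval of length `h` with `Q h ^ β ≤ 1/2` the Hölder constant is controlled by the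
starting point. -/
lemma IsSewn.local_bound {T : Set ℝ} {b : ℝ → E → E} {S : ℝ → E → V →L[ℝ] E} {g : ℝ → V}
    {x D J : ℝ → E} {κ β C L M G lam γ X₀ Q h : ℝ}
    (hx : IsSewn T S g x D J κ β C L G) (hS : YoungCoefficients b S L M lam γ)
    (he : YoungExponents β κ lam γ) (hG : 0 ≤ G) (hC : 0 ≤ C)
    (hg : ∀ u ∈ T, ∀ v ∈ T, u ≤ v → ‖g v - g u‖ ≤ G * (v - u) ^ β)
    (hX₀ : 0 ≤ X₀) (hfin : ∀ u ∈ T, ∀ v ∈ T, u ≤ v → ‖x v - x u‖ ≤ X₀ * (v - u) ^ β)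
    (hQ : Q = L + (M + C * M) * G) (hh : 0 ≤ h) (hh1 : h ≤ 1) (hQh : Q * h ^ β ≤ 1 / 2)
    {s : ℝ} (hs : s ∈ T) :
    ∀ u ∈ T, ∀ v ∈ T, s ≤ u → u ≤ v → v ≤ s + h →
      ‖x v - x u‖ ≤ 2 * Q * (1 + ‖x s‖) * (v - u) ^ β := by
  have hL := hS.L_nonneg
  have hM := hS.M_nonneg
  have hQ0 : 0 ≤ Q := by rw [hQ]; positivity
  have hβ := he.beta_pos
  have key := bound_of_self_improving
    (ι := {p : ℝ × ℝ // p.1 ∈ T ∧ p.2 ∈ T ∧ s ≤ p.1 ∧ p.1 ≤ p.2 ∧ p.2 ≤ s + h})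
    (F := fun p => ‖x p.1.2 - x p.1.1‖) (w := fun p => (p.1.2 - p.1.1) ^ β)
    (fun p => Real.rpow_nonneg (by linarith [p.2.2.2.2.1]) _) (a := Q * (1 + ‖x s‖)) (r := 1 / 2)
    (X₀ := X₀) (by positivity) (by norm_num) (by norm_num) hX₀ ?_ ?_
  · intro u hu v hv hsu huv hvh
    refine (key ⟨(u, v), hu, hv, hsu, huv, hvh⟩).trans (le_of_eq ?_)
    ring
  · rintro ⟨⟨u, v⟩, hu, hv, hsu, huv, hvh⟩
    exact hfin u hu v hv huv
  · rintro X hX hP ⟨⟨u, v⟩, hu, hv, hsu, huv, hvh⟩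
    dsimp only at hu hv hsu huv hvh ⊢
    have hXh : 0 ≤ X * h ^ β := by positivity
    set R := ‖x s‖ + X * h ^ β with hR
    have hR0 : 0 ≤ R := by positivity
    have hxR : ∀ w ∈ T, s ≤ w → w ≤ s + h → ‖x w‖ ≤ R := by
      intro w hw h1 h2
      have e := hP ⟨(s, w), hs, hw, le_rfl, h1, h2⟩
      dsimp only at e
      have e2 : X * (w - s) ^ β ≤ X * h ^ β := by
        apply mul_le_mul_of_nonneg_left _ hX
        exact Real.rpow_le_rpow (by linarith) (by linarith) hβ.le
      have e3 : ‖x w‖ ≤ ‖x s‖ + ‖x w - x s‖ := norm_le_insert' _ _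
      linarith
    have hvu : 0 ≤ v - u := sub_nonneg.2 huv
    have hvu1 : v - u ≤ 1 := by linarith
    set l := (v - u) ^ β with hl
    have hl0 : 0 ≤ l := Real.rpow_nonneg hvu _
    have hD : ‖D v - D u‖ ≤ L * (1 + R) * l := by
      refine (hx.drift u hu v hv huv R hR0 fun w hw h1 h2 =>
        hxR w hw (hsu.trans h1) (h2.trans hvh)).trans ?_
      apply mul_le_mul_of_nonneg_left _ (by positivity)
      have := rpow_le_rpow_of_le_one hvu hvu1 hβ he.beta_le
      rwa [Real.rpow_one] at this
    have hJ := hx.sew u hu v hv huv (M * (1 + X * h ^ (β - κ))) (by positivity)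
      fun p hp q hq h1 h2 h3 => hS.norm_along_le he (hx.sub hp) (hx.sub hq) h2 (by linarith) hX
        (hP ⟨(p, q), hp, hq, hsu.trans h1, h2, h3.trans hvh⟩)
    have hJ2 : C * (M * (1 + X * h ^ (β - κ))) * G * (v - u) ^ (κ + β) ≤
        C * M * G * (1 + R) * l := by
      have e1 : (v - u) ^ (κ + β) ≤ h ^ κ * l := by
        have := rpow_le_rpow_sub_mul hvu (by linarith : v - u ≤ h) hβ.le
          (by linarith [he.kappa_pos] : β ≤ κ + β)
        simpa using this
      have e2 : (1 + X * h ^ (β - κ)) * h ^ κ ≤ 1 + R := by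
        have : h ^ (β - κ) * h ^ κ = h ^ β := by
          rw [← Real.rpow_add_of_nonneg hh (by linarith [he.kappa_le]) he.kappa_pos.le]; ring_nf
        have h1 : h ^ κ ≤ 1 := Real.rpow_le_one hh hh1 he.kappa_pos.le
        calc (1 + X * h ^ (β - κ)) * h ^ κ = h ^ κ + X * (h ^ (β - κ) * h ^ κ) := by ring
          _ ≤ 1 + R := by rw [this, hR]; linarith [norm_nonneg (x s)]
      calc C * (M * (1 + X * h ^ (β - κ))) * G * (v - u) ^ (κ + β)
          ≤ C * (M * (1 + X * h ^ (β - κ))) * G * (h ^ κ * l) := by gcongr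
        _ = C * M * G * ((1 + X * h ^ (β - κ)) * h ^ κ) * l := by ring
        _ ≤ _ := by gcongr
    have hA : ‖S u (x u) (g v - g u)‖ ≤ M * G * (1 + R) * l := by
      calc ‖S u (x u) (g v - g u)‖ ≤ ‖S u (x u)‖ * ‖g v - g u‖ := (S u (x u)).le_opNorm _
        _ ≤ (M * (1 + R)) * (G * l) := by
          gcongr
          · exact (hS.growth u (hx.sub hu) _).trans (by gcongr; exact hxR u hu hsu (huv.trans hvh))
          · exact hg u hu v hv huv
        _ = _ := by ring
    have hsum : ‖x v - x u‖ ≤ ‖D v - D u‖ + ‖J v - J u - S u (x u) (g v - g u)‖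
        + ‖S u (x u) (g v - g u)‖ := by
      rw [hx.decomp u hu v hv huv]
      calc _ = ‖(D v - D u) + (J v - J u - S u (x u) (g v - g u)) + S u (x u) (g v - g u)‖ := by
            congr 1; abel
        _ ≤ _ := norm_add₃_le
    calc ‖x v - x u‖ ≤ Q * (1 + R) * l := by rw [hQ]; linarith
      _ = (Q * (1 + ‖x s‖) + Q * h ^ β * X) * l := by rw [hR]; ring
      _ ≤ (Q * (1 + ‖x s‖) + 1 / 2 * X) * l := by gcongr

/-- The bound for the Hölder constant relative to `1 + ‖x₀‖`; it grows like `exp (c Q ^ (1/β))`. -/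
noncomputable def aprioriC (β Q : ℝ) : ℝ := (4 * Q + 4) * 2 ^ ⌈2 * (2 * Q + 2) ^ (1 / β)⌉₊

/-- The length of the intervals on which the local bound applies. -/
noncomputable def stepLen (β Q : ℝ) : ℝ := ((2 * Q + 2) ^ (1 / β))⁻¹

lemma stepLen_pos {β Q : ℝ} (hQ : 0 ≤ Q) : 0 < stepLen β Q := by
  rw [stepLen]; positivity

lemma stepLen_rpow {β Q : ℝ} (hβ : 0 < β) (hQ : 0 ≤ Q) : stepLen β Q ^ β = (2 * Q + 2)⁻¹ := by
  rw [stepLen, Real.inv_rpow (by positivity), ← Real.rpow_mul (by positivity),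
    one_div_mul_cancel hβ.ne', Real.rpow_one]

lemma stepLen_le_one {β Q : ℝ} (hβ : 0 < β) (hQ : 0 ≤ Q) : stepLen β Q ≤ 1 := by
  rw [stepLen]
  exact inv_le_one_of_one_le₀ (Real.one_le_rpow (by linarith) (by positivity))

/-- The a priori estimate: on each interval of length `h ~ Q ^ (-1/β)` the quantity `1 + ‖x‖` at
most doubles, and about `1 / h` such intervals cover `[0, 1]`. -/
lemma IsSewn.global_bound {T : Set ℝ} {b : ℝ → E → E} {S : ℝ → E → V →L[ℝ] E} {g : ℝ → V}
    {x D J : ℝ → E} {κ β C L M G lam γ X₀ Q : ℝ}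
    (hx : IsSewn T S g x D J κ β C L G) (hS : YoungCoefficients b S L M lam γ)
    (he : YoungExponents β κ lam γ) (hG : 0 ≤ G) (hC : 0 ≤ C)
    (hg : ∀ u ∈ T, ∀ v ∈ T, u ≤ v → ‖g v - g u‖ ≤ G * (v - u) ^ β)
    (hX₀ : 0 ≤ X₀) (hfin : ∀ u ∈ T, ∀ v ∈ T, u ≤ v → ‖x v - x u‖ ≤ X₀ * (v - u) ^ β)
    (hQ : Q = L + (M + C * M) * G) (h0 : 0 ∈ T)
    (hdense : ∀ a, 0 ≤ a → a + stepLen β Q / 2 ≤ 1 → ∃ s ∈ T, a ≤ s ∧ s ≤ a + stepLen β Q / 2) :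
    (∀ u ∈ T, ∀ v ∈ T, u ≤ v →
      ‖x v - x u‖ ≤ aprioriC β Q * (1 + ‖x 0‖) * (v - u) ^ β) ∧
    ∀ u ∈ T, ‖x u‖ ≤ aprioriC β Q * (1 + ‖x 0‖) := by
  have hL := hS.L_nonneg
  have hM := hS.M_nonneg
  have hQ0 : 0 ≤ Q := by rw [hQ]; positivity
  have hβ := he.beta_pos
  set h := stepLen β Q with hh
  have hpos : 0 < h := stepLen_pos hQ0
  have hle : h ≤ 1 := stepLen_le_one hβ hQ0
  have hhβ : h ^ β = (2 * Q + 2)⁻¹ := stepLen_rpow hβ hQ0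
  have hQh : Q * h ^ β ≤ 1 / 2 := by
    rw [hhβ, ← div_eq_mul_inv, div_le_div_iff₀ (by positivity) (by norm_num)]; linarith
  have hloc := fun s (hs : s ∈ T) => hx.local_bound hS he hG hC hg hX₀ hfin hQ hpos.le hle hQh hs
  have hdouble : ∀ s ∈ T, ∀ t ∈ T, s ≤ t → t ≤ s + h → 1 + ‖x t‖ ≤ 2 * (1 + ‖x s‖) := by
    intro s hs t ht hst hth
    have e := hloc s hs s hs t ht le_rfl hst hth
    have e1 : (t - s) ^ β ≤ h ^ β := Real.rpow_le_rpow (by linarith) (by linarith) hβ.le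
    have e2 : 2 * Q * (1 + ‖x s‖) * (t - s) ^ β ≤ 1 + ‖x s‖ := by
      calc 2 * Q * (1 + ‖x s‖) * (t - s) ^ β ≤ 2 * Q * (1 + ‖x s‖) * h ^ β := by gcongr
        _ = 2 * (Q * h ^ β) * (1 + ‖x s‖) := by ring
        _ ≤ 2 * (1 / 2) * (1 + ‖x s‖) := by gcongr
        _ = _ := by ring
    have e3 : ‖x t‖ ≤ ‖x s‖ + ‖x t - x s‖ := norm_le_insert' _ _
    linarith
  have hind : ∀ k : ℕ, ∀ t ∈ T, t ≤ k * (h / 2) → 1 + ‖x t‖ ≤ 2 ^ k * (1 + ‖x 0‖) := by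
    intro k
    induction k with
    | zero =>
      intro t ht h1
      have : t = 0 := le_antisymm (by simpa using h1) (hx.sub ht).1
      simp [this]
    | succ k ih =>
      intro t ht h1
      obtain ⟨s, hs, hst, hsk, hts⟩ : ∃ s ∈ T, s ≤ t ∧ s ≤ k * (h / 2) ∧ t ≤ s + h := by
        by_cases hk : t ≤ k * (h / 2)
        · exact ⟨t, ht, le_rfl, hk, by linarith⟩
        push Not at hk
        rcases Nat.eq_zero_or_pos k with rfl | hk0
        · exact ⟨0, h0, (hx.sub ht).1, by simp, by push_cast at h1; linarith⟩
        · have hk1 : (1 : ℝ) ≤ k := by exact_mod_cast hk0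
          obtain ⟨s, hs, h2, h3⟩ := hdense ((k - 1) * (h / 2))
            (mul_nonneg (by linarith) (by linarith)) (by linarith [(hx.sub ht).2])
          exact ⟨s, hs, by linarith, by linarith, by push_cast at h1; linarith⟩
      calc 1 + ‖x t‖ ≤ 2 * (1 + ‖x s‖) := hdouble s hs t ht hst hts
        _ ≤ 2 * (2 ^ k * (1 + ‖x 0‖)) := by gcongr; exact ih s hs hsk
        _ = _ := by ring
  set k := ⌈2 * (2 * Q + 2) ^ (1 / β)⌉₊ with hk
  have hkh : 1 ≤ k * (h / 2) := by
    have e : 2 * (2 * Q + 2) ^ (1 / β) ≤ (k : ℝ) := Nat.le_ceil _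
    have e2 : (2 * (2 * Q + 2) ^ (1 / β)) * (h / 2) = 1 := by
      rw [hh, stepLen]; field_simp
    calc (1 : ℝ) = (2 * (2 * Q + 2) ^ (1 / β)) * (h / 2) := e2.symm
      _ ≤ _ := by gcongr
  have hsup : ∀ t ∈ T, 1 + ‖x t‖ ≤ 2 ^ k * (1 + ‖x 0‖) :=
    fun t ht => hind k t ht ((hx.sub ht).2.trans hkh)
  have hA : aprioriC β Q = (4 * Q + 4) * 2 ^ k := rfl
  refine ⟨fun u hu v hv huv => ?_, fun u hu => ?_⟩
  · have hl0 : 0 ≤ (v - u) ^ β := Real.rpow_nonneg (by linarith) _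
    by_cases hvu : v ≤ u + h
    · calc ‖x v - x u‖ ≤ 2 * Q * (1 + ‖x u‖) * (v - u) ^ β := hloc u hu u hu v hv le_rfl huv hvu
        _ ≤ 2 * Q * (2 ^ k * (1 + ‖x 0‖)) * (v - u) ^ β := by gcongr; exact hsup u hu
        _ ≤ (4 * Q + 4) * (2 ^ k * (1 + ‖x 0‖)) * (v - u) ^ β := by gcongr; linarith
        _ = _ := by rw [hA]; ring
    · push Not at hvu
      have e1 : (2 * Q + 2)⁻¹ ≤ (v - u) ^ β := by
        rw [← hhβ]; exact Real.rpow_le_rpow hpos.le (by linarith) hβ.le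
      have e2 : 1 ≤ (2 * Q + 2) * (v - u) ^ β := by
        rwa [inv_le_iff_one_le_mul₀' (by positivity)] at e1
      calc ‖x v - x u‖ ≤ ‖x v‖ + ‖x u‖ := norm_sub_le _ _
        _ ≤ 2 * (2 ^ k * (1 + ‖x 0‖)) * 1 := by linarith [hsup u hu, hsup v hv]
        _ ≤ 2 * (2 ^ k * (1 + ‖x 0‖)) * ((2 * Q + 2) * (v - u) ^ β) := by gcongr
        _ = _ := by rw [hA]; ring
  · calc ‖x u‖ ≤ 1 * (2 ^ k * (1 + ‖x 0‖)) := by linarith [hsup u hu]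
      _ ≤ (4 * Q + 4) * (2 ^ k * (1 + ‖x 0‖)) := by gcongr; linarith
      _ = _ := by rw [hA]; ring

/-! ### The drift along a path -/

/-- A drift that is measurable in time and Lipschitz in space is measurable along a measurable
path. -/
lemma YoungCoefficients.aestronglyMeasurable_drift {b : ℝ → E → E} {S : ℝ → E → V →L[ℝ] E}
    {L M lam γ : ℝ} (hS : YoungCoefficients b S L M lam γ) {x : ℝ → E}
    (hx : AEStronglyMeasurable x (volume.restrict (Icc (0 : ℝ) 1))) :
    AEStronglyMeasurable (fun t => b t (x t)) (volume.restrict (Icc (0 : ℝ) 1)) := by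
  have hsimple : ∀ φ : SimpleFunc ℝ E,
      AEStronglyMeasurable (fun t => b t (φ t)) (volume.restrict (Icc (0 : ℝ) 1)) := by
    intro φ
    have e : (fun t => b t (φ t)) =
        fun t => ∑ c ∈ φ.range, (φ ⁻¹' {c}).indicator (fun t => b t c) t := by
      ext t
      rw [Finset.sum_eq_single (φ t)]
      · simp [indicator]
      · intro c _ hc
        simp [indicator, hc.symm]
      · intro h
        exact absurd (SimpleFunc.mem_range_self φ t) h
    rw [e]
    exact Finset.aestronglyMeasurable_fun_sum _ fun c _ =>
      (hS.drift_meas c).indicator (φ.measurableSet_fiber c)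
  refine aestronglyMeasurable_of_tendsto_ae (u := atTop)
    (f := fun n t => b t (hx.stronglyMeasurable_mk.approx n t)) (fun n => hsimple _) ?_
  filter_upwards [hx.ae_eq_mk, ae_restrict_mem measurableSet_Icc] with t ht hmem
  rw [ht]
  have h1 := hx.stronglyMeasurable_mk.tendsto_approx t
  rw [tendsto_iff_norm_sub_tendsto_zero] at h1 ⊢
  refine squeeze_zero (fun _ => norm_nonneg _) (fun n => hS.drift_lip t hmem _ _) ?_
  simpa using h1.const_mul L

lemma YoungCoefficients.intervalIntegrable_drift {b : ℝ → E → E} {S : ℝ → E → V →L[ℝ] E}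
    {L M lam γ : ℝ} (hS : YoungCoefficients b S L M lam γ) {x : ℝ → E}
    (hx : AEStronglyMeasurable x (volume.restrict (Icc (0 : ℝ) 1))) {N : ℝ}
    (hN : ∀ t ∈ Icc (0 : ℝ) 1, ‖x t‖ ≤ N) {u v : ℝ} (hu : u ∈ Icc (0 : ℝ) 1)
    (hv : v ∈ Icc (0 : ℝ) 1) : IntervalIntegrable (fun t => b t (x t)) volume u v := by
  have h : IntegrableOn (fun t => b t (x t)) (Icc (0 : ℝ) 1) := by
    refine Integrable.of_bound (hS.aestronglyMeasurable_drift hx) (L * (1 + N)) ?_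
    filter_upwards [ae_restrict_mem measurableSet_Icc] with t ht
    refine (hS.drift_growth t ht _).trans (mul_le_mul_of_nonneg_left ?_ hS.L_nonneg)
    linarith [hN t ht]
  rw [intervalIntegrable_iff]
  refine h.mono_set (uIoc_subset_uIcc.trans ?_)
  rw [← uIcc_of_le zero_le_one] at hu hv ⊢
  exact uIcc_subset_uIcc hu hv

lemma YoungCoefficients.intervalIntegrable_const {b : ℝ → E → E} {S : ℝ → E → V →L[ℝ] E}
    {L M lam γ : ℝ} (hS : YoungCoefficients b S L M lam γ) (y : E) {u v : ℝ}
    (hu : u ∈ Icc (0 : ℝ) 1) (hv : v ∈ Icc (0 : ℝ) 1) :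
    IntervalIntegrable (fun t => b t y) volume u v :=
  hS.intervalIntegrable_drift (x := fun _ => y) aestronglyMeasurable_const (N := ‖y‖)
    (fun _ _ => le_rfl) hu hv

lemma norm_integral_le_mul_sub {f : ℝ → E} {c u v : ℝ} (huv : u ≤ v)
    (h : ∀ r, u ≤ r → r ≤ v → ‖f r‖ ≤ c) : ‖∫ r in u..v, f r‖ ≤ c * (v - u) := by
  have := intervalIntegral.norm_integral_le_of_norm_le_const (a := u) (b := v) (f := f) (C := c)
    fun r hr => by
      rw [uIoc_of_le huv] at hr
      exact h r hr.1.le hr.2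
  rwa [abs_of_nonneg (sub_nonneg.2 huv)] at this

/-! ### The Euler scheme -/

/-- The Euler scheme with step `1 / n`: the coefficients are frozen at the left end point of each
step, the drift being integrated exactly in its time variable. -/
noncomputable def euler (b : ℝ → E → E) (S : ℝ → E → V →L[ℝ] E) (x₀ : E) (g : ℝ → V) (n : ℕ) :
    ℕ → E
  | 0 => x₀
  | k + 1 => euler b S x₀ g n k +
      ((∫ r in (k / n : ℝ)..((k + 1 : ℕ) / n : ℝ), b r (euler b S x₀ g n k)) +
        S (k / n) (euler b S x₀ g n k) (g ((k + 1 : ℕ) / n) - g (k / n)))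

/-- The step function through the points of the Euler scheme. -/
noncomputable def eulerPath (b : ℝ → E → E) (S : ℝ → E → V →L[ℝ] E) (x₀ : E) (g : ℝ → V) (n : ℕ)
    (t : ℝ) : E := euler b S x₀ g n ⌊n * t⌋₊

/-- The grid `{0, 1/n, …, 1}`. -/
def grid (n : ℕ) : Set ℝ := {t | ∃ k : ℕ, k ≤ n ∧ t = k / n}

lemma floor_grid {n : ℕ} (hn : 0 < n) (k : ℕ) : ⌊(n : ℝ) * (k / n)⌋₊ = k := by
  have : (n : ℝ) ≠ 0 := by positivity
  rw [mul_div_cancel₀ _ this, Nat.floor_natCast]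

lemma grid_point_mem {n k : ℕ} (hn : 0 < n) (hk : k ≤ n) : (k / n : ℝ) ∈ Icc (0 : ℝ) 1 := by
  refine ⟨by positivity, ?_⟩
  rw [div_le_one (by positivity)]
  exact_mod_cast hk

lemma grid_le_iff {n : ℕ} (hn : 0 < n) {k l : ℕ} : (k / n : ℝ) ≤ l / n ↔ k ≤ l := by
  rw [div_le_div_iff_of_pos_right (by positivity), Nat.cast_le]

lemma euler_eq_sum (b : ℝ → E → E) (S : ℝ → E → V →L[ℝ] E) (x₀ : E) (g : ℝ → V) (n k : ℕ) :
    euler b S x₀ g n k = x₀ +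
      (∑ l ∈ Finset.range k, ∫ r in (l / n : ℝ)..((l + 1 : ℕ) / n : ℝ), b r (euler b S x₀ g n l)) +
      ∑ l ∈ Finset.range k, S (l / n) (euler b S x₀ g n l) (g ((l + 1 : ℕ) / n) - g (l / n)) := by
  induction k with
  | zero => simp [euler]
  | succ k ih =>
    rw [Finset.sum_range_succ, Finset.sum_range_succ, euler]
    nth_rewrite 1 [ih]
    abel

lemma sum_range_sub_sum_range {A : Type*} [AddCommGroup A] (f : ℕ → A) {i j : ℕ} (hij : i ≤ j) :
    ∑ l ∈ Finset.range j, f l - ∑ l ∈ Finset.range i, f l = ∑ l ∈ Finset.Ico i j, f l :=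
  (Finset.sum_Ico_eq_sub f hij).symm

lemma norm_sum_Ico_le {A : Type*} [SeminormedAddCommGroup A] {f : ℕ → A} {c : ℝ} {i j : ℕ}
    (hij : i ≤ j) (h : ∀ l, i ≤ l → l < j → ‖f l‖ ≤ c) :
    ‖∑ l ∈ Finset.Ico i j, f l‖ ≤ c * ((j : ℝ) - i) := by
  refine (norm_sum_le_of_le _ fun l hl =>
    h l (Finset.mem_Ico.1 hl).1 (Finset.mem_Ico.1 hl).2).trans ?_
  rw [Finset.sum_const, Nat.card_Ico, nsmul_eq_mul, Nat.cast_sub hij, mul_comm]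

/-- The Euler scheme satisfies the sewing inequality on its grid, by the discrete sewing
lemma. -/
lemma isSewn_euler {b : ℝ → E → E} {S : ℝ → E → V →L[ℝ] E} {L M lam γ β κ G : ℝ}
    (hS : YoungCoefficients b S L M lam γ) (he : YoungExponents β κ lam γ) (hG : 0 ≤ G) {g : ℝ → V}
    (hg : ∀ u v, 0 ≤ u → u ≤ v → v ≤ 1 → ‖g v - g u‖ ≤ G * (v - u) ^ β) (x₀ : E) {n : ℕ}
    (hn : 0 < n) :
    IsSewn (grid n) S g (eulerPath b S x₀ g n)
      (fun t => ∑ l ∈ Finset.range ⌊n * t⌋₊,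
        ∫ r in (l / n : ℝ)..((l + 1 : ℕ) / n : ℝ), b r (euler b S x₀ g n l))
      (fun t => ∑ l ∈ Finset.range ⌊n * t⌋₊,
        S (l / n) (euler b S x₀ g n l) (g ((l + 1 : ℕ) / n) - g (l / n)))
      κ β (sewC (κ + β)) L G := by
  have hnr : (0 : ℝ) < n := by positivity
  refine ⟨?_, ?_, ?_, ?_⟩
  · rintro _ ⟨k, hk, rfl⟩
    exact grid_point_mem hn hk
  · intro u _ v _ _
    rw [eulerPath, eulerPath, euler_eq_sum, euler_eq_sum b S x₀ g n ⌊n * u⌋₊]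
    abel
  · rintro _ ⟨i, hi, rfl⟩ _ ⟨j, hj, rfl⟩ hij R hR hx
    rw [grid_le_iff hn] at hij
    simp only [floor_grid hn]
    rw [sum_range_sub_sum_range _ hij]
    refine (norm_sum_Ico_le (c := L * (1 + R) * (1 / n)) hij
      fun l hil hlj => ?_).trans (le_of_eq ?_)
    · have e : ((l + 1 : ℕ) / n : ℝ) - l / n = 1 / n := by push_cast; ring
      rw [← e]
      refine norm_integral_le_mul_sub ((grid_le_iff hn).2 (by omega)) fun r h1 h2 => ?_
      have m1 := grid_point_mem hn (show l ≤ n by omega)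
      have m2 := grid_point_mem hn (show l + 1 ≤ n by omega)
      refine (hS.drift_growth r ⟨m1.1.trans h1, h2.trans m2.2⟩ _).trans ?_
      have hxl := hx (l / n) ⟨l, by omega, rfl⟩ ((grid_le_iff hn).2 hil)
        ((grid_le_iff hn).2 hlj.le)
      rw [eulerPath, floor_grid hn] at hxl
      have := hS.L_nonneg
      gcongr
    · field_simp
  · rintro _ ⟨i, hi, rfl⟩ _ ⟨j, hj, rfl⟩ hij K hK hx
    rw [grid_le_iff hn] at hij
    simp only [floor_grid hn, eulerPath]
    set Y := euler b S x₀ g n with hY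
    have key := discrete_sewing (θ := κ + β) (K := K * G * (1 / n) ^ (κ + β)) (a := i) (b := j)
      (R := fun p q => ∑ l ∈ Finset.range q, S (l / n) (Y l) (g ((l + 1 : ℕ) / n) - g (l / n)) -
        ∑ l ∈ Finset.range p, S (l / n) (Y l) (g ((l + 1 : ℕ) / n) - g (l / n)) -
        S (p / n) (Y p) (g (q / n) - g (p / n))) he.one_lt (by positivity)
      (fun k _ _ => by rw [Finset.sum_range_succ]; abel) (fun p q r hp hpq hqr hr => ?_)
      i j le_rfl hij le_rfl
    · refine key.trans (le_of_eq ?_)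
      have e : (j / n - i / n : ℝ) = (1 / n) * ((j : ℝ) - i) := by ring
      rw [e, Real.mul_rpow (by positivity) (by simpa using hij)]
      ring
    · have hnn : (0 : ℝ) ≤ 1 / n := by positivity
      have e1 := hx (p / n) ⟨p, by omega, rfl⟩ (q / n) ⟨q, by omega, rfl⟩
        ((grid_le_iff hn).2 hp) ((grid_le_iff hn).2 hpq) ((grid_le_iff hn).2 (by omega))
      simp only [floor_grid hn, eulerPath] at e1
      have e2 := hg (q / n) (r / n) (by positivity) ((grid_le_iff hn).2 hqr)
        (grid_point_mem hn (by omega)).2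
      have hpq' : (p : ℝ) ≤ q := by exact_mod_cast hpq
      have hqr' : (q : ℝ) ≤ r := by exact_mod_cast hqr
      have hκ := he.kappa_pos
      have hβ := he.beta_pos
      have e3 : ((q / n : ℝ) - p / n) ^ κ ≤ (1 / n * ((r : ℝ) - p)) ^ κ := by
        apply Real.rpow_le_rpow _ _ hκ.le
        · rw [sub_nonneg, grid_le_iff hn]; exact hpq
        · rw [← sub_div, div_eq_mul_one_div, mul_comm]; gcongr
      have e4 : ((r / n : ℝ) - q / n) ^ β ≤ (1 / n * ((r : ℝ) - p)) ^ β := by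
        apply Real.rpow_le_rpow _ _ hβ.le
        · rw [sub_nonneg, grid_le_iff hn]; exact hqr
        · rw [← sub_div, div_eq_mul_one_div, mul_comm]; gcongr
      have hrp : (0 : ℝ) ≤ (r : ℝ) - p := by linarith
      calc _ = ‖(S (q / n) (Y q) - S (p / n) (Y p)) (g (r / n) - g (q / n))‖ := by
            congr 1
            simp only [map_sub, sub_apply]
            abel
        _ ≤ ‖S (q / n) (Y q) - S (p / n) (Y p)‖ * ‖g (r / n) - g (q / n)‖ :=
            ContinuousLinearMap.le_opNorm _ _
        _ ≤ (K * (1 / n * ((r : ℝ) - p)) ^ κ) * (G * (1 / n * ((r : ℝ) - p)) ^ β) := by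
            gcongr
            · exact e1.trans (by gcongr)
            · exact e2.trans (by gcongr)
        _ = K * G * (1 / n * ((r : ℝ) - p)) ^ (κ + β) := by
            rw [Real.rpow_add_of_nonneg (by positivity) hκ.le hβ.le]; ring
        _ = K * G * (1 / n) ^ (κ + β) * ((r : ℝ) - p) ^ (κ + β) := by
            rw [Real.mul_rpow hnn hrp]; ring

/-- Bounds for the Euler schemes that are uniform in the step. -/
lemma euler_bounds {b : ℝ → E → E} {S : ℝ → E → V →L[ℝ] E} {L M lam γ β κ G : ℝ}
    (hS : YoungCoefficients b S L M lam γ) (he : YoungExponents β κ lam γ) (hG : 0 ≤ G) {g : ℝ → V}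
    (hg : ∀ u v, 0 ≤ u → u ≤ v → v ≤ 1 → ‖g v - g u‖ ≤ G * (v - u) ^ β) (x₀ : E) :
    ∃ X C : ℝ, ∃ n₀ : ℕ, 0 ≤ X ∧ 0 < n₀ ∧ ∀ n, n₀ ≤ n → ∀ u ∈ grid n, ∀ v ∈ grid n, u ≤ v →
      ‖eulerPath b S x₀ g n u‖ ≤ X ∧
      ‖eulerPath b S x₀ g n v - eulerPath b S x₀ g n u‖ ≤ X * (v - u) ^ β ∧
      ‖eulerPath b S x₀ g n v - eulerPath b S x₀ g n u
        - (∫ r in u..v, b r (eulerPath b S x₀ g n u))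
        - S u (eulerPath b S x₀ g n u) (g v - g u)‖ ≤ C * (v - u) ^ (κ + β) := by
  have hL := hS.L_nonneg
  have hM := hS.M_nonneg
  have hβ := he.beta_pos
  have hsC := (sewC_pos he.one_lt).le
  set Q := L + (M + sewC (κ + β) * M) * G with hQ
  have hQ0 : 0 ≤ Q := by positivity
  set h := stepLen β Q with hh
  have hpos : 0 < h := stepLen_pos hQ0
  set X := aprioriC β Q * (1 + ‖x₀‖) with hXdef
  have hX0 : 0 ≤ X := by rw [hXdef, aprioriC]; positivity
  obtain ⟨n₀, hn₀⟩ := exists_nat_gt (2 / h)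
  have hn₀pos : 0 < n₀ := by
    have : (0 : ℝ) < n₀ := lt_trans (by positivity) hn₀
    exact_mod_cast this
  refine ⟨X, L * X + sewC (κ + β) * (M * (1 + X)) * G, n₀, hX0, hn₀pos, fun n hn => ?_⟩
  have hnpos : 0 < n := by omega
  have hnr : (0 : ℝ) < n := by positivity
  have hsewn := isSewn_euler hS he hG hg x₀ hnpos
  set Y := euler b S x₀ g n with hY
  -- on the finite grid some Hölder bound holds trivially
  obtain ⟨X₁, hX₁, hfin⟩ : ∃ X₁, 0 ≤ X₁ ∧ ∀ u ∈ grid n, ∀ v ∈ grid n, u ≤ v →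
      ‖eulerPath b S x₀ g n v - eulerPath b S x₀ g n u‖ ≤ X₁ * (v - u) ^ β := by
    refine ⟨(∑ k ∈ Finset.range (n + 1), ‖Y k‖) * 2 * (n : ℝ) ^ β, by positivity, ?_⟩
    rintro _ ⟨i, hi, rfl⟩ _ ⟨j, hj, rfl⟩ hij
    rw [grid_le_iff hnpos] at hij
    simp only [eulerPath, floor_grid hnpos]
    rcases hij.eq_or_lt with rfl | hlt
    · simp [Real.zero_rpow hβ.ne']
    have hs : ∀ k ≤ n, ‖Y k‖ ≤ ∑ k ∈ Finset.range (n + 1), ‖Y k‖ := fun k hk =>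
      Finset.single_le_sum (f := fun k => ‖Y k‖) (fun _ _ => norm_nonneg _)
        (Finset.mem_range.2 (by omega))
    have e1 : 1 ≤ (n : ℝ) ^ β * ((j : ℝ) / n - i / n) ^ β := by
      have h1 : (i : ℝ) + 1 ≤ j := by exact_mod_cast hlt
      rw [← Real.mul_rpow (by positivity) (by rw [← sub_div]; apply div_nonneg <;> linarith)]
      apply Real.one_le_rpow _ hβ.le
      field_simp
      linarith
    calc ‖Y j - Y i‖ ≤ ‖Y j‖ + ‖Y i‖ := norm_sub_le _ _
      _ ≤ (∑ k ∈ Finset.range (n + 1), ‖Y k‖) * 2 * 1 := by linarith [hs i hi, hs j hj]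
      _ ≤ (∑ k ∈ Finset.range (n + 1), ‖Y k‖) * 2 * ((n : ℝ) ^ β * ((j : ℝ) / n - i / n) ^ β) := by
        gcongr
      _ = _ := by ring
  have hdense : ∀ a, 0 ≤ a → a + h / 2 ≤ 1 → ∃ s ∈ grid n, a ≤ s ∧ s ≤ a + h / 2 := by
    intro a ha hah
    have hn2 : 1 / (n : ℝ) ≤ h / 2 := by
      have h1 : 2 / h < n := hn₀.trans_le (by exact_mod_cast hn)
      rw [div_lt_iff₀ hpos] at h1
      rw [div_le_div_iff₀ hnr (by norm_num)]
      linarith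
    have h2 : (⌈(n : ℝ) * a⌉₊ : ℝ) / n ≤ a + h / 2 := by
      calc (⌈(n : ℝ) * a⌉₊ : ℝ) / n ≤ (n * a + 1) / n := by
            gcongr; exact (Nat.ceil_lt_add_one (by positivity)).le
        _ = a + 1 / n := by field_simp
        _ ≤ _ := by linarith
    refine ⟨(⌈(n : ℝ) * a⌉₊ : ℝ) / n, ⟨_, ?_, rfl⟩, ?_, h2⟩
    · have := h2.trans hah
      rw [div_le_one hnr] at this
      exact_mod_cast this
    · rw [le_div_iff₀ hnr, mul_comm]
      exact Nat.le_ceil _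
  have h0 : (0 : ℝ) ∈ grid n := ⟨0, by omega, by simp⟩
  obtain ⟨hhol, hbd⟩ := hsewn.global_bound hS he hG hsC
    (fun u hu v hv huv => hg u v (hsewn.sub hu).1 huv (hsewn.sub hv).2) hX₁ hfin hQ h0 hdense
  have hx0 : eulerPath b S x₀ g n 0 = x₀ := by simp [eulerPath, euler]
  rw [hx0, ← hXdef] at hhol hbd
  intro u hu v hv huv
  refine ⟨hbd u hu, hhol u hu v hv huv, ?_⟩
  have hJ := hsewn.sew u hu v hv huv (M * (1 + X)) (by positivity) fun p hp q hq h1 h2 h3 => by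
    have := hS.norm_along_le he (h := 1) (hsewn.sub hp) (hsewn.sub hq) h2
      (by linarith [(hsewn.sub hp).1, (hsewn.sub hq).2]) hX0 (hhol p hp q hq h2)
    simpa using this
  have hvu : 0 ≤ v - u := by linarith
  have hvu1 : v - u ≤ 1 := by linarith [(hsewn.sub hu).1, (hsewn.sub hv).2]
  have hdec := hsewn.decomp u hu v hv huv
  -- the drift differs from the frozen one by a term of order `(v - u) ^ (1 + β)`
  have hD : ‖(∑ l ∈ Finset.range ⌊n * v⌋₊,
        ∫ r in (l / n : ℝ)..((l + 1 : ℕ) / n : ℝ), b r (Y l)) -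
      (∑ l ∈ Finset.range ⌊n * u⌋₊,
        ∫ r in (l / n : ℝ)..((l + 1 : ℕ) / n : ℝ), b r (Y l)) -
      ∫ r in u..v, b r (eulerPath b S x₀ g n u)‖ ≤ L * X * (v - u) ^ (κ + β) := by
    have e0 : (v - u) ^ (1 + β) ≤ (v - u) ^ (κ + β) :=
      rpow_le_rpow_of_le_one hvu hvu1 (by linarith [he.one_lt])
        (by linarith [he.kappa_le, he.beta_le])
    refine le_trans ?_ (mul_le_mul_of_nonneg_left e0 (by positivity))
    obtain ⟨i, hi, rfl⟩ := hu
    obtain ⟨j, hj, rfl⟩ := hv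
    have hij := (grid_le_iff hnpos).1 huv
    simp only [floor_grid hnpos, eulerPath]
    rw [sum_range_sub_sum_range _ hij]
    have e1 : (∫ r in (i / n : ℝ)..(j / n : ℝ), b r (Y i)) =
        ∑ l ∈ Finset.Ico i j, ∫ r in (l / n : ℝ)..((l + 1 : ℕ) / n : ℝ), b r (Y i) := by
      rw [intervalIntegral.sum_integral_adjacent_intervals_Ico (a := fun l : ℕ => (l / n : ℝ)) hij]
      intro k hk
      exact hS.intervalIntegrable_const _
        (grid_point_mem hnpos (show k ≤ n by have := hk.2; omega))
        (grid_point_mem hnpos (show k + 1 ≤ n by have := hk.2; omega))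
    change ‖(∑ l ∈ Finset.Ico i j, ∫ r in (l / n : ℝ)..((l + 1 : ℕ) / n : ℝ), b r (Y l)) -
      ∫ r in (i / n : ℝ)..(j / n : ℝ), b r (Y i)‖ ≤ _
    rw [e1, ← Finset.sum_sub_distrib]
    refine (norm_sum_Ico_le (c := L * (X * ((j : ℝ) / n - i / n) ^ β) * (1 / n)) hij
      fun l hil hlj => ?_).trans (le_of_eq ?_)
    · have m1 := grid_point_mem hnpos (show l ≤ n by omega)
      have m2 := grid_point_mem hnpos (show l + 1 ≤ n by omega)
      rw [← intervalIntegral.integral_sub (hS.intervalIntegrable_const _ m1 m2)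
        (hS.intervalIntegrable_const _ m1 m2)]
      have e : ((l + 1 : ℕ) / n : ℝ) - l / n = 1 / n := by push_cast; ring
      rw [← e]
      refine norm_integral_le_mul_sub ((grid_le_iff hnpos).2 (by omega)) fun r h1 h2 => ?_
      refine (hS.drift_lip r ⟨m1.1.trans h1, h2.trans m2.2⟩ _ _).trans
        (mul_le_mul_of_nonneg_left ?_ hL)
      have := hhol (i / n) ⟨i, by omega, rfl⟩ (l / n) ⟨l, by omega, rfl⟩
        ((grid_le_iff hnpos).2 hil)
      simp only [floor_grid hnpos, eulerPath] at this
      refine this.trans (mul_le_mul_of_nonneg_left ?_ hX0)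
      apply Real.rpow_le_rpow _ _ hβ.le
      · rw [sub_nonneg, grid_le_iff hnpos]; exact hil
      · rw [sub_le_sub_iff_right, grid_le_iff hnpos]; exact hlj.le
    · rw [add_comm 1 β, Real.rpow_add_one' hvu (by linarith)]
      ring
  calc _ ≤ _ := le_of_eq (by rw [hdec])
    _ ≤ ‖((∑ l ∈ Finset.range ⌊n * v⌋₊,
        ∫ r in (l / n : ℝ)..((l + 1 : ℕ) / n : ℝ), b r (Y l)) -
      (∑ l ∈ Finset.range ⌊n * u⌋₊,
        ∫ r in (l / n : ℝ)..((l + 1 : ℕ) / n : ℝ), b r (Y l)) -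
      ∫ r in u..v, b r (eulerPath b S x₀ g n u)) + ((∑ l ∈ Finset.range ⌊n * v⌋₊,
        S (l / n) (Y l) (g ((l + 1 : ℕ) / n) - g (l / n))) - (∑ l ∈ Finset.range ⌊n * u⌋₊,
        S (l / n) (Y l) (g ((l + 1 : ℕ) / n) - g (l / n))) -
        S u (eulerPath b S x₀ g n u) (g v - g u))‖ := le_of_eq (by congr 1; abel)
    _ ≤ _ := norm_add_le _ _
    _ ≤ _ := add_le_add hD hJ
    _ = _ := by ring

/-! ### Solutions of Young equations -/

/-- Solutions of `dx = b(t, x) dt + S(t, x) dg` on `[0, 1]` in the sense of Davie: the germ of the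
right-hand side approximates the increments of the path up to an order larger than one. -/
structure IsYoungSolution (b : ℝ → E → E) (S : ℝ → E → V →L[ℝ] E) (x₀ : E) (g : ℝ → V) (κ β : ℝ)
    (x : ℝ → E) : Prop where
  init : x 0 = x₀
  holder : ∃ X, 0 ≤ X ∧ ∀ u v, 0 ≤ u → u ≤ v → v ≤ 1 → ‖x v - x u‖ ≤ X * (v - u) ^ β
  germ : ∃ C, ∀ u v, 0 ≤ u → u ≤ v → v ≤ 1 →
    ‖x v - x u - (∫ r in u..v, b r (x r)) - S u (x u) (g v - g u)‖ ≤ C * (v - u) ^ (κ + β)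

/-- A Hölder bound on `[0, 1]` in ordered form gives one for all pairs of points. -/
lemma norm_sub_le_of_ordered {A : Type*} [SeminormedAddCommGroup A] {x : ℝ → A} {X β : ℝ}
    (h : ∀ u v, 0 ≤ u → u ≤ v → v ≤ 1 → ‖x v - x u‖ ≤ X * (v - u) ^ β) {u v : ℝ}
    (hu : u ∈ Icc (0 : ℝ) 1) (hv : v ∈ Icc (0 : ℝ) 1) : ‖x v - x u‖ ≤ X * |v - u| ^ β := by
  rcases le_total u v with huv | huv
  · rw [abs_of_nonneg (sub_nonneg.2 huv)]
    exact h u v hu.1 huv hv.2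
  · rw [norm_sub_rev, abs_sub_comm, abs_of_nonneg (sub_nonneg.2 huv)]
    exact h v u hv.1 huv hu.2

lemma continuousOn_of_holder {A : Type*} [SeminormedAddCommGroup A] {x : ℝ → A} {X β : ℝ}
    (hβ : 0 < β) (h : ∀ u v, 0 ≤ u → u ≤ v → v ≤ 1 → ‖x v - x u‖ ≤ X * (v - u) ^ β) :
    ContinuousOn x (Icc (0 : ℝ) 1) := by
  intro u hu
  rw [ContinuousWithinAt, tendsto_iff_norm_sub_tendsto_zero]
  have hlim : Tendsto (fun v : ℝ => X * |v - u| ^ β) (𝓝[Icc (0 : ℝ) 1] u) (𝓝 0) := by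
    have : Continuous fun v : ℝ => X * |v - u| ^ β :=
      continuous_const.mul ((continuous_abs.comp (continuous_id.sub continuous_const)).rpow_const
        fun _ => Or.inr hβ.le)
    have h2 := (this.tendsto u).mono_left (nhdsWithin_le_nhds (s := Icc (0 : ℝ) 1))
    simpa [Real.zero_rpow hβ.ne'] using h2
  refine squeeze_zero' (Eventually.of_forall fun _ => norm_nonneg _) ?_ hlim
  filter_upwards [self_mem_nhdsWithin] with v hv
  exact norm_sub_le_of_ordered h hu hv

lemma norm_le_of_holder {A : Type*} [SeminormedAddCommGroup A] {x : ℝ → A} {X β : ℝ} (hβ : 0 ≤ β)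
    (hX : 0 ≤ X) (h : ∀ u v, 0 ≤ u → u ≤ v → v ≤ 1 → ‖x v - x u‖ ≤ X * (v - u) ^ β) {t : ℝ}
    (ht : t ∈ Icc (0 : ℝ) 1) : ‖x t‖ ≤ ‖x 0‖ + X := by
  have e := h 0 t le_rfl ht.1 ht.2
  have e2 : X * (t - 0) ^ β ≤ X * 1 := by
    apply mul_le_mul_of_nonneg_left _ hX
    exact Real.rpow_le_one (by linarith [ht.1]) (by linarith [ht.2]) hβ
  have e3 : ‖x t‖ ≤ ‖x 0‖ + ‖x t - x 0‖ := norm_le_insert' _ _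
  linarith

lemma aestronglyMeasurable_of_holder {A : Type*} [NormedAddCommGroup A] {x : ℝ → A} {X β : ℝ}
    (hβ : 0 < β) (h : ∀ u v, 0 ≤ u → u ≤ v → v ≤ 1 → ‖x v - x u‖ ≤ X * (v - u) ^ β) :
    AEStronglyMeasurable x (volume.restrict (Icc (0 : ℝ) 1)) :=
  (continuousOn_of_holder hβ h).aestronglyMeasurable_of_isCompact isCompact_Icc measurableSet_Icc

lemma YoungCoefficients.intervalIntegrable_holder {b : ℝ → E → E} {S : ℝ → E → V →L[ℝ] E}
    {L M lam γ β X : ℝ} (hS : YoungCoefficients b S L M lam γ) {x : ℝ → E} (hβ : 0 < β)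
    (hX : 0 ≤ X) (h : ∀ u v, 0 ≤ u → u ≤ v → v ≤ 1 → ‖x v - x u‖ ≤ X * (v - u) ^ β) {u v : ℝ}
    (hu : u ∈ Icc (0 : ℝ) 1) (hv : v ∈ Icc (0 : ℝ) 1) :
    IntervalIntegrable (fun t => b t (x t)) volume u v :=
  hS.intervalIntegrable_drift (aestronglyMeasurable_of_holder hβ h)
    (fun _ ht => norm_le_of_holder hβ.le hX h ht) hu hv

/-- A solution of a Young equation is sewn on `[0, 1]`. -/
lemma IsYoungSolution.isSewn {b : ℝ → E → E} {S : ℝ → E → V →L[ℝ] E} {L M lam γ β κ G : ℝ}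
    (hS : YoungCoefficients b S L M lam γ) (he : YoungExponents β κ lam γ) (hG : 0 ≤ G) {g : ℝ → V}
    (hg : ∀ u v, 0 ≤ u → u ≤ v → v ≤ 1 → ‖g v - g u‖ ≤ G * (v - u) ^ β) {x₀ : E} {x : ℝ → E}
    (hx : IsYoungSolution b S x₀ g κ β x) :
    IsSewn (Icc 0 1) S g x (fun t => ∫ r in (0 : ℝ)..t, b r (x r))
      (fun t => x t - ∫ r in (0 : ℝ)..t, b r (x r)) κ β (sewC (κ + β)) L G := by
  obtain ⟨X, hX, hhol⟩ := hx.holder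
  obtain ⟨C, hC⟩ := hx.germ
  have hβ := he.beta_pos
  have hint : ∀ u v, u ∈ Icc (0 : ℝ) 1 → v ∈ Icc (0 : ℝ) 1 →
      (∫ r in (0 : ℝ)..v, b r (x r)) - ∫ r in (0 : ℝ)..u, b r (x r) = ∫ r in u..v, b r (x r) :=
    fun u v hu hv => intervalIntegral.integral_interval_sub_left
      (hS.intervalIntegrable_holder hβ hX hhol (by simp) hv)
      (hS.intervalIntegrable_holder hβ hX hhol (by simp) hu)
  refine ⟨subset_rfl, fun u _ v _ _ => by abel, ?_, ?_⟩
  · intro u hu v hv huv R hR hxR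
    rw [hint u v hu hv]
    refine norm_integral_le_mul_sub huv fun r h1 h2 => ?_
    have hr : r ∈ Icc (0 : ℝ) 1 := ⟨hu.1.trans h1, h2.trans hv.2⟩
    refine (hS.drift_growth r hr _).trans (mul_le_mul_of_nonneg_left ?_ hS.L_nonneg)
    linarith [hxR r hr h1 h2]
  · intro u hu v hv huv K hK hxK
    have e : ∀ p q, u ≤ p → p ≤ q → q ≤ v →
        (x q - ∫ r in (0 : ℝ)..q, b r (x r)) - (x p - ∫ r in (0 : ℝ)..p, b r (x r)) =
        x q - x p - ∫ r in p..q, b r (x r) := by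
      intro p q h1 h2 h3
      rw [← hint p q ⟨hu.1.trans h1, (h2.trans h3).trans hv.2⟩
        ⟨hu.1.trans (h1.trans h2), h3.trans hv.2⟩]
      abel
    have key := sewing_bound (θ := κ + β) (K := K * G) (C₀ := C) (a := u) (b := v)
      (R := fun p q => (x q - ∫ r in (0 : ℝ)..q, b r (x r)) - (x p - ∫ r in (0 : ℝ)..p, b r (x r))
        - S p (x p) (g q - g p)) he.one_lt (by positivity) ?_ ?_ u v le_rfl huv le_rfl
    · exact key.trans (le_of_eq (by ring))
    · intro p q h1 h2 h3
      simp only [e p q h1 h2 h3]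
      exact hC p q (hu.1.trans h1) h2 (h3.trans hv.2)
    · intro p w q h1 h2 h3 h4
      have hp : p ∈ Icc (0 : ℝ) 1 := ⟨hu.1.trans h1, by linarith [hv.2]⟩
      have hw : w ∈ Icc (0 : ℝ) 1 := ⟨by linarith [hp.1], by linarith [hv.2]⟩
      have e1 := hxK p hp w hw h1 h2 (h3.trans h4)
      have e2 := hg w q hw.1 h3 (h4.trans hv.2)
      have hκ := he.kappa_pos
      have hpw : 0 ≤ w - p := by linarith
      have hwq : 0 ≤ q - w := by linarith
      have hpq : 0 ≤ q - p := by linarith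
      calc _ = ‖(S w (x w) - S p (x p)) (g q - g w)‖ := by
            congr 1
            simp only [map_sub, sub_apply]
            abel
        _ ≤ ‖S w (x w) - S p (x p)‖ * ‖g q - g w‖ := ContinuousLinearMap.le_opNorm _ _
        _ ≤ (K * (q - p) ^ κ) * (G * (q - p) ^ β) := by
            gcongr
            · exact e1.trans (by gcongr)
            · exact e2.trans (by gcongr)
        _ = K * G * (q - p) ^ (κ + β) := by
            rw [Real.rpow_add_of_nonneg hpq hκ.le hβ.le]; ring

/-- The a priori bound for the Hölder constant of a solution. -/
lemma IsYoungSolution.holder_bound {b : ℝ → E → E} {S : ℝ → E → V →L[ℝ] E} {L M lam γ β κ G : ℝ}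
    (hS : YoungCoefficients b S L M lam γ) (he : YoungExponents β κ lam γ) (hG : 0 ≤ G) {g : ℝ → V}
    (hg : ∀ u v, 0 ≤ u → u ≤ v → v ≤ 1 → ‖g v - g u‖ ≤ G * (v - u) ^ β) {x₀ : E} {x : ℝ → E}
    (hx : IsYoungSolution b S x₀ g κ β x) :
    ∀ u v, 0 ≤ u → u ≤ v → v ≤ 1 →
      ‖x v - x u‖ ≤ aprioriC β (L + (M + sewC (κ + β) * M) * G) * (1 + ‖x₀‖) * (v - u) ^ β := by
  obtain ⟨X, hX, hhol⟩ := hx.holder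
  have hQ0 : 0 ≤ L + (M + sewC (κ + β) * M) * G := by
    have := hS.L_nonneg
    have := hS.M_nonneg
    have := (sewC_pos he.one_lt).le
    positivity
  have hst := (stepLen_pos (β := β) hQ0).le
  have := ((hx.isSewn hS he hG hg).global_bound hS he hG (sewC_pos he.one_lt).le
    (fun u hu v hv huv => hg u v hu.1 huv hv.2) hX
    (fun u hu v hv huv => hhol u v hu.1 huv hv.2) rfl (by simp)
    (fun a ha h => ⟨a, ⟨ha, by linarith⟩, le_rfl, by linarith⟩)).1
  rw [hx.init] at this
  intro u v hu huv hv
  exact this u ⟨hu, huv.trans hv⟩ v ⟨hu.trans huv, hv⟩ huv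

/-! ### Uniqueness -/

/-- Two solutions agree: on short intervals the four-point inequality makes the map defining the
equation a contraction for the Hölder seminorm of their difference. -/
lemma IsYoungSolution.unique {b : ℝ → E → E} {S : ℝ → E → V →L[ℝ] E} {L M lam γ β κ G : ℝ}
    (hS : YoungCoefficients b S L M lam γ) (he : YoungExponents β κ lam γ) (hG : 0 ≤ G) {g : ℝ → V}
    (hg : ∀ u v, 0 ≤ u → u ≤ v → v ≤ 1 → ‖g v - g u‖ ≤ G * (v - u) ^ β) {x₀ : E} {x y : ℝ → E}
    (hx : IsYoungSolution b S x₀ g κ β x) (hy : IsYoungSolution b S x₀ g κ β y) :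
    ∀ t ∈ Icc (0 : ℝ) 1, x t = y t := by
  obtain ⟨X, hX, hhx⟩ := hx.holder
  obtain ⟨Y, hY, hhy⟩ := hy.holder
  obtain ⟨Cx, hCx⟩ := hx.germ
  obtain ⟨Cy, hCy⟩ := hy.germ
  have hβ := he.beta_pos
  have hκ := he.kappa_pos
  have hL := hS.L_nonneg
  have hM := hS.M_nonneg
  have hsC := (sewC_pos he.one_lt).le
  obtain ⟨F, hF, h4⟩ := hS.four_point (‖x₀‖ + X + Y)
  have hγ : 0 < γ := by
    have := he.kappa_le_gamma
    by_contra h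
    nlinarith
  have hbx : ∀ t ∈ Icc (0 : ℝ) 1, ‖x t‖ ≤ ‖x₀‖ + X + Y := fun t ht => by
    have := norm_le_of_holder hβ.le hX hhx ht
    rw [hx.init] at this; linarith
  have hby : ∀ t ∈ Icc (0 : ℝ) 1, ‖y t‖ ≤ ‖x₀‖ + X + Y := fun t ht => by
    have := norm_le_of_holder hβ.le hY hhy ht
    rw [hy.init] at this; linarith
  set z : ℝ → E := fun t => x t - y t with hz
  set A := L + M * G + sewC (κ + β) * (F * (2 + Y ^ γ)) * G with hA
  have hA0 : 0 ≤ A := by positivity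
  set h : ℝ := min 1 ((2 * A + 1)⁻¹ ^ (1 / κ)) with hh
  have hh0 : 0 < h := by rw [hh]; positivity
  have hh1 : h ≤ 1 := min_le_left _ _
  have hAh : A * h ^ κ ≤ 1 / 2 := by
    have e : h ^ κ ≤ (2 * A + 1)⁻¹ := by
      calc h ^ κ ≤ ((2 * A + 1)⁻¹ ^ (1 / κ)) ^ κ :=
            Real.rpow_le_rpow hh0.le (min_le_right _ _) hκ.le
        _ = (2 * A + 1)⁻¹ := by
            rw [← Real.rpow_mul (by positivity), one_div_mul_cancel hκ.ne', Real.rpow_one]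
    calc A * h ^ κ ≤ A * (2 * A + 1)⁻¹ := by gcongr
      _ ≤ 1 / 2 := by
        rw [← div_eq_mul_inv, div_le_div_iff₀ (by positivity) (by norm_num)]; linarith
  have hlocal : ∀ s, 0 ≤ s → s ≤ 1 → z s = 0 → ∀ t, s ≤ t → t ≤ s + h → t ≤ 1 → z t = 0 := by
    intro s hs0 hs1 hzs
    have key := bound_of_self_improving
      (ι := {p : ℝ × ℝ // s ≤ p.1 ∧ p.1 ≤ p.2 ∧ p.2 ≤ s + h ∧ p.2 ≤ 1})
      (F := fun p => ‖z p.1.2 - z p.1.1‖) (w := fun p => (p.1.2 - p.1.1) ^ β)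
      (fun p => Real.rpow_nonneg (by linarith [p.2.2.1]) _) (a := 0) (r := 1 / 2)
      (X₀ := X + Y) le_rfl (by norm_num) (by norm_num) (by positivity) ?_ ?_
    · intro t hst hth ht1
      have := key ⟨(s, t), le_rfl, hst, hth, ht1⟩
      simp only [zero_div, zero_mul, hzs, sub_zero] at this
      exact norm_le_zero_iff.1 this
    · rintro ⟨⟨u, v⟩, hsu, huv, hvh, hv1⟩
      dsimp only at hsu huv hvh hv1 ⊢
      have e1 := hhx u v (hs0.trans hsu) huv hv1
      have e2 := hhy u v (hs0.trans hsu) huv hv1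
      calc ‖z v - z u‖ = ‖(x v - x u) - (y v - y u)‖ := by congr 1; simp only [hz]; abel
        _ ≤ _ := norm_sub_le _ _
        _ ≤ _ := by linarith
    · rintro Z hZ hP ⟨⟨u, v⟩, hsu, huv, hvh, hv1⟩
      dsimp only at hsu huv hvh hv1 ⊢
      have hzb : ∀ w, s ≤ w → w ≤ s + h → w ≤ 1 → ‖z w‖ ≤ Z * h ^ β := by
        intro w h1 h2 h3
        have e := hP ⟨(s, w), le_rfl, h1, h2, h3⟩
        simp only [hzs, sub_zero] at e
        refine e.trans (mul_le_mul_of_nonneg_left ?_ hZ)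
        exact Real.rpow_le_rpow (by linarith) (by linarith) hβ.le
      have hhβ : h ^ β ≤ h ^ κ := rpow_le_rpow_of_le_one hh0.le hh1 hκ he.kappa_le
      have hhβ1 : h ^ β ≤ 1 := Real.rpow_le_one hh0.le hh1 hβ.le
      -- Hölder bound for the difference of the coefficients along the two paths
      have hcoef : ∀ p q, s ≤ p → p ≤ q → q ≤ s + h → q ≤ 1 →
          ‖(S q (x q) - S q (y q)) - (S p (x p) - S p (y p))‖
            ≤ F * (2 + Y ^ γ) * Z * (q - p) ^ κ := by
        intro p q h1 h2 h3 h5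
        have hp : p ∈ Icc (0 : ℝ) 1 := ⟨by linarith, by linarith⟩
        have hq : q ∈ Icc (0 : ℝ) 1 := ⟨by linarith, h5⟩
        have hqp : 0 ≤ q - p := by linarith
        have hqp1 : q - p ≤ 1 := by linarith
        have e0 := h4 p hp q hq (x q) (y q) (x p) (y p) (hbx q hq) (hby q hq) (hbx p hp) (hby p hp)
        have e1 : ‖(x q - y q) - (x p - y p)‖ ≤ Z * (q - p) ^ κ :=
          (hP ⟨(p, q), h1, h2, h3, h5⟩).trans (mul_le_mul_of_nonneg_left
            (rpow_le_rpow_of_le_one hqp hqp1 hκ he.kappa_le) hZ)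
        have e2 : |q - p| ^ lam ≤ (q - p) ^ κ := by
          rw [abs_of_nonneg hqp]
          exact rpow_le_rpow_of_le_one hqp hqp1 hκ he.kappa_le_lam
        have e3 : ‖y q - y p‖ ^ γ ≤ Y ^ γ * (q - p) ^ κ := by
          calc ‖y q - y p‖ ^ γ ≤ (Y * (q - p) ^ β) ^ γ :=
                Real.rpow_le_rpow (norm_nonneg _) (hhy p q hp.1 h2 h5) hγ.le
            _ = Y ^ γ * (q - p) ^ (γ * β) := by
                rw [Real.mul_rpow hY (by positivity), ← Real.rpow_mul hqp, mul_comm β]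
            _ ≤ _ := mul_le_mul_of_nonneg_left
                (rpow_le_rpow_of_le_one hqp hqp1 hκ he.kappa_le_gamma) (by positivity)
        have e4 : ‖x p - y p‖ ≤ Z :=
          (hzb p h1 (h2.trans h3) hp.2).trans (by nlinarith)
        calc _ ≤ _ := e0
          _ ≤ F * (Z * (q - p) ^ κ + Z * ((q - p) ^ κ + Y ^ γ * (q - p) ^ κ)) := by gcongr
          _ = _ := by ring
      have hu : u ∈ Icc (0 : ℝ) 1 := ⟨by linarith, by linarith⟩
      have hv : v ∈ Icc (0 : ℝ) 1 := ⟨by linarith, hv1⟩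
      have hvu : 0 ≤ v - u := by linarith
      have hvu1 : v - u ≤ 1 := by linarith
      have hix : ∀ p q, p ∈ Icc (0 : ℝ) 1 → q ∈ Icc (0 : ℝ) 1 →
          IntervalIntegrable (fun t => b t (x t)) volume p q := fun p q hp hq =>
        hS.intervalIntegrable_holder hβ hX hhx hp hq
      have hiy : ∀ p q, p ∈ Icc (0 : ℝ) 1 → q ∈ Icc (0 : ℝ) 1 →
          IntervalIntegrable (fun t => b t (y t)) volume p q := fun p q hp hq =>
        hS.intervalIntegrable_holder hβ hY hhy hp hq
      set K := F * (2 + Y ^ γ) * Z with hK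
      have hK0 : 0 ≤ K := by positivity
      set R : ℝ → ℝ → E := fun p q =>
        (x q - x p - (∫ r in p..q, b r (x r)) - S p (x p) (g q - g p)) -
        (y q - y p - (∫ r in p..q, b r (y r)) - S p (y p) (g q - g p)) with hR
      have hRb := sewing_bound (θ := κ + β) (K := K * G) (C₀ := Cx + Cy) (a := u) (b := v)
        (R := R) he.one_lt (by positivity) ?_ ?_ u v le_rfl huv le_rfl
      rotate_left
      · intro p q h1 h2 h3
        refine (norm_sub_le _ _).trans ?_
        have := hCx p q (hu.1.trans h1) h2 (h3.trans hv1)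
        have := hCy p q (hu.1.trans h1) h2 (h3.trans hv1)
        linarith
      · intro p w q h1 h2 h3 h5
        have hp : p ∈ Icc (0 : ℝ) 1 := ⟨hu.1.trans h1, by linarith⟩
        have hw : w ∈ Icc (0 : ℝ) 1 := ⟨by linarith [hp.1], by linarith⟩
        have hq : q ∈ Icc (0 : ℝ) 1 := ⟨by linarith [hw.1], by linarith⟩
        have e1 := hcoef p w (hsu.trans h1) h2 (by linarith) hw.2
        have e2 := hg w q hw.1 h3 hq.2
        have hpw : 0 ≤ w - p := by linarith
        have hwq : 0 ≤ q - w := by linarith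
        have hpq : 0 ≤ q - p := by linarith
        have i1 := intervalIntegral.integral_add_adjacent_intervals (hix p w hp hw) (hix w q hw hq)
        have i2 := intervalIntegral.integral_add_adjacent_intervals (hiy p w hp hw) (hiy w q hw hq)
        calc ‖R p q - R p w - R w q‖
            = ‖((S w (x w) - S w (y w)) - (S p (x p) - S p (y p))) (g q - g w)‖ := by
              congr 1
              simp only [hR, ← i1, ← i2, map_sub, sub_apply]
              abel
          _ ≤ ‖(S w (x w) - S w (y w)) - (S p (x p) - S p (y p))‖ * ‖g q - g w‖ :=
              ContinuousLinearMap.le_opNorm _ _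
          _ ≤ (K * (q - p) ^ κ) * (G * (q - p) ^ β) := by
              gcongr
              · exact e1.trans (by gcongr)
              · exact e2.trans (by gcongr)
          _ = K * G * (q - p) ^ (κ + β) := by
              rw [Real.rpow_add_of_nonneg hpq hκ.le hβ.le]; ring
      set l := (v - u) ^ β with hl
      have hl0 : 0 ≤ l := Real.rpow_nonneg hvu _
      have hD : ‖(∫ r in u..v, b r (x r)) - ∫ r in u..v, b r (y r)‖ ≤ L * (Z * h ^ κ) * l := by
        rw [← intervalIntegral.integral_sub (hix u v hu hv) (hiy u v hu hv)]
        refine (norm_integral_le_mul_sub huv (c := L * (Z * h ^ κ)) fun r h1 h2 => ?_).trans ?_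
        · refine (hS.drift_lip r ⟨hu.1.trans h1, h2.trans hv1⟩ _ _).trans
            (mul_le_mul_of_nonneg_left ?_ hL)
          exact (hzb r (hsu.trans h1) (h2.trans hvh) (h2.trans hv1)).trans (by gcongr)
        · apply mul_le_mul_of_nonneg_left _ (by positivity)
          have := rpow_le_rpow_of_le_one hvu hvu1 hβ he.beta_le
          rwa [Real.rpow_one] at this
      have hS1 : ‖(S u (x u) - S u (y u)) (g v - g u)‖ ≤ M * (Z * h ^ κ) * (G * l) := by
        refine (ContinuousLinearMap.le_opNorm _ _).trans ?_
        gcongr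
        · refine (hS.space u hu _ _).trans (mul_le_mul_of_nonneg_left ?_ hM)
          exact (hzb u hsu (huv.trans hvh) hu.2).trans (by gcongr)
        · exact hg u v hu.1 huv hv1
      have hRb2 : ‖R u v‖ ≤ sewC (κ + β) * (K * G) * (h ^ κ * l) := by
        refine hRb.trans (mul_le_mul_of_nonneg_left ?_ (by positivity))
        have := rpow_le_rpow_sub_mul hvu (by linarith : v - u ≤ h) hβ.le
          (by linarith : β ≤ κ + β)
        simpa using this
      calc ‖z v - z u‖ = ‖R u v + ((∫ r in u..v, b r (x r)) - ∫ r in u..v, b r (y r)) +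
            (S u (x u) - S u (y u)) (g v - g u)‖ := by
            congr 1
            simp only [hR, hz, map_sub, sub_apply]
            abel
        _ ≤ _ := norm_add₃_le
        _ ≤ A * h ^ κ * Z * l := by
            rw [hA]
            calc _ ≤ _ := add_le_add (add_le_add hRb2 hD) hS1
              _ = _ := by rw [hK]; ring
        _ ≤ 1 / 2 * Z * l := by gcongr
        _ = (0 + 1 / 2 * Z) * l := by ring
  have hind : ∀ k : ℕ, ∀ t, 0 ≤ t → t ≤ 1 → t ≤ k * h → z t = 0 := by
    intro k
    induction k with
    | zero =>
      intro t h0 _ h1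
      have : t = 0 := le_antisymm (by simpa using h1) h0
      simp [this, hz, hx.init, hy.init]
    | succ k ih =>
      intro t h0 h1 h2
      by_cases hk : t ≤ k * h
      · exact ih t h0 h1 hk
      push Not at hk
      have hk1 : (k : ℝ) * h ≤ 1 := by linarith
      have hk0 : 0 ≤ (k : ℝ) * h := by positivity
      exact hlocal (k * h) hk0 hk1 (ih _ hk0 hk1 le_rfl) t hk.le
        (by push_cast at h2; linarith) h1
  intro t ht
  obtain ⟨k, hk⟩ := exists_nat_gt (1 / h)
  rw [div_lt_iff₀ hh0] at hk
  exact sub_eq_zero.1 (hind k t ht.1 ht.2 (ht.2.trans hk.le))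

/-! ### Convergence of the Euler scheme -/

lemma eulerPath_eq_grid (b : ℝ → E → E) (S : ℝ → E → V →L[ℝ] E) (x₀ : E) (g : ℝ → V) {n : ℕ}
    (hn : 0 < n) (t : ℝ) :
    eulerPath b S x₀ g n (⌊n * t⌋₊ / n) = eulerPath b S x₀ g n t := by
  rw [eulerPath, floor_grid hn, eulerPath]

lemma floor_div_mem_grid {n : ℕ} {t : ℝ} (ht : t ∈ Icc (0 : ℝ) 1) :
    (⌊n * t⌋₊ / n : ℝ) ∈ grid n := by
  refine ⟨_, ?_, rfl⟩
  have h : (n : ℝ) * t ≤ n := mul_le_of_le_one_right (by positivity) ht.2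
  exact_mod_cast (Nat.floor_le (mul_nonneg (Nat.cast_nonneg n) ht.1)).trans h

lemma tendsto_floor_div {t : ℝ} (ht : 0 ≤ t) :
    Tendsto (fun n : ℕ => (⌊n * t⌋₊ / n : ℝ)) atTop (𝓝 t) := by
  have := (tendsto_nat_floor_mul_div_atTop ht).comp tendsto_natCast_atTop_atTop
  refine this.congr fun n => ?_
  simp [mul_comm]

/-- Limits of the Euler schemes along ultrafilters exist by compactness, and are solutions since
the Euler schemes satisfy the germ estimate with uniform constants. -/
lemma exists_isYoungSolution_of_ultrafilter [ProperSpace E] {b : ℝ → E → E}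
    {S : ℝ → E → V →L[ℝ] E} {L M lam γ β κ G : ℝ}
    (hS : YoungCoefficients b S L M lam γ) (he : YoungExponents β κ lam γ) (hG : 0 ≤ G) {g : ℝ → V}
    (hg : ∀ u v, 0 ≤ u → u ≤ v → v ≤ 1 → ‖g v - g u‖ ≤ G * (v - u) ^ β) (x₀ : E)
    (U : Ultrafilter ℕ) (hU : (U : Filter ℕ) ≤ atTop) :
    ∃ x, IsYoungSolution b S x₀ g κ β x ∧ ∀ t ∈ Icc (0 : ℝ) 1,
      Tendsto (fun n => eulerPath b S x₀ g n t) U (𝓝 (x t)) := by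
  obtain ⟨X, C, n₀, hX, hn₀, hbd⟩ := euler_bounds hS he hG hg x₀
  have hβ := he.beta_pos
  have hκ := he.kappa_pos
  have hL := hS.L_nonneg
  have hM := hS.M_nonneg
  have hlarge : ∀ᶠ n in (U : Filter ℕ), n₀ ≤ n := hU (eventually_ge_atTop n₀)
  have hlim : ∀ t, ∃ y, t ∈ Icc (0 : ℝ) 1 →
      Tendsto (fun n => eulerPath b S x₀ g n t) U (𝓝 y) := by
    intro t
    by_cases ht : t ∈ Icc (0 : ℝ) 1
    · have hb : ∀ᶠ n in (U : Filter ℕ), eulerPath b S x₀ g n t ∈ Metric.closedBall (0 : E) X := by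
        filter_upwards [hlarge] with n hn
        have := (hbd n hn _ (floor_div_mem_grid ht) _ (floor_div_mem_grid ht) le_rfl).1
        rw [eulerPath_eq_grid _ _ _ _ (hn₀.trans_le hn)] at this
        simpa using this
      obtain ⟨y, _, hy⟩ := (isCompact_closedBall (0 : E) X).ultrafilter_le_nhds
        (U.map fun n => eulerPath b S x₀ g n t) (le_principal_iff.2 hb)
      exact ⟨y, fun _ => hy⟩
    · exact ⟨0, fun h => absurd h ht⟩
  choose x hx using hlim
  have hfl : ∀ t ∈ Icc (0 : ℝ) 1, Tendsto (fun n : ℕ => (⌊n * t⌋₊ / n : ℝ)) U (𝓝 t) :=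
    fun t ht => (tendsto_floor_div ht.1).mono_left hU
  have hflmem : ∀ᶠ n : ℕ in (U : Filter ℕ), ∀ t ∈ Icc (0 : ℝ) 1,
      (⌊n * t⌋₊ / n : ℝ) ∈ Icc (0 : ℝ) 1 := by
    filter_upwards [hlarge] with n hn t ht
    obtain ⟨k, hk, e⟩ := floor_div_mem_grid (n := n) ht
    rw [e]
    exact grid_point_mem (hn₀.trans_le hn) hk
  have hmono : ∀ n : ℕ, ∀ u v : ℝ, u ≤ v → (⌊n * u⌋₊ / n : ℝ) ≤ ⌊n * v⌋₊ / n := by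
    intro n u v huv
    gcongr
  have hpow : ∀ u v c : ℝ, u ∈ Icc (0 : ℝ) 1 → v ∈ Icc (0 : ℝ) 1 → 0 < c →
      Tendsto (fun n : ℕ => ((⌊n * v⌋₊ / n : ℝ) - ⌊n * u⌋₊ / n) ^ c) U (𝓝 ((v - u) ^ c)) :=
    fun u v c hu hv hc => ((hfl v hv).sub (hfl u hu)).rpow_const (p := c) (Or.inr hc.le)
  have hhol : ∀ u v, 0 ≤ u → u ≤ v → v ≤ 1 → ‖x v - x u‖ ≤ X * (v - u) ^ β := by
    intro u v hu0 huv hv1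
    have hu : u ∈ Icc (0 : ℝ) 1 := ⟨hu0, huv.trans hv1⟩
    have hv : v ∈ Icc (0 : ℝ) 1 := ⟨hu0.trans huv, hv1⟩
    refine le_of_tendsto_of_tendsto ((hx v hv).sub (hx u hu)).norm
      ((hpow u v β hu hv hβ).const_mul X) ?_
    filter_upwards [hlarge] with n hn
    have := (hbd n hn _ (floor_div_mem_grid hu) _ (floor_div_mem_grid hv) (hmono n u v huv)).2.1
    rwa [eulerPath_eq_grid _ _ _ _ (hn₀.trans_le hn),
      eulerPath_eq_grid _ _ _ _ (hn₀.trans_le hn)] at this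
  refine ⟨x, ⟨?_, ⟨X, hX, hhol⟩, ⟨C + L * X, ?_⟩⟩, hx⟩
  · have h0 := hx 0 (by simp)
    have : (fun n => eulerPath b S x₀ g n 0) = fun _ => x₀ := by
      ext n; simp [eulerPath, euler]
    rw [this] at h0
    exact tendsto_nhds_unique h0 tendsto_const_nhds
  intro u v hu0 huv hv1
  have hu : u ∈ Icc (0 : ℝ) 1 := ⟨hu0, huv.trans hv1⟩
  have hv : v ∈ Icc (0 : ℝ) 1 := ⟨hu0.trans huv, hv1⟩
  have hvu : 0 ≤ v - u := by linarith
  have hvu1 : v - u ≤ 1 := by linarith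
  -- the limit of the germ estimate has the drift frozen at `x u`
  have hfrozen : ‖x v - x u - (∫ r in u..v, b r (x u)) - S u (x u) (g v - g u)‖
      ≤ C * (v - u) ^ (κ + β) := by
    have hint : Tendsto (fun n : ℕ => ∫ r in (⌊n * u⌋₊ / n : ℝ)..(⌊n * v⌋₊ / n : ℝ),
        b r (eulerPath b S x₀ g n u)) U (𝓝 (∫ r in u..v, b r (x u))) := by
      have hprim : ∀ t ∈ Icc (0 : ℝ) 1, Tendsto (fun n : ℕ => ∫ r in (0 : ℝ)..(⌊n * t⌋₊ / n : ℝ),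
          b r (x u)) U (𝓝 (∫ r in (0 : ℝ)..t, b r (x u))) := by
        intro t ht
        have hc : ContinuousOn (fun t => ∫ r in (0 : ℝ)..t, b r (x u)) (Icc 0 1) := by
          have := intervalIntegral.continuousOn_primitive_interval (μ := volume) (a := 0) (b := 1)
            (f := fun r => b r (x u)) (by
              have := hS.intervalIntegrable_const (x u) (u := 0) (v := 1) (by simp) (by simp)
              rwa [intervalIntegrable_iff'] at this)
          rwa [uIcc_of_le zero_le_one] at this
        refine (hc t ht).tendsto.comp (tendsto_nhdsWithin_iff.2 ⟨hfl t ht, ?_⟩)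
        filter_upwards [hflmem] with n hn using hn t ht
      have h1 : Tendsto (fun n : ℕ => ∫ r in (⌊n * u⌋₊ / n : ℝ)..(⌊n * v⌋₊ / n : ℝ), b r (x u)) U
          (𝓝 (∫ r in u..v, b r (x u))) := by
        have h2 := (hprim v hv).sub (hprim u hu)
        rw [intervalIntegral.integral_interval_sub_left
          (hS.intervalIntegrable_const _ (by simp) hv)
          (hS.intervalIntegrable_const _ (by simp) hu)] at h2
        refine h2.congr' ?_
        filter_upwards [hflmem] with n hn
        exact intervalIntegral.integral_interval_sub_left
          (hS.intervalIntegrable_const _ (by simp) (hn v hv))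
          (hS.intervalIntegrable_const _ (by simp) (hn u hu))
      have h2 : Tendsto (fun n : ℕ => (∫ r in (⌊n * u⌋₊ / n : ℝ)..(⌊n * v⌋₊ / n : ℝ),
          b r (eulerPath b S x₀ g n u)) - ∫ r in (⌊n * u⌋₊ / n : ℝ)..(⌊n * v⌋₊ / n : ℝ),
          b r (x u)) U (𝓝 0) := by
        rw [tendsto_zero_iff_norm_tendsto_zero]
        have h3 : Tendsto (fun n : ℕ => L * ‖eulerPath b S x₀ g n u - x u‖) U (𝓝 0) := by
          simpa using ((tendsto_iff_norm_sub_tendsto_zero.1 (hx u hu)).const_mul L)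
        refine squeeze_zero' (Eventually.of_forall fun _ => norm_nonneg _) ?_ h3
        filter_upwards [hflmem] with n hn
        have m1 := hn u hu
        have m2 := hn v hv
        rw [← intervalIntegral.integral_sub (hS.intervalIntegrable_const _ m1 m2)
          (hS.intervalIntegrable_const _ m1 m2)]
        refine (norm_integral_le_mul_sub (hmono n u v huv) fun r h1 h2 =>
          hS.drift_lip r ⟨m1.1.trans h1, h2.trans m2.2⟩ _ _).trans ?_
        exact mul_le_of_le_one_right (by positivity) (by linarith [m1.1, m2.2])
      simpa using h2.add h1
    have hcont := continuousOn_of_holder hβ hg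
    have hgt : ∀ t ∈ Icc (0 : ℝ) 1, Tendsto (fun n : ℕ => g (⌊n * t⌋₊ / n : ℝ)) U (𝓝 (g t)) := by
      intro t ht
      refine (hcont t ht).tendsto.comp (tendsto_nhdsWithin_iff.2 ⟨hfl t ht, ?_⟩)
      filter_upwards [hflmem] with n hn using hn t ht
    have hSt : Tendsto (fun n : ℕ => S (⌊n * u⌋₊ / n : ℝ) (eulerPath b S x₀ g n u)) U
        (𝓝 (S u (x u))) := by
      rw [tendsto_iff_norm_sub_tendsto_zero]
      have h1 : Tendsto (fun n : ℕ => M * |(⌊n * u⌋₊ / n : ℝ) - u| ^ lam +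
          M * ‖eulerPath b S x₀ g n u - x u‖) U (𝓝 0) := by
        have a1 : Tendsto (fun n : ℕ => |(⌊n * u⌋₊ / n : ℝ) - u| ^ lam) U (𝓝 0) := by
          have hlam : 0 < lam := hκ.trans_le he.kappa_le_lam
          have := (((hfl u hu).sub_const u).abs).rpow_const (p := lam) (Or.inr hlam.le)
          simpa [Real.zero_rpow hlam.ne'] using this
        have a2 := tendsto_iff_norm_sub_tendsto_zero.1 (hx u hu)
        simpa using (a1.const_mul M).add (a2.const_mul M)
      refine squeeze_zero' (Eventually.of_forall fun _ => norm_nonneg _) ?_ h1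
      filter_upwards [hflmem] with n hn
      exact (norm_sub_le_norm_sub_add_norm_sub _ (S u (eulerPath b S x₀ g n u)) _).trans
        (add_le_add (hS.time u hu _ (hn u hu) _) (hS.space u hu _ _))
    refine le_of_tendsto_of_tendsto ((((hx v hv).sub (hx u hu)).sub hint).sub
      ((isBoundedBilinearMap_apply (𝕜 := ℝ) (E := V) (F := E)).continuous.tendsto _ |>.comp
        (hSt.prodMk_nhds ((hgt v hv).sub (hgt u hu))))).norm
      ((hpow u v (κ + β) hu hv (by linarith)).const_mul C) ?_
    filter_upwards [hlarge] with n hn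
    have := (hbd n hn _ (floor_div_mem_grid hu) _ (floor_div_mem_grid hv) (hmono n u v huv)).2.2
    rwa [eulerPath_eq_grid _ _ _ _ (hn₀.trans_le hn),
      eulerPath_eq_grid _ _ _ _ (hn₀.trans_le hn)] at this
  have hdrift : ‖(∫ r in u..v, b r (x u)) - ∫ r in u..v, b r (x r)‖
      ≤ L * X * (v - u) ^ (κ + β) := by
    have e0 : (v - u) ^ (1 + β) ≤ (v - u) ^ (κ + β) :=
      rpow_le_rpow_of_le_one hvu hvu1 (by linarith [he.one_lt])
        (by linarith [he.kappa_le, he.beta_le])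
    refine le_trans ?_ (mul_le_mul_of_nonneg_left e0 (by positivity))
    rw [← intervalIntegral.integral_sub (hS.intervalIntegrable_const _ hu hv)
      (hS.intervalIntegrable_holder hβ hX hhol hu hv)]
    refine (norm_integral_le_mul_sub huv (c := L * (X * (v - u) ^ β)) fun r h1 h2 => ?_).trans
      (le_of_eq ?_)
    · have hr : r ∈ Icc (0 : ℝ) 1 := ⟨hu0.trans h1, h2.trans hv1⟩
      refine (hS.drift_lip r hr _ _).trans (mul_le_mul_of_nonneg_left ?_ hL)
      rw [norm_sub_rev]
      refine (hhol u r hu0 h1 hr.2).trans (mul_le_mul_of_nonneg_left ?_ hX)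
      exact Real.rpow_le_rpow (by linarith) (by linarith) hβ.le
    · rw [add_comm 1 β, Real.rpow_add_one' hvu (by linarith)]
      ring
  calc _ = ‖(x v - x u - (∫ r in u..v, b r (x u)) - S u (x u) (g v - g u)) +
        ((∫ r in u..v, b r (x u)) - ∫ r in u..v, b r (x r))‖ := by congr 1; abel
    _ ≤ _ := norm_add_le _ _
    _ ≤ _ := add_le_add hfrozen hdrift
    _ = _ := by ring

/-- By uniqueness all the limits along ultrafilters agree, so the Euler schemes converge. -/
theorem exists_isYoungSolution_tendsto [ProperSpace E] {b : ℝ → E → E}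
    {S : ℝ → E → V →L[ℝ] E} {L M lam γ β κ G : ℝ}
    (hS : YoungCoefficients b S L M lam γ) (he : YoungExponents β κ lam γ) (hG : 0 ≤ G) {g : ℝ → V}
    (hg : ∀ u v, 0 ≤ u → u ≤ v → v ≤ 1 → ‖g v - g u‖ ≤ G * (v - u) ^ β) (x₀ : E) :
    ∃ x, IsYoungSolution b S x₀ g κ β x ∧ ∀ t ∈ Icc (0 : ℝ) 1,
      Tendsto (fun n => eulerPath b S x₀ g n t) atTop (𝓝 (x t)) := by
  obtain ⟨x, hx, _⟩ := exists_isYoungSolution_of_ultrafilter hS he hG hg x₀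
    (Ultrafilter.of atTop) (Ultrafilter.of_le _)
  refine ⟨x, hx, fun t ht => ?_⟩
  rw [tendsto_iff_ultrafilter]
  intro U hU
  obtain ⟨y, hy, hlim⟩ := exists_isYoungSolution_of_ultrafilter hS he hG hg x₀ U hU
  rw [hx.unique hS he hG hg hy t ht]
  exact hlim t ht

/-- Existence of the Young integral, as the solution of an equation whose coefficient does not
depend on the state. -/
lemma exists_young_integral {f g : ℝ → ℝ} {κ β Kf Kg : ℝ} (hκ : 0 < κ) (hκβ : κ ≤ β)
    (hβ : β ≤ 1) (hlt : 1 < κ + β) (hKf : 0 ≤ Kf) (hKg : 0 ≤ Kg)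
    (hf : ∀ u v, 0 ≤ u → u ≤ v → v ≤ 1 → |f v - f u| ≤ Kf * (v - u) ^ κ)
    (hg : ∀ u v, 0 ≤ u → u ≤ v → v ≤ 1 → |g v - g u| ≤ Kg * (v - u) ^ β) :
    ∃ (I : ℝ → ℝ) (C : ℝ), 0 ≤ C ∧ I 0 = 0 ∧ ∀ u v, 0 ≤ u → u ≤ v → v ≤ 1 →
      |I v - I u - f u * (g v - g u)| ≤ C * (v - u) ^ (κ + β) := by
  have hS : YoungCoefficients (E := ℝ) (V := ℝ) (fun _ _ => 0)
      (fun t _ => ContinuousLinearMap.mul ℝ ℝ (f t)) 0 (|f 0| + Kf) κ 1 := by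
    have hft : ∀ s ∈ Icc (0 : ℝ) 1, ∀ t ∈ Icc (0 : ℝ) 1, |f t - f s| ≤ Kf * |t - s| ^ κ :=
      fun s hs t ht => norm_sub_le_of_ordered (x := f) hf hs ht
    refine ⟨le_rfl, by positivity, fun _ => aestronglyMeasurable_const, by simp, by simp,
      fun t _ x y => ?_, fun s hs t ht x => ?_, fun t ht x => ?_,
      fun N => ⟨0, le_rfl, fun s _ t _ x y x' y' _ _ _ _ => by simp⟩⟩
    · simp only [sub_self, norm_zero]; positivity
    · rw [← map_sub, ContinuousLinearMap.opNorm_mul_apply, Real.norm_eq_abs]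
      refine (hft s hs t ht).trans ?_
      gcongr
      linarith [abs_nonneg (f 0)]
    · rw [ContinuousLinearMap.opNorm_mul_apply, Real.norm_eq_abs]
      have h1 := norm_le_of_holder (x := f) hκ.le hKf hf ht
      rw [Real.norm_eq_abs, Real.norm_eq_abs] at h1
      nlinarith [norm_nonneg x, abs_nonneg (f 0)]
  have he : YoungExponents β κ κ 1 := ⟨hκ, hκβ, hβ, le_rfl, by linarith, hlt⟩
  obtain ⟨I, hI, _⟩ := exists_isYoungSolution_tendsto hS he hKg (g := g) hg 0
  obtain ⟨C, hC⟩ := hI.germ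
  refine ⟨I, |C|, abs_nonneg _, hI.init, fun u v hu huv hv => ?_⟩
  have := hC u v hu huv hv
  simp only [intervalIntegral.integral_zero, sub_zero, ContinuousLinearMap.mul_apply',
    Real.norm_eq_abs] at this
  exact this.trans (mul_le_mul_of_nonneg_right (le_abs_self _) (Real.rpow_nonneg (by linarith) _))

end Abstract

/-! ### The space `W_0^{α,∞}` and Hölder continuity -/

section Sobolev

variable {n : ℕ}

lemma MemW.enorm_le {α : ℝ} {f : ℝ → EuclideanSpace ℝ (Fin n)} {t : ℝ} (ht : t ∈ Icc (0 : ℝ) 1) :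
    ‖f t‖ₑ ≤ sobolevNorm α f :=
  le_self_add.trans (le_iSup₂_of_le (f := fun t (_ : t ∈ Icc (0 : ℝ) 1) =>
    (‖f t‖ₑ + ∫⁻ s in Ioo 0 t, ‖f t - f s‖ₑ / ENNReal.ofReal ((t - s) ^ (α + 1)))) t ht le_rfl)

lemma MemW.lintegral_le {α : ℝ} {f : ℝ → EuclideanSpace ℝ (Fin n)} {t : ℝ}
    (ht : t ∈ Icc (0 : ℝ) 1) :
    ∫⁻ s in Ioo 0 t, ‖f t - f s‖ₑ / ENNReal.ofReal ((t - s) ^ (α + 1)) ≤ sobolevNorm α f :=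
  le_add_self.trans (le_iSup₂_of_le (f := fun t (_ : t ∈ Icc (0 : ℝ) 1) =>
    (‖f t‖ₑ + ∫⁻ s in Ioo 0 t, ‖f t - f s‖ₑ / ENNReal.ofReal ((t - s) ^ (α + 1)))) t ht le_rfl)

/-- The mean of `‖f t - f u‖` over `u ∈ (a, b)` is controlled by the Sobolev norm. -/
lemma MemW.lintegral_Ioo_le {α : ℝ} (hα : 0 < α) {f : ℝ → EuclideanSpace ℝ (Fin n)} {a b t l : ℝ}
    (ha : 0 ≤ a) (hb : b ≤ t) (ht : t ∈ Icc (0 : ℝ) 1) (hl : t - a ≤ l) :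
    ∫⁻ u in Ioo a b, ‖f t - f u‖ₑ ≤ ENNReal.ofReal (l ^ (α + 1)) * sobolevNorm α f := by
  calc ∫⁻ u in Ioo a b, ‖f t - f u‖ₑ
      ≤ ∫⁻ u in Ioo a b, ENNReal.ofReal (l ^ (α + 1)) *
          (‖f t - f u‖ₑ / ENNReal.ofReal ((t - u) ^ (α + 1))) := by
        refine setLIntegral_mono' measurableSet_Ioo fun u hu => ?_
        have h0 : 0 < (t - u) ^ (α + 1) := Real.rpow_pos_of_pos (by linarith [hu.2]) _
        have h1 : (t - u) ^ (α + 1) ≤ l ^ (α + 1) :=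
          Real.rpow_le_rpow (by linarith [hu.2]) (by linarith [hu.1]) (by linarith)
        rw [← mul_div_assoc, ENNReal.le_div_iff_mul_le (Or.inl (by simpa using h0))
          (Or.inl ENNReal.ofReal_ne_top), mul_comm]
        gcongr
    _ = ENNReal.ofReal (l ^ (α + 1)) *
          ∫⁻ u in Ioo a b, ‖f t - f u‖ₑ / ENNReal.ofReal ((t - u) ^ (α + 1)) :=
        lintegral_const_mul' _ _ ENNReal.ofReal_ne_top
    _ ≤ _ := by
        gcongr
        exact (lintegral_mono_set (Ioo_subset_Ioo ha hb)).trans (MemW.lintegral_le ht)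

/-- Comparing `f s` and `f t` through the mean of `f` over `(s - (t - s), s)`. -/
lemma MemW.norm_sub_le_of_le_two_mul {α : ℝ} (hα : 0 < α) {f : ℝ → EuclideanSpace ℝ (Fin n)}
    (hf : MemW α f) {s t : ℝ} (hs : 0 < s) (hst : s ≤ t) (ht : t ≤ 1) (hts : t ≤ 2 * s) :
    ‖f t - f s‖ ≤ (2 ^ (α + 1) + 1) * (sobolevNorm α f).toReal * (t - s) ^ α := by
  rcases hst.eq_or_lt with rfl | hlt
  · simp [Real.zero_rpow hα.ne']
  set h := t - s with hh
  have hpos : 0 < h := by linarith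
  set K := (sobolevNorm α f).toReal with hK
  have hKe : sobolevNorm α f = ENNReal.ofReal K := (ENNReal.ofReal_toReal hf.2.ne).symm
  have hK0 : 0 ≤ K := ENNReal.toReal_nonneg
  have hsub : Ioo (s - h) s ⊆ Icc 0 1 := fun u hu => ⟨by linarith [hu.1], by linarith [hu.2]⟩
  have hmeas : AEMeasurable f (volume.restrict (Ioo (s - h) s)) := hf.1.mono_set hsub
  have e1 := MemW.lintegral_Ioo_le (f := f) hα (a := s - h) (b := s) (t := t) (l := 2 * h)
    (by linarith) hst ⟨by linarith, ht⟩ (by linarith)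
  have e2 := MemW.lintegral_Ioo_le (f := f) hα (a := s - h) (b := s) (t := s) (l := h)
    (by linarith) le_rfl ⟨hs.le, by linarith⟩ (by linarith)
  have e3 : ENNReal.ofReal h * ‖f t - f s‖ₑ ≤
      ENNReal.ofReal ((2 * h) ^ (α + 1)) * sobolevNorm α f +
        ENNReal.ofReal (h ^ (α + 1)) * sobolevNorm α f := by
    calc ENNReal.ofReal h * ‖f t - f s‖ₑ = ∫⁻ _ in Ioo (s - h) s, ‖f t - f s‖ₑ := by
          rw [setLIntegral_const, Real.volume_Ioo, mul_comm]; congr 2; ring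
      _ ≤ ∫⁻ u in Ioo (s - h) s, (‖f t - f u‖ₑ + ‖f s - f u‖ₑ) := by
          refine lintegral_mono fun u => ?_
          calc ‖f t - f s‖ₑ = ‖(f t - f u) - (f s - f u)‖ₑ := by congr 1; abel
            _ ≤ _ := enorm_sub_le
      _ = (∫⁻ u in Ioo (s - h) s, ‖f t - f u‖ₑ) + ∫⁻ u in Ioo (s - h) s, ‖f s - f u‖ₑ :=
          lintegral_add_left' (hmeas.const_sub _).enorm _
      _ ≤ _ := add_le_add e1 e2
  have e4 : h * ‖f t - f s‖ ≤ (2 * h) ^ (α + 1) * K + h ^ (α + 1) * K := by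
    rw [hKe, ← ofReal_norm, ← ENNReal.ofReal_mul hpos.le,
      ← ENNReal.ofReal_mul (by positivity), ← ENNReal.ofReal_mul (by positivity),
      ← ENNReal.ofReal_add (by positivity) (by positivity)] at e3
    exact (ENNReal.ofReal_le_ofReal_iff (by positivity)).1 e3
  rw [Real.mul_rpow (by norm_num) hpos.le, Real.rpow_add_one hpos.ne'] at e4
  refine le_of_mul_le_mul_left (e4.trans (le_of_eq ?_)) hpos
  ring

/-- Elements of `W_0^{α,∞}` are `α`-Hölder continuous away from the initial time. -/
lemma MemW.exists_holder {α : ℝ} (hα : 0 < α) {f : ℝ → EuclideanSpace ℝ (Fin n)}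
    (hf : MemW α f) :
    ∃ C, 0 ≤ C ∧ ∀ s t, 0 < s → s ≤ t → t ≤ 1 → ‖f t - f s‖ ≤ C * (t - s) ^ α := by
  set c := (2 ^ (α + 1) + 1) * (sobolevNorm α f).toReal with hc
  have hc0 : 0 ≤ c := by positivity
  have hclose := fun s t => hf.norm_sub_le_of_le_two_mul (s := s) (t := t) hα
  have hr : (2 : ℝ) ^ (-α) < 1 :=
    Real.rpow_lt_one_of_one_lt_of_neg (by norm_num) (by linarith)
  set C := c / (1 - 2 ^ (-α)) with hC
  have hC0 : 0 ≤ C := div_nonneg hc0 (by linarith)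
  have hCc : c + C * 2 ^ (-α) = C := by
    have : 1 - (2 : ℝ) ^ (-α) ≠ 0 := by linarith
    rw [hC]; field_simp; ring
  have hcC : c ≤ C := by
    have : 0 ≤ C * 2 ^ (-α) := by positivity
    linarith
  -- halving `t` until it is comparable to `s` gives a geometric series
  have hdyad : ∀ j : ℕ, ∀ s t, 0 < s → s ≤ t → t ≤ 1 → t ≤ 2 ^ j * s →
      ‖f t - f s‖ ≤ C * t ^ α := by
    intro j
    induction j with
    | zero =>
      intro s t hs hst _ h
      have : t = s := le_antisymm (by simpa using h) hst
      rw [this, sub_self, norm_zero]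
      positivity
    | succ j ih =>
      intro s t hs hst ht h
      have ht0 : 0 < t := by linarith
      by_cases h2 : t ≤ 2 * s
      · refine (hclose s t hs hst ht h2).trans ?_
        have : (t - s) ^ α ≤ t ^ α := Real.rpow_le_rpow (by linarith) (by linarith) hα.le
        gcongr
      · push Not at h2
        have e1 := hclose (t / 2) t (by linarith) (by linarith) ht (by linarith)
        have e2 := ih s (t / 2) hs (by linarith) (by linarith) (by rw [pow_succ] at h; linarith)
        have e3 : (t / 2) ^ α = 2 ^ (-α) * t ^ α := by
          rw [Real.div_rpow ht0.le (by norm_num), Real.rpow_neg (by norm_num)]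
          field_simp
        have e4 : (t - t / 2) ^ α ≤ t ^ α :=
          Real.rpow_le_rpow (by linarith) (by linarith) hα.le
        calc ‖f t - f s‖ ≤ ‖f t - f (t / 2)‖ + ‖f (t / 2) - f s‖ :=
              norm_sub_le_norm_sub_add_norm_sub _ _ _
          _ ≤ c * t ^ α + C * (2 ^ (-α) * t ^ α) := by
              rw [e3] at e2
              refine add_le_add (e1.trans (mul_le_mul_of_nonneg_left e4 hc0)) e2
          _ = (c + C * 2 ^ (-α)) * t ^ α := by ring
          _ = _ := by rw [hCc]
  refine ⟨C * 2 ^ α, by positivity, fun s t hs hst ht => ?_⟩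
  have h2α : (1 : ℝ) ≤ 2 ^ α := Real.one_le_rpow (by norm_num) hα.le
  by_cases h2 : t ≤ 2 * s
  · refine (hclose s t hs hst ht h2).trans ?_
    apply mul_le_mul_of_nonneg_right _ (Real.rpow_nonneg (by linarith) _)
    nlinarith
  · push Not at h2
    obtain ⟨j, hj⟩ := pow_unbounded_of_one_lt (t / s) (by norm_num : (1 : ℝ) < 2)
    rw [div_lt_iff₀ hs] at hj
    refine (hdyad j s t hs hst ht hj.le).trans ?_
    rw [mul_assoc, ← Real.mul_rpow (by norm_num) (by linarith)]
    apply mul_le_mul_of_nonneg_left _ hC0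
    exact Real.rpow_le_rpow (by linarith) (by linarith) hα.le

/-- Membership in `W_0^{α,∞}` does not see the value at `0`; changing it makes the path Hölder
continuous on all of `[0, 1]`. -/
lemma MemW.exists_holder_modification {α : ℝ} (hα : 0 < α) {f : ℝ → EuclideanSpace ℝ (Fin n)}
    (hf : MemW α f) :
    ∃ (f' : ℝ → EuclideanSpace ℝ (Fin n)) (C : ℝ), 0 ≤ C ∧ (∀ t, 0 < t → f' t = f t) ∧
      ∀ s t, 0 ≤ s → s ≤ t → t ≤ 1 → ‖f' t - f' s‖ ≤ C * (t - s) ^ α := by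
  obtain ⟨C, hC, hhol⟩ := hf.exists_holder hα
  set a : ℕ → ℝ := fun k => 1 / ((k : ℝ) + 1) with ha
  have ha0 : ∀ k, 0 < a k := fun k => by positivity
  have ha1 : ∀ k, a k ≤ 1 := fun k => by
    rw [ha]; dsimp only; rw [div_le_one (by positivity)]
    linarith [(Nat.cast_nonneg k : (0 : ℝ) ≤ k)]
  have hlim : Tendsto a (hyperfilter ℕ : Filter ℕ) (𝓝 0) :=
    tendsto_one_div_add_atTop_nhds_zero_nat.mono_left Nat.hyperfilter_le_atTop
  have hb : ∀ᶠ k in (hyperfilter ℕ : Filter ℕ),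
      f (a k) ∈ Metric.closedBall (0 : EuclideanSpace ℝ (Fin n)) (sobolevNorm α f).toReal := by
    refine Eventually.of_forall fun k => ?_
    rw [mem_closedBall_zero_iff, ← toReal_enorm]
    exact ENNReal.toReal_mono hf.2.ne (MemW.enorm_le ⟨(ha0 k).le, ha1 k⟩)
  obtain ⟨y, _, hy⟩ := (isCompact_closedBall (0 : EuclideanSpace ℝ (Fin n))
    (sobolevNorm α f).toReal).ultrafilter_le_nhds
    ((hyperfilter ℕ).map fun k => f (a k)) (le_principal_iff.2 hb)
  have hy' : Tendsto (fun k => f (a k)) (hyperfilter ℕ : Filter ℕ) (𝓝 y) := hy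
  refine ⟨Function.update f 0 y, C, hC, fun t ht => Function.update_of_ne ht.ne' _ _, ?_⟩
  intro s t hs hst ht
  rcases hs.eq_or_lt with rfl | hs
  · rcases hst.eq_or_lt with rfl | ht0
    · simp [Real.zero_rpow hα.ne']
    rw [Function.update_of_ne ht0.ne', Function.update_self]
    refine le_of_tendsto_of_tendsto (tendsto_const_nhds.sub hy').norm
      (((tendsto_const_nhds.sub hlim).rpow_const (Or.inr hα.le)).const_mul C) ?_
    filter_upwards [hlim.eventually (gt_mem_nhds ht0)] with k hk
    exact hhol _ _ (ha0 k) hk.le ht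
  · rw [Function.update_of_ne (hs.trans_le hst).ne', Function.update_of_ne hs.ne']
    exact hhol s t hs hst ht

/-- Hölder continuous paths of an exponent above `α` belong to `W_0^{α,∞}`. -/
lemma memW_of_holder {α β X : ℝ} (hα : 0 < α) (hαβ : α < β) (hX : 0 ≤ X)
    {f : ℝ → EuclideanSpace ℝ (Fin n)}
    (hf : ∀ u v, 0 ≤ u → u ≤ v → v ≤ 1 → ‖f v - f u‖ ≤ X * (v - u) ^ β) : MemW α f := by
  have hβ : 0 < β := hα.trans hαβ
  refine ⟨(aestronglyMeasurable_of_holder hβ hf).aemeasurable, ?_⟩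
  set F : ℝ → ℝ≥0∞ := fun r => ENNReal.ofReal (X * r ^ (β - α - 1)) with hF
  have hFfin : ∫⁻ r in Ioo (0 : ℝ) 1, F r < ∞ := by
    have h1 : IntervalIntegrable (fun r : ℝ => X * r ^ (β - α - 1)) volume 0 1 :=
      (intervalIntegral.intervalIntegrable_rpow' (by linarith)).const_mul X
    rw [intervalIntegrable_iff_integrableOn_Ioo_of_le zero_le_one] at h1
    exact h1.lintegral_lt_top
  refine lt_of_le_of_lt (b := ENNReal.ofReal (‖f 0‖ + X) + ∫⁻ r in Ioo (0 : ℝ) 1, F r) ?_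
    (ENNReal.add_lt_top.2 ⟨ENNReal.ofReal_lt_top, hFfin⟩)
  refine iSup₂_le fun t ht => add_le_add ?_ ?_
  · rw [← ofReal_norm]
    exact ENNReal.ofReal_le_ofReal (norm_le_of_holder hβ.le hX hf ht)
  · calc ∫⁻ s in Ioo 0 t, ‖f t - f s‖ₑ / ENNReal.ofReal ((t - s) ^ (α + 1))
        ≤ ∫⁻ s in Ioo 0 t, F (t - s) := by
          refine setLIntegral_mono' measurableSet_Ioo fun s hs => ?_
          have hts : 0 < t - s := by linarith [hs.2]
          have hp : 0 < (t - s) ^ (α + 1) := Real.rpow_pos_of_pos hts _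
          rw [ENNReal.div_le_iff (by simpa using hp) ENNReal.ofReal_ne_top, hF,
            ← ENNReal.ofReal_mul (by positivity), ← ofReal_norm]
          apply ENNReal.ofReal_le_ofReal
          refine (hf s t hs.1.le hs.2.le ht.2).trans (le_of_eq ?_)
          rw [mul_assoc, ← Real.rpow_add hts]
          congr 2; ring
      _ = ∫⁻ s, (Ioo 0 t).indicator F (t - s) := by
          rw [← lintegral_indicator measurableSet_Ioo]
          congr 1 with s
          by_cases hs : s ∈ Ioo 0 t
          · rw [indicator_of_mem hs, indicator_of_mem]
            exact ⟨by linarith [hs.2], by linarith [hs.1]⟩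
          · rw [indicator_of_notMem hs, indicator_of_notMem]
            exact fun h => hs ⟨by linarith [h.2], by linarith [h.1]⟩
      _ = ∫⁻ r in Ioo 0 t, F r := by
          rw [lintegral_sub_left_eq_self, lintegral_indicator measurableSet_Ioo]
      _ ≤ _ := lintegral_mono_set (Ioo_subset_Ioo_right ht.2)

end Sobolev

/-! ### Matrix coefficients -/

section Matrix

variable {m d : ℕ}

/-- The continuous linear map of Euclidean spaces given by a matrix. -/
noncomputable def matCLM (A : Matrix (Fin m) (Fin d) ℝ) :
    EuclideanSpace ℝ (Fin d) →L[ℝ] EuclideanSpace ℝ (Fin m) :=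
  LinearMap.toContinuousLinearMap (Matrix.toEuclideanLin A)

lemma matCLM_apply (A : Matrix (Fin m) (Fin d) ℝ) (w : EuclideanSpace ℝ (Fin d)) (i : Fin m) :
    matCLM A w i = ∑ j, A i j * w j := rfl

lemma matCLM_sub (A B : Matrix (Fin m) (Fin d) ℝ) : matCLM (A - B) = matCLM A - matCLM B := by
  rw [matCLM, map_sub, map_sub]; rfl

lemma matNorm_nonneg (A : Matrix (Fin m) (Fin d) ℝ) : 0 ≤ matNorm A := Real.sqrt_nonneg _

lemma norm_matCLM_le (A : Matrix (Fin m) (Fin d) ℝ) : ‖matCLM A‖ ≤ matNorm A := by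
  refine ContinuousLinearMap.opNorm_le_bound _ (matNorm_nonneg A) fun w => ?_
  rw [EuclideanSpace.norm_eq, EuclideanSpace.norm_eq, matNorm, ← Real.sqrt_mul (by positivity)]
  apply Real.sqrt_le_sqrt
  rw [Finset.sum_mul]
  apply Finset.sum_le_sum
  intro i _
  simp only [Real.norm_eq_abs, sq_abs, matCLM_apply]
  exact Finset.sum_mul_sq_le_sq_mul_sq _ _ _

lemma abs_entry_le (A : Matrix (Fin m) (Fin d) ℝ) (i : Fin m) (j : Fin d) :
    |A i j| ≤ matNorm A := by
  apply Real.abs_le_sqrt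
  exact (Finset.single_le_sum (f := fun j => A i j ^ 2) (fun _ _ => sq_nonneg _)
    (Finset.mem_univ j)).trans (Finset.single_le_sum (f := fun i => ∑ j, A i j ^ 2)
    (fun _ _ => Finset.sum_nonneg fun _ _ => sq_nonneg _) (Finset.mem_univ i))

lemma norm_le_sum_abs (w : EuclideanSpace ℝ (Fin m)) : ‖w‖ ≤ ∑ i, |w i| := by
  rw [EuclideanSpace.norm_eq]
  refine Real.sqrt_le_iff.2 ⟨Finset.sum_nonneg fun _ _ => abs_nonneg _, ?_⟩
  exact Finset.sum_sq_le_sq_sum_of_nonneg fun _ _ => abs_nonneg _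

lemma norm_matCLM_le_of_entries {A : Matrix (Fin m) (Fin d) ℝ} {c : ℝ} (hc : 0 ≤ c)
    (h : ∀ i j, |A i j| ≤ c) : ‖matCLM A‖ ≤ m * d * c := by
  refine ContinuousLinearMap.opNorm_le_bound _ (by positivity) fun w => ?_
  refine (norm_le_sum_abs _).trans ?_
  calc ∑ i, |matCLM A w i| ≤ ∑ _i : Fin m, ∑ _j : Fin d, c * ‖w‖ := by
        apply Finset.sum_le_sum
        intro i _
        rw [matCLM_apply]
        refine (Finset.abs_sum_le_sum_abs _ _).trans (Finset.sum_le_sum fun j _ => ?_)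
        rw [abs_mul]
        exact mul_le_mul (h i j) (PiLp.norm_apply_le w j) (abs_nonneg _) hc
    _ = m * d * c * ‖w‖ := by simp; ring

lemma norm_functional_le (l : EuclideanSpace ℝ (Fin m) →L[ℝ] ℝ) {c : ℝ} (hc : 0 ≤ c)
    (h : ∀ k, |l (EuclideanSpace.single k 1)| ≤ c) : ‖l‖ ≤ m * c := by
  refine ContinuousLinearMap.opNorm_le_bound _ (by positivity) fun w => ?_
  have e : l w = ∑ k, w k * l (EuclideanSpace.single k (1 : ℝ)) := by
    conv_lhs => rw [← (EuclideanSpace.basisFun (Fin m) ℝ).sum_repr w]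
    simp
  rw [e]
  calc ‖∑ k, w k * l (EuclideanSpace.single k (1 : ℝ))‖ ≤ ∑ _k : Fin m, ‖w‖ * c := by
        refine norm_sum_le_of_le _ fun k _ => ?_
        rw [norm_mul]
        exact mul_le_mul (PiLp.norm_apply_le w k) (h k) (abs_nonneg _) (norm_nonneg _)
    _ = m * c * ‖w‖ := by simp; ring

/-- The increment over increments of a family of functions of the state, from a bound for the
function, a Hölder bound for its derivative on a ball, and a bound for the derivative of its
increments in time. -/
lemma abs_four_point_le {φ ψ : EuclideanSpace ℝ (Fin m) → ℝ} (hφ : Differentiable ℝ φ)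
    (hψ : Differentiable ℝ ψ) {N M₁ M₂ δ γ : ℝ}
    (hlip : ∀ x y, |φ x - φ y| ≤ M₁ * ‖x - y‖)
    (hder : ∀ x y, ‖x‖ ≤ 3 * N → ‖y‖ ≤ 3 * N → ‖fderiv ℝ φ x - fderiv ℝ φ y‖ ≤ M₂ * ‖x - y‖ ^ γ)
    (htime : ∀ x, ‖fderiv ℝ φ x - fderiv ℝ ψ x‖ ≤ δ)
    {x y x' y' : EuclideanSpace ℝ (Fin m)} (hx' : ‖x'‖ ≤ N) (hy : ‖y‖ ≤ N) (hy' : ‖y'‖ ≤ N) :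
    |(φ x - φ y) - (ψ x' - ψ y')| ≤
      M₁ * ‖(x - y) - (x' - y')‖ + ‖x' - y'‖ * (δ + M₂ * ‖y - y'‖ ^ γ) := by
  have h1 : |φ x - φ (y + (x' - y'))| ≤ M₁ * ‖(x - y) - (x' - y')‖ := by
    refine (hlip _ _).trans (le_of_eq ?_)
    congr 2; abel
  have h2 : |(φ (y + (x' - y')) - φ (y' + (x' - y'))) - (φ (y + 0) - φ (y' + 0))|
      ≤ M₂ * ‖y - y'‖ ^ γ * ‖x' - y'‖ := by
    have hd : ∀ c w, HasFDerivAt (fun w => φ (c + w)) (fderiv ℝ φ (c + w)) w := fun c w => by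
      have := ((hφ (c + w)).hasFDerivAt).comp w ((hasFDerivAt_id w).const_add c)
      rwa [ContinuousLinearMap.comp_id] at this
    have hd' : ∀ w, HasFDerivAt (fun w => φ (y + w) - φ (y' + w))
        (fderiv ℝ φ (y + w) - fderiv ℝ φ (y' + w)) w := fun w => (hd y w).sub (hd y' w)
    have hN : 0 ≤ N := (norm_nonneg _).trans hy
    have key := Convex.norm_image_sub_le_of_norm_hasFDerivWithin_le
      (hs := convex_closedBall (0 : EuclideanSpace ℝ (Fin m)) (2 * N))
      (f := fun w => φ (y + w) - φ (y' + w)) (C := M₂ * ‖y - y'‖ ^ γ)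
      (fun w _ => (hd' w).hasFDerivWithinAt) (fun w hw => ?_) (x := 0) (y := x' - y')
      (by simpa using hN) (by
        rw [mem_closedBall_zero_iff]
        exact (norm_sub_le _ _).trans (by linarith))
    · simpa using key
    · rw [mem_closedBall_zero_iff] at hw
      have := hder (y + w) (y' + w) ((norm_add_le _ _).trans (by linarith))
        ((norm_add_le _ _).trans (by linarith))
      simpa using this
  have h3 : |(φ x' - ψ x') - (φ y' - ψ y')| ≤ δ * ‖x' - y'‖ :=
    convex_univ.norm_image_sub_le_of_norm_hasFDerivWithin_le (f := fun w => φ w - ψ w)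
      (fun w _ => ((hφ w).hasFDerivAt.sub (hψ w).hasFDerivAt).hasFDerivWithinAt)
      (fun w _ => htime w) (mem_univ y') (mem_univ x')
  have e : y' + (x' - y') = x' := by abel
  rw [e, add_zero, add_zero] at h2
  calc |(φ x - φ y) - (ψ x' - ψ y')| = |(φ x - φ (y + (x' - y'))) +
        ((φ (y + (x' - y')) - φ x') - (φ y - φ y')) + ((φ x' - ψ x') - (φ y' - ψ y'))| := by
        congr 1; ring
    _ ≤ _ := abs_add_three _ _ _
    _ ≤ _ := by linarith

/-- The coefficients of the stochastic equation satisfy the abstract conditions. -/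
lemma exists_youngCoefficients {H lam γ : ℝ}
    {b : ℝ → EuclideanSpace ℝ (Fin m) → EuclideanSpace ℝ (Fin m)}
    {σ : ℝ → EuclideanSpace ℝ (Fin m) → Matrix (Fin m) (Fin d) ℝ}
    (hlam : 0 ≤ lam) (hσ : DiffusionAssumption H lam γ σ) (hb : DriftAssumption b) :
    ∃ L M, YoungCoefficients b (fun t x => matCLM (σ t x)) L M lam γ := by
  obtain ⟨L, hL, hbL⟩ := hb.bounds
  obtain ⟨M, hM, hlip, hder, htime⟩ := hσ.bounds
  have htime' : ∀ s ∈ Icc (0 : ℝ) 1, ∀ t ∈ Icc (0 : ℝ) 1, ∀ x,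
      matNorm (σ t x - σ s x) ≤ M * |t - s| ^ lam := by
    intro s hs t ht x
    rcases Nat.eq_zero_or_pos m with rfl | hm
    · simp only [matNorm, Finset.univ_eq_empty, Finset.sum_empty, Real.sqrt_zero]; positivity
    · have := htime s hs t ht x ⟨0, hm⟩
      linarith [matNorm_nonneg (partialX σ ⟨0, hm⟩ t x - partialX σ ⟨0, hm⟩ s x)]
  have hspace : ∀ t ∈ Icc (0 : ℝ) 1, ∀ x y, ‖matCLM (σ t x) - matCLM (σ t y)‖ ≤ M * ‖x - y‖ := by
    intro t ht x y
    rw [← matCLM_sub]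
    exact (norm_matCLM_le _).trans (hlip t ht x y)
  have htimeS : ∀ s ∈ Icc (0 : ℝ) 1, ∀ t ∈ Icc (0 : ℝ) 1, ∀ x,
      ‖matCLM (σ t x) - matCLM (σ s x)‖ ≤ M * |t - s| ^ lam := by
    intro s hs t ht x
    rw [← matCLM_sub]
    exact (norm_matCLM_le _).trans (htime' s hs t ht x)
  have hMle : M ≤ M + ‖matCLM (σ 0 0)‖ := by linarith [norm_nonneg (matCLM (σ 0 0))]
  refine ⟨L, M + ‖matCLM (σ 0 0)‖, hL.le, by positivity,
    fun x => (hb.measurable x).aestronglyMeasurable, fun t ht x y => (hbL t ht).1 x y,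
    fun t ht x => (hbL t ht).2 x, fun t ht x y => (hspace t ht x y).trans (by gcongr),
    fun s hs t ht x => (htimeS s hs t ht x).trans (by gcongr), fun t ht x => ?_, fun N => ?_⟩
  · have h1 := hspace t ht x 0
    have h2 := htimeS 0 (by simp) t ht 0
    have h3 : |t - 0| ^ lam ≤ 1 := Real.rpow_le_one (abs_nonneg _)
      (by rw [sub_zero, abs_of_nonneg ht.1]; exact ht.2) hlam
    have h4 : ‖matCLM (σ t x)‖ ≤ ‖matCLM (σ t x) - matCLM (σ t 0)‖ +
        ‖matCLM (σ t 0) - matCLM (σ 0 0)‖ + ‖matCLM (σ 0 0)‖ := by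
      calc _ = ‖(matCLM (σ t x) - matCLM (σ t 0)) +
        (matCLM (σ t 0) - matCLM (σ 0 0)) + matCLM (σ 0 0)‖ := by congr 1; abel
        _ ≤ _ := norm_add₃_le
    rw [sub_zero] at h1
    nlinarith [norm_nonneg x, norm_nonneg (matCLM (σ 0 0))]
  · obtain ⟨MN, hMN, hMNd⟩ := hder (3 * |N| + 1) (by positivity)
    refine ⟨m * d * (M + m * M + m * MN), by positivity, ?_⟩
    intro s hs t ht x y x' y' hx hy hx' hy'
    have hentry : ∀ (i : Fin m) (j : Fin d),
        |((σ t x - σ t y) - (σ s x' - σ s y')) i j| ≤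
        (M + m * M + m * MN) * (‖(x - y) - (x' - y')‖ +
          ‖x' - y'‖ * (|t - s| ^ lam + ‖y - y'‖ ^ γ)) := by
      intro i j
      have key := abs_four_point_le (φ := fun z => σ t z i j) (ψ := fun z => σ s z i j)
        (hσ.differentiable t ht i j) (hσ.differentiable s hs i j) (N := |N|) (M₁ := M)
        (M₂ := m * MN) (δ := m * (M * |t - s| ^ lam)) (γ := γ)
        (fun z w => (abs_entry_le (σ t z - σ t w) i j).trans (hlip t ht z w))
        (fun z w hz hw => ?_) (fun z => ?_) (x := x) (hx'.trans (le_abs_self _))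
        (hy.trans (le_abs_self _)) (hy'.trans (le_abs_self _))
      · refine key.trans ?_
        set P := ‖(x - y) - (x' - y')‖
        set Z := ‖x' - y'‖
        set A := |t - s| ^ lam
        set D := ‖y - y'‖ ^ γ
        have hP : 0 ≤ P := norm_nonneg _
        have hZ : 0 ≤ Z := norm_nonneg _
        have hA : 0 ≤ A := by positivity
        have hD : 0 ≤ D := by positivity
        have c1 : 0 ≤ (m * M + m * MN) * P := by positivity
        have c2 : 0 ≤ (M + m * MN) * (Z * A) := by positivity
        have c3 : 0 ≤ (M + m * M) * (Z * D) := by positivity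
        nlinarith
      · rw [mul_assoc]
        refine norm_functional_le _ (by positivity) fun k => ?_
        exact (abs_entry_le (partialX σ k t z - partialX σ k t w) i j).trans
          (hMNd t ht z w (max_le (by linarith) (by linarith)) k)
      · refine norm_functional_le _ (by positivity) fun k => ?_
        refine (abs_entry_le (partialX σ k t z - partialX σ k s z) i j).trans ?_
        linarith [htime s hs t ht z k, matNorm_nonneg (σ t z - σ s z)]
    have := norm_matCLM_le_of_entries (by positivity) hentry
    rw [matCLM_sub, matCLM_sub, matCLM_sub] at this
    exact this.trans (le_of_eq (by ring))

end Matrix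

/-! ### Solutions in the Riemann-Stieltjes sense and Young solutions -/

section Bridge

variable {m d : ℕ}

lemma abs_entry_le_norm_matCLM (A : Matrix (Fin m) (Fin d) ℝ) (i : Fin m) (j : Fin d) :
    |A i j| ≤ ‖matCLM A‖ := by
  have e : matCLM A (EuclideanSpace.single j 1) i = A i j := by
    rw [matCLM_apply]
    simp
  rw [← e]
  refine (PiLp.norm_apply_le (matCLM A (EuclideanSpace.single j 1)) i).trans ?_
  simpa using (matCLM A).le_opNorm (EuclideanSpace.single j (1 : ℝ))

/-- The Young integrals of the entries of the coefficient along a Hölder path. -/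
lemma exists_young_integrals {b : ℝ → EuclideanSpace ℝ (Fin m) → EuclideanSpace ℝ (Fin m)}
    {σ : ℝ → EuclideanSpace ℝ (Fin m) → Matrix (Fin m) (Fin d) ℝ} {L M lam γ a β X G : ℝ}
    (hS : YoungCoefficients b (fun t x => matCLM (σ t x)) L M lam γ) (ha : 0 < a) (hal : a ≤ lam)
    (haβ : a ≤ β) (hβ : β ≤ 1) (hlt : 1 < a + β) (hG : 0 ≤ G) (hX : 0 ≤ X)
    {g : ℝ → EuclideanSpace ℝ (Fin d)}
    (hg : ∀ u v, 0 ≤ u → u ≤ v → v ≤ 1 → ‖g v - g u‖ ≤ G * (v - u) ^ β)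
    {x : ℝ → EuclideanSpace ℝ (Fin m)}
    (hx : ∀ u v, 0 ≤ u → u ≤ v → v ≤ 1 → ‖x v - x u‖ ≤ X * (v - u) ^ a) :
    ∃ (I : Fin m → Fin d → ℝ → ℝ) (C : ℝ), 0 ≤ C ∧ ∀ i j, I i j 0 = 0 ∧
      (∀ u v, 0 ≤ u → u ≤ v → v ≤ 1 →
        |I i j v - I i j u - σ u (x u) i j * (g v j - g u j)| ≤ C * (v - u) ^ (a + β)) ∧
      ∀ t ∈ Icc (0 : ℝ) 1,
        HasRSIntegral (fun s => σ s (x s) i j) (fun s => g s j) 0 t (I i j t) := by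
  have hM := hS.M_nonneg
  have hf : ∀ i j u v, 0 ≤ u → u ≤ v → v ≤ 1 →
      |σ v (x v) i j - σ u (x u) i j| ≤ M * (1 + X) * (v - u) ^ a := by
    intro i j u v hu huv hv
    have hu' : u ∈ Icc (0 : ℝ) 1 := ⟨hu, huv.trans hv⟩
    have hv' : v ∈ Icc (0 : ℝ) 1 := ⟨hu.trans huv, hv⟩
    have h1 := hS.time u hu' v hv' (x v)
    have h2 := hS.space u hu' (x v) (x u)
    rw [abs_of_nonneg (sub_nonneg.2 huv)] at h1
    have h3 : (v - u) ^ lam ≤ (v - u) ^ a :=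
      rpow_le_rpow_of_le_one (by linarith) (by linarith) ha hal
    have h4 := hx u v hu huv hv
    calc |σ v (x v) i j - σ u (x u) i j| ≤ ‖matCLM (σ v (x v) - σ u (x u))‖ :=
          abs_entry_le_norm_matCLM (σ v (x v) - σ u (x u)) i j
      _ = ‖matCLM (σ v (x v)) - matCLM (σ u (x u))‖ := by rw [matCLM_sub]
      _ ≤ ‖matCLM (σ v (x v)) - matCLM (σ u (x v))‖ + ‖matCLM (σ u (x v)) - matCLM (σ u (x u))‖ :=
          norm_sub_le_norm_sub_add_norm_sub _ _ _
      _ ≤ M * (v - u) ^ a + M * (X * (v - u) ^ a) := by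
          refine add_le_add (h1.trans ?_) (h2.trans ?_) <;> gcongr
      _ = _ := by ring
  have hgj : ∀ j u v, 0 ≤ u → u ≤ v → v ≤ 1 → |g v j - g u j| ≤ G * (v - u) ^ β :=
    fun j u v hu huv hv => (PiLp.norm_apply_le (g v - g u) j).trans (hg u v hu huv hv)
  have hY := fun i j => exists_young_integral (f := fun s => σ s (x s) i j) (g := fun s => g s j)
    ha haβ hβ hlt (by positivity : 0 ≤ M * (1 + X)) hG (hf i j) (hgj j)
  choose I C hC hI0 hI using hY
  refine ⟨I, ∑ i, ∑ j, C i j, Finset.sum_nonneg fun i _ => Finset.sum_nonneg fun j _ => hC i j,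
    fun i j => ⟨hI0 i j, fun u v hu huv hv => (hI i j u v hu huv hv).trans ?_, fun t ht => ?_⟩⟩
  · apply mul_le_mul_of_nonneg_right _ (Real.rpow_nonneg (by linarith) _)
    exact (Finset.single_le_sum (f := fun j => C i j) (fun j _ => hC i j)
      (Finset.mem_univ j)).trans (Finset.single_le_sum (f := fun i => ∑ j, C i j)
      (fun i _ => Finset.sum_nonneg fun j _ => hC i j) (Finset.mem_univ i))
  · have := hasRSIntegral_of_young ha (ha.trans_le haβ) hlt
      (fun u v hu huv hv => hf i j u v hu huv (hv.trans ht.2))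
      (fun u v hu huv hv => hgj j u v hu huv (hv.trans ht.2)) (by positivity) hG (hC i j)
      (fun u v hu huv hv => hI i j u v hu huv (hv.trans ht.2)) ht.1
    rwa [hI0, sub_zero] at this

lemma matCLM_smul_sub_apply (A : Matrix (Fin m) (Fin d) ℝ) (c : ℝ)
    (v w : EuclideanSpace ℝ (Fin d)) (i : Fin m) :
    matCLM A (c • v - c • w) i = c * ∑ j, A i j * (v j - w j) := by
  rw [matCLM_apply, Finset.mul_sum]
  refine Finset.sum_congr rfl fun j _ => ?_
  simp only [PiLp.sub_apply, PiLp.smul_apply, smul_eq_mul]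
  ring

lemma intervalIntegral_apply {f : ℝ → EuclideanSpace ℝ (Fin m)} {u v : ℝ}
    (hf : IntervalIntegrable f volume u v) (i : Fin m) :
    (∫ r in u..v, f r) i = ∫ r in u..v, f r i :=
  ((EuclideanSpace.proj i : EuclideanSpace ℝ (Fin m) →L[ℝ] ℝ).intervalIntegral_comp_comm hf).symm

lemma intervalIntegrable_apply {f : ℝ → EuclideanSpace ℝ (Fin m)} {u v : ℝ}
    (hf : IntervalIntegrable f volume u v) (i : Fin m) :
    IntervalIntegrable (fun r => f r i) volume u v :=
  ⟨(EuclideanSpace.proj i : EuclideanSpace ℝ (Fin m) →L[ℝ] ℝ).integrable_comp hf.1,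
    (EuclideanSpace.proj i : EuclideanSpace ℝ (Fin m) →L[ℝ] ℝ).integrable_comp hf.2⟩

lemma IsYoungSolution.isSolution
    {b : ℝ → EuclideanSpace ℝ (Fin m) → EuclideanSpace ℝ (Fin m)}
    {σ : ℝ → EuclideanSpace ℝ (Fin m) → Matrix (Fin m) (Fin d) ℝ} {L M lam γ κ β G α ε : ℝ}
    (hS : YoungCoefficients b (fun t x => matCLM (σ t x)) L M lam γ)
    (he : YoungExponents β κ lam γ) (hα : 0 < α) (hαβ : α < β) (hG : 0 ≤ G)
    {g : ℝ → EuclideanSpace ℝ (Fin d)}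
    (hg : ∀ u v, 0 ≤ u → u ≤ v → v ≤ 1 → ‖g v - g u‖ ≤ G * (v - u) ^ β)
    {x₀ : EuclideanSpace ℝ (Fin m)} {x : ℝ → EuclideanSpace ℝ (Fin m)}
    (hx : IsYoungSolution b (fun t x => matCLM (σ t x)) x₀ (fun t => Real.sqrt ε • g t) κ β x) :
    IsSolution b σ x₀ α ε g x := by
  obtain ⟨X, hX, hhol⟩ := hx.holder
  obtain ⟨C₁, hC₁⟩ := hx.germ
  have hβ := he.beta_pos
  have hholκ : ∀ u v, 0 ≤ u → u ≤ v → v ≤ 1 → ‖x v - x u‖ ≤ X * (v - u) ^ κ :=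
    fun u v hu huv hv => (hhol u v hu huv hv).trans (mul_le_mul_of_nonneg_left
      (rpow_le_rpow_of_le_one (by linarith) (by linarith) he.kappa_pos he.kappa_le) hX)
  obtain ⟨I, C, hC, hI⟩ := exists_young_integrals hS he.kappa_pos he.kappa_le_lam he.kappa_le
    he.beta_le he.one_lt hG hX hg hholκ
  have hint : ∀ u ∈ Icc (0 : ℝ) 1, ∀ v ∈ Icc (0 : ℝ) 1,
      IntervalIntegrable (fun r => b r (x r)) volume u v := fun u hu v hv =>
    hS.intervalIntegrable_holder hβ hX hhol hu hv
  refine ⟨memW_of_holder hα hαβ hX hhol, fun t ht => ⟨fun i j => I i j t,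
    fun i j => (hI i j).2.2 t ht,
    fun i => ⟨intervalIntegrable_apply (hint 0 (by simp) t ht) i, ?_⟩⟩⟩
  have key := eq_of_norm_sub_le_rpow (a := 0) (b := 1) (θ := κ + β)
    (C := C₁ + Real.sqrt ε * (d * C))
    (φ := fun t => x t i - (∫ r in (0 : ℝ)..t, b r (x r)) i - Real.sqrt ε * ∑ j, I i j t)
    he.one_lt (fun u v hu huv hv => ?_) 0 t le_rfl ht.1 ht.2
  · simp only [intervalIntegral.integral_same, hx.init, (hI i _).1, Finset.sum_const_zero,
      mul_zero, sub_zero, PiLp.zero_apply] at key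
    rw [← intervalIntegral_apply (hint 0 (by simp) t ht)]
    linarith
  · have hu' : u ∈ Icc (0 : ℝ) 1 := ⟨hu, huv.trans hv⟩
    have hv' : v ∈ Icc (0 : ℝ) 1 := ⟨hu.trans huv, hv⟩
    have h1 : |x v i - x u i - (∫ r in u..v, b r (x r)) i -
        Real.sqrt ε * ∑ j, σ u (x u) i j * (g v j - g u j)| ≤ C₁ * (v - u) ^ (κ + β) := by
      have := (PiLp.norm_apply_le _ i).trans (hC₁ u v hu huv hv)
      simpa only [PiLp.sub_apply, matCLM_smul_sub_apply, Real.norm_eq_abs] using this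
    have h2 : |∑ j, (I i j v - I i j u - σ u (x u) i j * (g v j - g u j))|
        ≤ d * C * (v - u) ^ (κ + β) := by
      refine (Finset.abs_sum_le_sum_abs _ _).trans ((Finset.sum_le_sum fun j _ =>
        (hI i j).2.1 u v hu huv hv).trans (le_of_eq ?_))
      simp [mul_assoc]
    have h3 : Real.sqrt ε * |∑ j, (I i j v - I i j u - σ u (x u) i j * (g v j - g u j))|
        ≤ Real.sqrt ε * (d * C * (v - u) ^ (κ + β)) :=
      mul_le_mul_of_nonneg_left h2 (Real.sqrt_nonneg _)
    have e0 : (∫ r in (0 : ℝ)..v, b r (x r)) - (∫ r in (0 : ℝ)..u, b r (x r)) =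
        ∫ r in u..v, b r (x r) := intervalIntegral.integral_interval_sub_left
      (hint 0 (by simp) v hv') (hint 0 (by simp) u hu')
    have e1 : (∫ r in u..v, b r (x r)) i = (∫ r in (0 : ℝ)..v, b r (x r)) i -
        (∫ r in (0 : ℝ)..u, b r (x r)) i := by rw [← e0]; rfl
    rw [e1] at h1
    rw [Real.norm_eq_abs]
    calc _ = |(x v i - x u i - ((∫ r in (0 : ℝ)..v, b r (x r)) i -
          (∫ r in (0 : ℝ)..u, b r (x r)) i) -
          Real.sqrt ε * ∑ j, σ u (x u) i j * (g v j - g u j)) -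
          Real.sqrt ε * ∑ j, (I i j v - I i j u - σ u (x u) i j * (g v j - g u j))| := by
          congr 1
          simp only [Finset.sum_sub_distrib]
          ring
      _ ≤ _ := abs_sub _ _
      _ ≤ _ := by
          rw [abs_mul, abs_of_nonneg (Real.sqrt_nonneg _)]
          linarith

/-- A solution in `W_0^{α,∞}` is a Young solution. Away from `0` it is `α`-Hölder; since the
Riemann-Stieltjes integrals do not see the value of the integrand at `0`, the equation makes the
path `β`-Hölder on `[0, 1]`, and the Young estimate for the integrals is the germ estimate. -/
lemma IsSolution.isYoungSolution
    {b : ℝ → EuclideanSpace ℝ (Fin m) → EuclideanSpace ℝ (Fin m)}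
    {σ : ℝ → EuclideanSpace ℝ (Fin m) → Matrix (Fin m) (Fin d) ℝ} {L M lam γ κ β G α ε : ℝ}
    (hS : YoungCoefficients b (fun t x => matCLM (σ t x)) L M lam γ)
    (he : YoungExponents β κ lam γ) (hα : 0 < α) (hαβ : α < β) (hαlam : α ≤ lam)
    (hlt : 1 < α + β) (hG : 0 ≤ G) {g : ℝ → EuclideanSpace ℝ (Fin d)}
    (hg : ∀ u v, 0 ≤ u → u ≤ v → v ≤ 1 → ‖g v - g u‖ ≤ G * (v - u) ^ β)
    {x₀ : EuclideanSpace ℝ (Fin m)} {x : ℝ → EuclideanSpace ℝ (Fin m)}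
    (hx : IsSolution b σ x₀ α ε g x) :
    IsYoungSolution b (fun t x => matCLM (σ t x)) x₀ (fun t => Real.sqrt ε • g t) κ β x := by
  have hβ := he.beta_pos
  have hL := hS.L_nonneg
  have hM := hS.M_nonneg
  obtain ⟨x', X', hX', hxx', hhol'⟩ := hx.mem.exists_holder_modification hα
  obtain ⟨I', C', hC', hI'⟩ := exists_young_integrals hS hα hαlam hαβ.le he.beta_le hlt hG hX' hg
    hhol'
  -- the equation with the Young integrals of the modified path
  have heq : ∀ t ∈ Icc (0 : ℝ) 1, ∀ i, IntervalIntegrable (fun s => b s (x s) i) volume 0 t ∧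
      x t i = x₀ i + (∫ s in (0 : ℝ)..t, b s (x s) i) + Real.sqrt ε * ∑ j, I' i j t := by
    intro t ht i
    obtain ⟨J, hJ, hJ2⟩ := hx.equation t ht
    refine ⟨(hJ2 i).1, (hJ2 i).2.trans ?_⟩
    congr 2
    refine Finset.sum_congr rfl fun j _ => ?_
    exact (hJ i j).unique_of_eq_off_zero ht.1 ((hI' i j).2.2 t ht)
      fun s hs _ => by rw [hxx' s hs]
  have hinit : x 0 = x₀ := by
    ext i
    have := (heq 0 (by simp) i).2
    simpa [(hI' i _).1] using this
  set R := (sobolevNorm α x).toReal with hR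
  have hxR : ∀ t ∈ Icc (0 : ℝ) 1, ‖x t‖ ≤ R := fun t ht => by
    rw [← toReal_enorm]
    exact ENNReal.toReal_mono hx.mem.2.ne (MemW.enorm_le ht)
  have hx'R : ∀ t ∈ Icc (0 : ℝ) 1, ‖x' t‖ ≤ ‖x' 0‖ + X' := fun t ht =>
    norm_le_of_holder hα.le hX' hhol' ht
  have hR0 : 0 ≤ R := ENNReal.toReal_nonneg
  set N := ‖x' 0‖ + X' with hN
  have hN0 : 0 ≤ N := by positivity
  set X := m * (L * (1 + R) + Real.sqrt ε * (d * (M * (1 + N) * G + C'))) with hXdef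
  have hX : 0 ≤ X := by positivity
  have hhol : ∀ u v, 0 ≤ u → u ≤ v → v ≤ 1 → ‖x v - x u‖ ≤ X * (v - u) ^ β := by
    intro u v hu huv hv
    have hu' : u ∈ Icc (0 : ℝ) 1 := ⟨hu, huv.trans hv⟩
    have hv' : v ∈ Icc (0 : ℝ) 1 := ⟨hu.trans huv, hv⟩
    have hvu : 0 ≤ v - u := by linarith
    have hvu1 : v - u ≤ 1 := by linarith
    set l := (v - u) ^ β with hl
    have hl0 : 0 ≤ l := Real.rpow_nonneg hvu _
    have hcoord : ∀ i, |(x v - x u) i| ≤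
        (L * (1 + R) + Real.sqrt ε * (d * (M * (1 + N) * G + C'))) * l := by
      intro i
      have e1 : (∫ s in (0 : ℝ)..v, b s (x s) i) - (∫ s in (0 : ℝ)..u, b s (x s) i) =
          ∫ s in u..v, b s (x s) i := intervalIntegral.integral_interval_sub_left
        (heq v hv' i).1 (heq u hu' i).1
      have e2 : |∫ s in u..v, b s (x s) i| ≤ L * (1 + R) * l := by
        refine (norm_integral_le_mul_sub (E := ℝ) huv (c := L * (1 + R)) fun r h1 h2 => ?_).trans ?_
        · have hr : r ∈ Icc (0 : ℝ) 1 := ⟨hu.trans h1, h2.trans hv⟩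
          refine (PiLp.norm_apply_le (b r (x r)) i).trans ((hS.drift_growth r hr _).trans ?_)
          have := hxR r hr
          gcongr
        · apply mul_le_mul_of_nonneg_left _ (by positivity)
          have := rpow_le_rpow_of_le_one hvu hvu1 hβ he.beta_le
          rwa [Real.rpow_one] at this
      have e3 : ∀ j, |I' i j v - I' i j u| ≤ (M * (1 + N) * G + C') * l := by
        intro j
        have h1 := (hI' i j).2.1 u v hu huv hv
        have h2 : (v - u) ^ (α + β) ≤ l := rpow_le_rpow_of_le_one hvu hvu1 hβ (by linarith)
        have h3 : |σ u (x' u) i j| ≤ M * (1 + N) :=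
          (abs_entry_le_norm_matCLM _ i j).trans ((hS.growth u hu' _).trans (by
            have := hx'R u hu'
            gcongr))
        have h4 : |g v j - g u j| ≤ G * l :=
          (PiLp.norm_apply_le (g v - g u) j).trans (hg u v hu huv hv)
        calc |I' i j v - I' i j u| = |(I' i j v - I' i j u - σ u (x' u) i j * (g v j - g u j)) +
              σ u (x' u) i j * (g v j - g u j)| := by congr 1; ring
          _ ≤ _ := abs_add_le _ _
          _ ≤ C' * l + M * (1 + N) * (G * l) := by
              rw [abs_mul]
              refine add_le_add (h1.trans (by gcongr)) (by gcongr)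
          _ = _ := by ring
      have e4 : |∑ j, (I' i j v - I' i j u)| ≤ d * (M * (1 + N) * G + C') * l := by
        refine (Finset.abs_sum_le_sum_abs _ _).trans ((Finset.sum_le_sum fun j _ =>
          e3 j).trans (le_of_eq ?_))
        simp [mul_assoc]
      have e5 : Real.sqrt ε * |∑ j, (I' i j v - I' i j u)| ≤
          Real.sqrt ε * (d * (M * (1 + N) * G + C') * l) :=
        mul_le_mul_of_nonneg_left e4 (Real.sqrt_nonneg _)
      calc |(x v - x u) i| = |(∫ s in u..v, b s (x s) i) +
            Real.sqrt ε * ∑ j, (I' i j v - I' i j u)| := by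
            rw [PiLp.sub_apply, (heq v hv' i).2, (heq u hu' i).2, ← e1, Finset.sum_sub_distrib]
            congr 1; ring
        _ ≤ _ := abs_add_le _ _
        _ ≤ _ := by
            rw [abs_mul, abs_of_nonneg (Real.sqrt_nonneg _)]
            linarith
    refine (norm_le_sum_abs _).trans ((Finset.sum_le_sum fun i _ => hcoord i).trans (le_of_eq ?_))
    simp only [Finset.sum_const, Finset.card_univ, Fintype.card_fin, nsmul_eq_mul, hXdef]
    ring
  have hholκ : ∀ u v, 0 ≤ u → u ≤ v → v ≤ 1 → ‖x v - x u‖ ≤ X * (v - u) ^ κ :=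
    fun u v hu huv hv => (hhol u v hu huv hv).trans (mul_le_mul_of_nonneg_left
      (rpow_le_rpow_of_le_one (by linarith) (by linarith) he.kappa_pos he.kappa_le) hX)
  obtain ⟨I, C, hC, hI⟩ := exists_young_integrals hS he.kappa_pos he.kappa_le_lam he.kappa_le
    he.beta_le he.one_lt hG hX hg hholκ
  have hII' : ∀ t ∈ Icc (0 : ℝ) 1, ∀ i j, I' i j t = I i j t := fun t ht i j =>
    ((hI' i j).2.2 t ht).unique_of_eq_off_zero ht.1 ((hI i j).2.2 t ht)
      fun s hs _ => by rw [hxx' s hs]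
  refine ⟨hinit, ⟨X, hX, hhol⟩, ⟨m * (Real.sqrt ε * (d * C)), fun u v hu huv hv => ?_⟩⟩
  have hu' : u ∈ Icc (0 : ℝ) 1 := ⟨hu, huv.trans hv⟩
  have hv' : v ∈ Icc (0 : ℝ) 1 := ⟨hu.trans huv, hv⟩
  have hcoord : ∀ i, |(x v - x u - (∫ r in u..v, b r (x r)) -
      matCLM (σ u (x u)) (Real.sqrt ε • g v - Real.sqrt ε • g u)) i| ≤
      Real.sqrt ε * (d * C) * (v - u) ^ (κ + β) := by
    intro i
    have e1 : (∫ s in (0 : ℝ)..v, b s (x s) i) - (∫ s in (0 : ℝ)..u, b s (x s) i) =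
        ∫ s in u..v, b s (x s) i := intervalIntegral.integral_interval_sub_left
      (heq v hv' i).1 (heq u hu' i).1
    have h2 : |∑ j, (I i j v - I i j u - σ u (x u) i j * (g v j - g u j))|
        ≤ d * C * (v - u) ^ (κ + β) := by
      refine (Finset.abs_sum_le_sum_abs _ _).trans ((Finset.sum_le_sum fun j _ =>
        (hI i j).2.1 u v hu huv hv).trans (le_of_eq ?_))
      simp [mul_assoc]
    calc _ = |Real.sqrt ε * ∑ j, (I i j v - I i j u - σ u (x u) i j * (g v j - g u j))| := by
          congr 1
          simp only [PiLp.sub_apply, matCLM_smul_sub_apply]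
          rw [intervalIntegral_apply (hS.intervalIntegrable_holder hβ hX hhol hu' hv'), ← e1,
            (heq v hv' i).2, (heq u hu' i).2]
          simp only [hII' v hv', hII' u hu', Finset.sum_sub_distrib]
          ring
      _ ≤ Real.sqrt ε * (d * C * (v - u) ^ (κ + β)) := by
          rw [abs_mul, abs_of_nonneg (Real.sqrt_nonneg _)]
          exact mul_le_mul_of_nonneg_left h2 (Real.sqrt_nonneg _)
      _ = _ := by ring
  refine (norm_le_sum_abs _).trans ((Finset.sum_le_sum fun i _ => hcoord i).trans (le_of_eq ?_))
  simp only [Finset.sum_const, Finset.card_univ, Fintype.card_fin, nsmul_eq_mul]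
  ring

end Bridge

/-! ### Chaining along dyadic points -/

/-- The constant of the dyadic chaining lemma. -/
noncomputable def chainC (β : ℝ) : ℝ :=
  2 ^ β * (2 * (2 ^ (-β) / (1 - 2 ^ (-β))) + 1)

lemma two_rpow_neg_lt_one {β : ℝ} (hβ : 0 < β) : (2 : ℝ) ^ (-β) < 1 :=
  Real.rpow_lt_one_of_one_lt_of_neg (by norm_num) (by linarith)

lemma chainC_nonneg {β : ℝ} (hβ : 0 < β) : 0 ≤ chainC β := by
  have : 0 < 1 - (2 : ℝ) ^ (-β) := by linarith [two_rpow_neg_lt_one hβ]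
  unfold chainC
  positivity

/-- A continuous path whose increments over dyadic intervals of length `2 ^ (-n)` are of order
`2 ^ (-n β)` is `β`-Hölder. -/
lemma holder_of_dyadic {A : Type*} [NormedAddCommGroup A] {f : ℝ → A} {β K : ℝ} (hβ : 0 < β)
    (hf : ContinuousOn f (Icc (0 : ℝ) 1))
    (h : ∀ n k : ℕ, k < 2 ^ n →
      ‖f (((k + 1 : ℕ) : ℝ) / 2 ^ n) - f ((k : ℝ) / 2 ^ n)‖ ≤ K * (2 ^ (-β)) ^ n) :
    ∀ u v, 0 ≤ u → u ≤ v → v ≤ 1 → ‖f v - f u‖ ≤ chainC β * K * (v - u) ^ β := by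
  set ρ : ℝ := 2 ^ (-β) with hρ
  have hρ0 : 0 < ρ := by positivity
  have hρ1 : ρ < 1 := two_rpow_neg_lt_one hβ
  have hK : 0 ≤ K := by
    have := (norm_nonneg _).trans (h 0 0 (by norm_num))
    simpa using this
  have hfl : ∀ t ∈ Icc (0 : ℝ) 1, ∀ n : ℕ, (⌊2 ^ n * t⌋₊ : ℝ) / 2 ^ n ∈ Icc (0 : ℝ) 1 ∧
      ⌊2 ^ n * t⌋₊ ≤ 2 ^ n := by
    intro t ht n
    have h1 : (⌊(2 : ℝ) ^ n * t⌋₊ : ℝ) ≤ 2 ^ n :=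
      (Nat.floor_le (mul_nonneg (by positivity) ht.1)).trans
        (mul_le_of_le_one_right (by positivity) ht.2)
    refine ⟨⟨by positivity, (div_le_one (by positivity)).2 h1⟩, by exact_mod_cast h1⟩
  -- consecutive dyadic approximations of `t` agree or are neighbours
  have hstep : ∀ t ∈ Icc (0 : ℝ) 1, ∀ n : ℕ,
      dist (f ((⌊2 ^ n * t⌋₊ : ℝ) / 2 ^ n)) (f ((⌊2 ^ (n + 1) * t⌋₊ : ℝ) / 2 ^ (n + 1)))
        ≤ K * ρ * ρ ^ n := by
    intro t ht n
    set a := ⌊(2 : ℝ) ^ n * t⌋₊ with ha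
    set c := ⌊(2 : ℝ) ^ (n + 1) * t⌋₊ with hc
    have ht2 : (0 : ℝ) ≤ 2 ^ n * t := mul_nonneg (by positivity) ht.1
    have h1 : 2 * a ≤ c := by
      rw [hc, Nat.le_floor_iff (mul_nonneg (by positivity) ht.1)]
      have := Nat.floor_le ht2
      push_cast
      rw [pow_succ]
      linarith
    have h2 : c < 2 * a + 2 := by
      rw [hc, Nat.floor_lt (mul_nonneg (by positivity) ht.1)]
      have := Nat.lt_floor_add_one ((2 : ℝ) ^ n * t)
      push_cast
      rw [pow_succ]
      linarith
    have e : (a : ℝ) / 2 ^ n = ((2 * a : ℕ) : ℝ) / 2 ^ (n + 1) := by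
      push_cast; rw [pow_succ]; field_simp
    rcases (by omega : c = 2 * a ∨ c = 2 * a + 1) with h3 | h3
    · rw [e, h3, dist_self]; positivity
    · have hlt : 2 * a < 2 ^ (n + 1) := by
        have := (hfl t ht (n + 1)).2
        omega
      rw [dist_comm, dist_eq_norm, e, h3]
      refine (h (n + 1) (2 * a) hlt).trans (le_of_eq ?_)
      rw [pow_succ]; ring
  have hlim : ∀ t ∈ Icc (0 : ℝ) 1,
      Tendsto (fun n : ℕ => f ((⌊2 ^ n * t⌋₊ : ℝ) / 2 ^ n)) atTop (𝓝 (f t)) := by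
    intro t ht
    have h1 : Tendsto (fun n : ℕ => (⌊(2 : ℝ) ^ n * t⌋₊ : ℝ) / 2 ^ n) atTop (𝓝 t) := by
      have := (tendsto_nat_floor_mul_div_atTop ht.1).comp
        (tendsto_pow_atTop_atTop_of_one_lt (one_lt_two : (1 : ℝ) < 2))
      refine this.congr fun n => ?_
      simp [mul_comm]
    exact (hf t ht).tendsto.comp (tendsto_nhdsWithin_iff.2
      ⟨h1, Eventually.of_forall fun n => (hfl t ht n).1⟩)
  have hdist : ∀ t ∈ Icc (0 : ℝ) 1, ∀ p : ℕ,
      ‖f t - f ((⌊2 ^ p * t⌋₊ : ℝ) / 2 ^ p)‖ ≤ K * ρ * ρ ^ p / (1 - ρ) := by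
    intro t ht p
    rw [← dist_eq_norm, dist_comm]
    exact dist_le_of_le_geometric_of_tendsto ρ (K * ρ) hρ1 (hstep t ht) (hlim t ht) p
  intro u v hu huv hv
  rcases huv.eq_or_lt with rfl | hlt
  · simp [Real.zero_rpow hβ.ne']
  have hu' : u ∈ Icc (0 : ℝ) 1 := ⟨hu, huv.trans hv⟩
  have hv' : v ∈ Icc (0 : ℝ) 1 := ⟨hu.trans huv, hv⟩
  obtain ⟨p, hp1, hp2⟩ := exists_nat_pow_near_of_lt_one (x := v - u) (y := (1 / 2 : ℝ))
    (by linarith) (by linarith) (by norm_num) (by norm_num)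
  have hmid : ‖f ((⌊2 ^ p * v⌋₊ : ℝ) / 2 ^ p) - f ((⌊2 ^ p * u⌋₊ : ℝ) / 2 ^ p)‖ ≤ K * ρ ^ p := by
    have h2p : (0 : ℝ) < 2 ^ p := by positivity
    have h1 : (2 : ℝ) ^ p * v ≤ 2 ^ p * u + 1 := by
      have : (2 : ℝ) ^ p * (v - u) ≤ 2 ^ p * (1 / 2) ^ p := by gcongr
      rw [← mul_pow] at this
      norm_num at this
      linarith
    have h2 : ⌊(2 : ℝ) ^ p * v⌋₊ ≤ ⌊(2 : ℝ) ^ p * u⌋₊ + 1 := by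
      have := Nat.floor_le_floor h1
      rwa [Nat.floor_add_one (by positivity)] at this
    have h3 : ⌊(2 : ℝ) ^ p * u⌋₊ ≤ ⌊(2 : ℝ) ^ p * v⌋₊ := Nat.floor_le_floor (by gcongr)
    rcases (by omega : ⌊(2 : ℝ) ^ p * v⌋₊ = ⌊(2 : ℝ) ^ p * u⌋₊ ∨
      ⌊(2 : ℝ) ^ p * v⌋₊ = ⌊(2 : ℝ) ^ p * u⌋₊ + 1) with h4 | h4
    · rw [h4, sub_self, norm_zero]; positivity
    · rw [h4]
      exact h p _ (by have := (hfl v hv' p).2; omega)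
  have hρp : ρ ^ p ≤ 2 ^ β * (v - u) ^ β := by
    have e : ρ ^ (p + 1) = ((1 / 2 : ℝ) ^ (p + 1)) ^ β := by
      rw [hρ, ← Real.rpow_natCast, ← Real.rpow_mul (by norm_num), ← Real.rpow_natCast,
        ← Real.rpow_mul (by norm_num), one_div, Real.inv_rpow (by norm_num),
        ← Real.rpow_neg (by norm_num)]
      congr 1; ring
    have h1 : ρ ^ (p + 1) ≤ (v - u) ^ β := by
      rw [e]; exact Real.rpow_le_rpow (by positivity) hp1.le hβ.le
    have h2 : (2 : ℝ) ^ β * ρ = 1 := by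
      rw [hρ, ← Real.rpow_add (by norm_num)]; simp
    calc ρ ^ p = 2 ^ β * ρ ^ (p + 1) := by rw [pow_succ]; linear_combination (-ρ ^ p) * h2
      _ ≤ _ := by gcongr
  have e1 := hdist u hu' p
  have e2 := hdist v hv' p
  have hC : 0 ≤ 2 * (ρ / (1 - ρ)) + 1 := by
    have : 0 < 1 - ρ := by linarith
    positivity
  calc ‖f v - f u‖ = ‖(f v - f ((⌊2 ^ p * v⌋₊ : ℝ) / 2 ^ p)) +
        (f ((⌊2 ^ p * v⌋₊ : ℝ) / 2 ^ p) - f ((⌊2 ^ p * u⌋₊ : ℝ) / 2 ^ p)) +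
        -(f u - f ((⌊2 ^ p * u⌋₊ : ℝ) / 2 ^ p))‖ := by congr 1; abel
    _ ≤ _ := norm_add₃_le
    _ ≤ K * ρ * ρ ^ p / (1 - ρ) + K * ρ ^ p + K * ρ * ρ ^ p / (1 - ρ) := by
        rw [norm_neg]; gcongr
    _ = (2 * (ρ / (1 - ρ)) + 1) * K * ρ ^ p := by ring
    _ ≤ (2 * (ρ / (1 - ρ)) + 1) * K * (2 ^ β * (v - u) ^ β) := by gcongr
    _ = chainC β * K * (v - u) ^ β := by rw [chainC, ← hρ]; ring

/-! ### Exponential moments of the Hölder constant of fractional Brownian motion -/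

/-- For `q < 2` the power `x ^ q` is dominated by any multiple of `x ^ 2`, up to a constant. -/
lemma rpow_le_mul_sq_add {q η : ℝ} (hq : 0 ≤ q) (hq2 : q < 2) (hη : 0 < η) :
    ∃ C, 0 ≤ C ∧ ∀ x, 0 ≤ x → x ^ q ≤ η * x ^ 2 + C := by
  refine ⟨((1 / η) ^ (1 / (2 - q))) ^ q, by positivity, fun x hx => ?_⟩
  have h2q : 0 < 2 - q := by linarith
  by_cases h : x ≤ (1 / η) ^ (1 / (2 - q))
  · have := Real.rpow_le_rpow hx h hq
    have : 0 ≤ η * x ^ 2 := by positivity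
    linarith
  · push Not at h
    have hx0 : 0 < x := lt_of_le_of_lt (by positivity) h
    have h1 : 1 / η ≤ x ^ (2 - q) := by
      have := Real.rpow_le_rpow (by positivity) h.le h2q.le
      rwa [← Real.rpow_mul (by positivity), one_div_mul_cancel h2q.ne', Real.rpow_one] at this
    have h2 : 1 ≤ η * x ^ (2 - q) := by
      rw [div_le_iff₀ hη] at h1; linarith
    have h3 : x ^ (2 - q) * x ^ q = x ^ 2 := by
      rw [← Real.rpow_add hx0, sub_add_cancel]; norm_cast
    have h4 : 0 ≤ ((1 / η) ^ (1 / (2 - q))) ^ q := by positivity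
    calc x ^ q ≤ η * x ^ (2 - q) * x ^ q := le_mul_of_one_le_left (by positivity) h2
      _ = η * x ^ 2 := by rw [mul_assoc, h3]
      _ ≤ _ := by linarith

lemma lintegral_exp_sq_gaussian_lt_top :
    ∫⁻ z, ENNReal.ofReal (Real.exp (z ^ 2 / 4)) ∂(gaussianReal 0 1) < ∞ := by
  rw [gaussianReal_of_var_ne_zero _ one_ne_zero,
    lintegral_withDensity_eq_lintegral_mul _ (measurable_gaussianPDF _ _) (by fun_prop)]
  have hint : Integrable (fun z : ℝ =>
      (Real.sqrt (2 * Real.pi * 1))⁻¹ * Real.exp (-(1 / 4) * z ^ 2)) :=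
    (integrable_exp_neg_mul_sq (by norm_num)).const_mul _
  refine lt_of_le_of_lt (le_of_eq ?_) hint.lintegral_lt_top
  refine lintegral_congr fun z => ?_
  rw [Pi.mul_apply, gaussianPDF, ← ENNReal.ofReal_mul (gaussianPDFReal_nonneg _ _ _),
    gaussianPDFReal, mul_assoc, ← Real.exp_add]
  congr 3
  simp only [NNReal.coe_one]
  ring

/-- A power times an exponential of order less than two has a Gaussian expectation, which
inherits the smallness of the variance. -/
lemma exists_lintegral_rpow_exp_le {q D : ℝ} (hq : 0 ≤ q) (hq2 : q < 2) (hD : 0 ≤ D) (R : ℕ) :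
    ∃ C : ℝ≥0∞, C < ∞ ∧ ∀ {Ω : Type*} [MeasurableSpace Ω] (P : Measure Ω) (X : Ω → ℝ) (s c : ℝ),
      Measurable X → 0 ≤ s → 0 ≤ c → c * s ≤ 1 →
      P.map X = gaussianReal 0 (s ^ 2).toNNReal →
      ∫⁻ ω, ENNReal.ofReal ((c * |X ω|) ^ (2 * R) * Real.exp (D * (2 * (c * |X ω|)) ^ q)) ∂P ≤
        ENNReal.ofReal ((c * s) ^ (2 * R)) * C := by
  obtain ⟨A, hA, hAq⟩ := rpow_le_mul_sq_add hq hq2 (η := 1 / (32 * D + 1)) (by positivity)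
  refine ⟨ENNReal.ofReal (8 ^ R * R.factorial * Real.exp (D * A)) *
    ∫⁻ z, ENNReal.ofReal (Real.exp (z ^ 2 / 4)) ∂(gaussianReal 0 1),
    ENNReal.mul_lt_top ENNReal.ofReal_lt_top lintegral_exp_sq_gaussian_lt_top, ?_⟩
  intro Ω _ P X s c hX hs hc hcs hlaw
  have hF : Measurable fun x : ℝ =>
      ENNReal.ofReal ((c * |x|) ^ (2 * R) * Real.exp (D * (2 * (c * |x|)) ^ q)) := by
    have : Measurable fun x : ℝ => |x| := measurable_norm
    fun_prop
  have hlaw2 : gaussianReal 0 (s ^ 2).toNNReal = (gaussianReal 0 1).map (fun z => s * z) := by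
    rw [gaussianReal_map_const_mul]
    congr 1
    · simp
    · rw [mul_one]; ext; simp [sq_nonneg]
  rw [← lintegral_map hF hX, hlaw, hlaw2, lintegral_map hF (by fun_prop),
    ← mul_assoc, ← ENNReal.ofReal_mul (by positivity),
    ← lintegral_const_mul' _ _ ENNReal.ofReal_ne_top]
  refine lintegral_mono fun z => ?_
  rw [← ENNReal.ofReal_mul (by positivity)]
  apply ENNReal.ofReal_le_ofReal
  rw [abs_mul, abs_of_nonneg hs, ← mul_assoc]
  have h1 : |z| ^ (2 * R) ≤ 8 ^ R * R.factorial * Real.exp (z ^ 2 / 8) := by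
    have := Real.pow_div_factorial_le_exp (z ^ 2 / 8) (by positivity) R
    rw [div_le_iff₀ (by positivity), div_pow, div_le_iff₀ (by positivity)] at this
    rw [pow_mul, sq_abs]
    linarith
  have h2 : D * (2 * (c * s * |z|)) ^ q ≤ z ^ 2 / 8 + D * A := by
    have e1 : 2 * (c * s * |z|) ≤ 2 * |z| := by
      have : c * s * |z| ≤ 1 * |z| := by gcongr
      linarith
    have e2 : (2 * (c * s * |z|)) ^ q ≤ (2 * |z|) ^ q := Real.rpow_le_rpow (by positivity) e1 hq
    have e3 := hAq (2 * |z|) (by positivity)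
    have e4 : D * (1 / (32 * D + 1) * (2 * |z|) ^ 2) ≤ z ^ 2 / 8 := by
      rw [mul_pow, sq_abs]
      have : D * (1 / (32 * D + 1)) ≤ 1 / 32 := by
        rw [mul_one_div, div_le_div_iff₀ (by positivity) (by norm_num)]; linarith
      calc D * (1 / (32 * D + 1) * (2 ^ 2 * z ^ 2)) =
            D * (1 / (32 * D + 1)) * (4 * z ^ 2) := by ring
        _ ≤ 1 / 32 * (4 * z ^ 2) := by gcongr
        _ = _ := by ring
    calc D * (2 * (c * s * |z|)) ^ q ≤ D * (1 / (32 * D + 1) * (2 * |z|) ^ 2 + A) := by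
          gcongr; exact e2.trans e3
      _ ≤ _ := by linarith
  calc (c * s * |z|) ^ (2 * R) * Real.exp (D * (2 * (c * s * |z|)) ^ q)
      ≤ ((c * s) ^ (2 * R) * (8 ^ R * R.factorial * Real.exp (z ^ 2 / 8))) *
        Real.exp (z ^ 2 / 8 + D * A) := by
        rw [mul_pow]; gcongr
    _ = (c * s) ^ (2 * R) * (8 ^ R * R.factorial * Real.exp (D * A)) *
        (Real.exp (z ^ 2 / 8) * Real.exp (z ^ 2 / 8)) := by rw [Real.exp_add]; ring
    _ = _ := by rw [← Real.exp_add]; congr 2; ring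

section FBM

variable {Ω : Type*} {d : ℕ}

/-- The law of the increments of a coordinate of fractional Brownian motion. -/
lemma IsFBM.map_increment [MeasurableSpace Ω] {H : ℝ} {B : ℝ → Ω → EuclideanSpace ℝ (Fin d)}
    {P : Measure Ω} [IsProbabilityMeasure P] (hB : IsFBM H B P) (hH : 0 < H) {s t : ℝ}
    (hs : s ∈ Icc (0 : ℝ) 1)
    (ht : t ∈ Icc (0 : ℝ) 1) (j : Fin d) :
    P.map (fun ω => B t ω j - B s ω j) = gaussianReal 0 (|t - s| ^ (2 * H)).toNNReal := by
  have hlaw : ∀ r ∈ Icc (0 : ℝ) 1, HasGaussianLaw (fun ω => B r ω j) P := fun r hr =>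
    (hB.gaussian.hasGaussianLaw_eval ⟨r, hr⟩).map_fun (EuclideanSpace.proj j)
  have hincr : HasGaussianLaw (fun ω => B t ω j - B s ω j) P :=
    (hB.gaussian.hasGaussianLaw_fun_sub (s := ⟨t, ht⟩) (t := ⟨s, hs⟩)).map_fun
      (EuclideanSpace.proj j)
  have hmean : ∫ ω, (B t ω j - B s ω j) ∂P = 0 := by
    rw [integral_sub (hlaw t ht).integrable (hlaw s hs).integrable, hB.centered t ht,
      hB.centered s hs, sub_zero]
  have hmul : ∀ r ∈ Icc (0 : ℝ) 1, ∀ r' ∈ Icc (0 : ℝ) 1,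
      Integrable (fun ω => B r ω j * B r' ω j) P := fun r hr r' hr' =>
    (hlaw r hr).memLp_two.integrable_mul (hlaw r' hr').memLp_two
  have hvar : Var[fun ω => B t ω j - B s ω j; P] = |t - s| ^ (2 * H) := by
    rw [variance_of_integral_eq_zero hincr.aemeasurable hmean]
    have e : (fun ω => (B t ω j - B s ω j) ^ 2) = fun ω =>
        B t ω j * B t ω j - 2 * (B s ω j * B t ω j) + B s ω j * B s ω j := by
      ext ω; ring
    have hi : Integrable (fun ω => B t ω j * B t ω j - 2 * (B s ω j * B t ω j)) P :=
      (hmul t ht t ht).sub ((hmul s hs t ht).const_mul 2)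
    rw [e, integral_add hi (hmul s hs s hs),
      integral_sub (hmul t ht t ht) ((hmul s hs t ht).const_mul 2), integral_const_mul,
      hB.covariance t ht t ht, hB.covariance s hs t ht, hB.covariance s hs s hs]
    simp only [sub_self, abs_zero, if_true]
    rw [Real.zero_rpow (by positivity)]
    ring
  rw [hincr.map_eq_gaussianReal, hmean, hvar]

/-- The increment over a dyadic interval, normalised for the exponent `β`; zero for indices that
stand for no interval of `[0, 1]`. -/
noncomputable def dyadicIncrement (β : ℝ) (B : ℝ → Ω → EuclideanSpace ℝ (Fin d))
    (i : ℕ × ℕ × Fin d) (ω : Ω) : ℝ :=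
  if i.2.1 < 2 ^ i.1 then
    (2 ^ β) ^ i.1 *
      |B (((i.2.1 + 1 : ℕ) : ℝ) / 2 ^ i.1) ω i.2.2 - B ((i.2.1 : ℝ) / 2 ^ i.1) ω i.2.2|
  else 0

lemma dyadicIncrement_nonneg (β : ℝ) (B : ℝ → Ω → EuclideanSpace ℝ (Fin d))
    (i : ℕ × ℕ × Fin d) (ω : Ω) : 0 ≤ dyadicIncrement β B i ω := by
  unfold dyadicIncrement; split_ifs <;> positivity

/-- The supremum of the normalised dyadic increments: a Hölder constant, up to a factor. -/
noncomputable def dyadicSup (β : ℝ) (B : ℝ → Ω → EuclideanSpace ℝ (Fin d)) (ω : Ω) : ℝ≥0∞ :=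
  ⨆ i, ENNReal.ofReal (dyadicIncrement β B i ω)

lemma dyadic_mem {n k : ℕ} (hk : k ≤ 2 ^ n) : ((k : ℝ) / 2 ^ n) ∈ Icc (0 : ℝ) 1 := by
  refine ⟨by positivity, (div_le_one (by positivity)).2 ?_⟩
  exact_mod_cast hk

/-- Exponential moments of order `q < 2` of the supremum of the dyadic increments. If the
supremum `K` exceeds `2`, some increment `Y` is at least `K / 2 ≥ 1`, and `exp (D K ^ q)` is at
most `Y ^ (2 R) exp (D (2 Y) ^ q)`. For large `R` the sum of the expectations of these converges:
the `2 ^ n` increments of level `n` have standard deviation `2 ^ (-n (H - β))`. -/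
lemma IsFBM.lintegral_exp_dyadicSup [MeasurableSpace Ω] {H β q D : ℝ}
    {B : ℝ → Ω → EuclideanSpace ℝ (Fin d)}
    {P : Measure Ω} [IsProbabilityMeasure P] (hB : IsFBM H B P) (hH : 0 < H) (hβH : β < H)
    (hq : 0 ≤ q) (hq2 : q < 2) (hD : 0 ≤ D) :
    (∀ᵐ ω ∂P, dyadicSup β B ω < ∞) ∧
    ∫⁻ ω, ENNReal.ofReal (Real.exp (D * (dyadicSup β B ω).toReal ^ q)) ∂P < ∞ := by
  obtain ⟨R, hR⟩ := exists_nat_gt (1 / (H - β))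
  have hHβ : 0 < H - β := by linarith
  rw [div_lt_iff₀ hHβ] at hR
  have hR0 : R ≠ 0 := by
    rintro rfl; simp at hR; linarith
  obtain ⟨C, hC, hCb⟩ := exists_lintegral_rpow_exp_le hq hq2 hD R
  set T : ℕ × ℕ × Fin d → Ω → ℝ≥0∞ := fun i ω =>
    ENNReal.ofReal (dyadicIncrement β B i ω ^ (2 * R) *
      Real.exp (D * (2 * dyadicIncrement β B i ω) ^ q)) with hT
  have hmeasB : ∀ n k : ℕ, k ≤ 2 ^ n → ∀ j, Measurable fun ω => B ((k : ℝ) / 2 ^ n) ω j :=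
    fun n k hk j => (EuclideanSpace.proj j : EuclideanSpace ℝ (Fin d) →L[ℝ] ℝ).measurable.comp
      (hB.measurable _ (dyadic_mem hk))
  have hmeasY : ∀ i, Measurable (dyadicIncrement β B i) := by
    rintro ⟨n, k, j⟩
    unfold dyadicIncrement
    by_cases hk : k < 2 ^ n
    · simp only [hk, if_true]
      exact ((((hmeasB n (k + 1) (by omega) j).sub (hmeasB n k hk.le j)).norm).const_mul _)
    · simp only [hk, if_false]; exact measurable_const
  have hmeasT : ∀ i, Measurable (T i) := fun i => by
    have := hmeasY i
    simp only [hT]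
    fun_prop
  have hTint : ∀ n k j, ∫⁻ ω, T (n, k, j) ω ∂P ≤
      if k < 2 ^ n then ENNReal.ofReal ((1 / 4) ^ n) * C else 0 := by
    intro n k j
    by_cases hk : k < 2 ^ n
    · simp only [hk, if_true, hT, dyadicIncrement]
      have hlen : |((k + 1 : ℕ) : ℝ) / 2 ^ n - (k : ℝ) / 2 ^ n| = (1 / 2) ^ n := by
        have : ((k + 1 : ℕ) : ℝ) / 2 ^ n - (k : ℝ) / 2 ^ n = (1 / 2) ^ n := by
          push_cast; rw [one_div, inv_pow]; field_simp; ring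
        rw [this, abs_of_nonneg (by positivity)]
      have hlaw := hB.map_increment hH (dyadic_mem hk.le)
        (dyadic_mem (show k + 1 ≤ 2 ^ n by omega)) j
      rw [hlen] at hlaw
      have hs2 : ((1 / 2 : ℝ) ^ n) ^ (2 * H) = (((1 / 2 : ℝ) ^ n) ^ H) ^ 2 := by
        rw [mul_comm 2 H, Real.rpow_mul (by positivity)]; norm_cast
      rw [hs2] at hlaw
      have hcs : ((2 : ℝ) ^ β) ^ n * ((1 / 2 : ℝ) ^ n) ^ H = ((2 : ℝ) ^ (-(H - β))) ^ n := by
        rw [← Real.rpow_natCast, ← Real.rpow_natCast, ← Real.rpow_natCast,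
          ← Real.rpow_mul (by norm_num), ← Real.rpow_mul (by norm_num),
          ← Real.rpow_mul (by norm_num), one_div, Real.inv_rpow (by norm_num),
          ← Real.rpow_neg (by norm_num), ← Real.rpow_add (by norm_num)]
        congr 1; ring
      have hle1 : ((2 : ℝ) ^ (-(H - β))) ^ n ≤ 1 :=
        pow_le_one₀ (by positivity) (two_rpow_neg_lt_one hHβ).le
      refine (hCb P _ (((1 / 2 : ℝ) ^ n) ^ H) ((2 ^ β) ^ n)
        ((hmeasB n (k + 1) (by omega) j).sub (hmeasB n k hk.le j)) (by positivity) (by positivity)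
        (by rw [hcs]; exact hle1) hlaw).trans ?_
      gcongr
      rw [hcs, ← pow_mul, mul_comm n, pow_mul]
      gcongr
      rw [← Real.rpow_natCast, ← Real.rpow_mul (by norm_num)]
      have : (1 / 4 : ℝ) = 2 ^ (-2 : ℝ) := by
        rw [Real.rpow_neg (by norm_num)]; norm_num
      rw [this]
      apply Real.rpow_le_rpow_of_exponent_le (by norm_num)
      push_cast
      nlinarith
    · simp only [hk, if_false, hT, dyadicIncrement]
      simp [hR0]
  have hsum : ∫⁻ ω, ∑' i, T i ω ∂P < ∞ := by
    rw [lintegral_tsum fun i => (hmeasT i).aemeasurable, ENNReal.tsum_prod']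
    have hn : ∀ n : ℕ, ∑' y : ℕ × Fin d, ∫⁻ ω, T (n, y) ω ∂P ≤
        ENNReal.ofReal ((1 / 2) ^ n) * (d * C) := by
      intro n
      rw [ENNReal.tsum_prod']
      calc ∑' k, ∑' j, ∫⁻ ω, T (n, k, j) ω ∂P
          ≤ ∑' k : ℕ, (if k < 2 ^ n then d * (ENNReal.ofReal ((1 / 4) ^ n) * C) else 0) := by
            refine ENNReal.tsum_le_tsum fun k => ?_
            rw [tsum_fintype]
            refine (Finset.sum_le_sum fun j _ => hTint n k j).trans (le_of_eq ?_)
            split_ifs <;> simp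
        _ = (2 ^ n : ℕ) * (d * (ENNReal.ofReal ((1 / 4) ^ n) * C)) := by
            rw [tsum_eq_sum (s := Finset.range (2 ^ n)) fun k hk => by
              rw [if_neg (by simpa using hk)],
              Finset.sum_congr rfl fun k hk => if_pos (Finset.mem_range.1 hk)]
            simp
        _ = ENNReal.ofReal ((1 / 2) ^ n) * (d * C) := by
            have : ENNReal.ofReal ((1 / 2) ^ n) =
                (2 ^ n : ℕ) * ENNReal.ofReal ((1 / 4) ^ n) := by
              rw [← ENNReal.ofReal_natCast, ← ENNReal.ofReal_mul (by positivity)]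
              congr 1
              push_cast
              rw [← mul_pow]; norm_num
            rw [this]; ring
    refine lt_of_le_of_lt (ENNReal.tsum_le_tsum hn) ?_
    rw [ENNReal.tsum_mul_right, ← ENNReal.ofReal_tsum_of_nonneg (fun n => by positivity)
      (summable_geometric_of_lt_one (by norm_num) (by norm_num))]
    exact ENNReal.mul_lt_top ENNReal.ofReal_lt_top
      (ENNReal.mul_lt_top (ENNReal.natCast_lt_top d) hC)
  have hmeasSum : Measurable fun ω => ∑' i, T i ω := Measurable.tsum hmeasT
  have hfin : ∀ᵐ ω ∂P, ∑' i, T i ω < ∞ := ae_lt_top hmeasSum hsum.ne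
  have hsup : ∀ ω, ∑' i, T i ω < ∞ → dyadicSup β B ω < ∞ := by
    intro ω hω
    refine lt_of_le_of_lt (iSup_le fun i => ?_) (b := ENNReal.ofReal (1 + (∑' i, T i ω).toReal))
      ENNReal.ofReal_lt_top
    apply ENNReal.ofReal_le_ofReal
    set y := dyadicIncrement β B i ω with hy
    have hy0 : 0 ≤ y := dyadicIncrement_nonneg _ _ _ _
    have h1 : y ^ (2 * R) * Real.exp (D * (2 * y) ^ q) ≤ (∑' i, T i ω).toReal := by
      rw [← ENNReal.ofReal_le_iff_le_toReal hω.ne]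
      exact ENNReal.le_tsum (f := fun i => T i ω) i
    by_cases hy1 : y ≤ 1
    · linarith [ENNReal.toReal_nonneg (a := ∑' i, T i ω)]
    · push Not at hy1
      have h2 : y ≤ y ^ (2 * R) := le_self_pow₀ hy1.le (by omega)
      have h3 : 1 ≤ Real.exp (D * (2 * y) ^ q) := Real.one_le_exp (by positivity)
      have h4 : y ^ (2 * R) ≤ y ^ (2 * R) * Real.exp (D * (2 * y) ^ q) :=
        le_mul_of_one_le_right (by positivity) h3
      linarith
  refine ⟨hfin.mono hsup, ?_⟩
  refine lt_of_le_of_lt (b := ∫⁻ ω, (ENNReal.ofReal (Real.exp (D * 2 ^ q)) + ∑' i, T i ω) ∂P)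
    (lintegral_mono_ae ?_) ?_
  · filter_upwards [hfin] with ω hω
    have hK := hsup ω hω
    set K := (dyadicSup β B ω).toReal with hKdef
    by_cases h2 : K ≤ 2
    · refine le_add_right (ENNReal.ofReal_le_ofReal (Real.exp_le_exp.2 ?_))
      gcongr
    · push Not at h2
      obtain ⟨i, hi⟩ : ∃ i, ENNReal.ofReal (K / 2) < ENNReal.ofReal (dyadicIncrement β B i ω) := by
        rw [← lt_iSup_iff]
        change _ < dyadicSup β B ω
        rw [← ENNReal.ofReal_toReal hK.ne, ← hKdef]
        exact (ENNReal.ofReal_lt_ofReal_iff (by linarith)).2 (by linarith)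
      have hi' : K / 2 < dyadicIncrement β B i ω :=
        (ENNReal.ofReal_lt_ofReal_iff_of_nonneg (by linarith)).1 hi
      set y := dyadicIncrement β B i ω with hy
      refine le_add_left (le_trans ?_ (ENNReal.le_tsum (f := fun i => T i ω) i))
      apply ENNReal.ofReal_le_ofReal
      have h3 : 1 ≤ y ^ (2 * R) := one_le_pow₀ (by linarith)
      calc Real.exp (D * K ^ q) ≤ Real.exp (D * (2 * y) ^ q) := by
            apply Real.exp_le_exp.2
            gcongr
            linarith
        _ ≤ _ := le_mul_of_one_le_left (Real.exp_nonneg _) h3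
  · rw [lintegral_add_left measurable_const]
    refine ENNReal.add_lt_top.2 ⟨?_, hsum⟩
    simp

/-- Almost every path is Hölder continuous, with constant a multiple of the dyadic supremum. -/
lemma holder_of_dyadicSup {β : ℝ} (hβ : 0 < β) {B : ℝ → Ω → EuclideanSpace ℝ (Fin d)} {ω : Ω}
    (hc : ContinuousOn (fun t => B t ω) (Icc (0 : ℝ) 1)) (hK : dyadicSup β B ω < ∞) :
    ∀ u v, 0 ≤ u → u ≤ v → v ≤ 1 →
      ‖B v ω - B u ω‖ ≤ chainC β * (d * (dyadicSup β B ω).toReal) * (v - u) ^ β := by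
  refine holder_of_dyadic (f := fun t => B t ω) hβ hc fun n k hk => ?_
  refine (norm_le_sum_abs _).trans ?_
  have hj : ∀ j : Fin d, |(B (((k + 1 : ℕ) : ℝ) / 2 ^ n) ω - B ((k : ℝ) / 2 ^ n) ω) j| ≤
      (dyadicSup β B ω).toReal * (2 ^ (-β)) ^ n := by
    intro j
    have h1 : dyadicIncrement β B (n, k, j) ω ≤ (dyadicSup β B ω).toReal := by
      rw [← ENNReal.ofReal_le_iff_le_toReal hK.ne]
      exact le_iSup (fun i => ENNReal.ofReal (dyadicIncrement β B i ω)) (n, k, j)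
    simp only [dyadicIncrement, hk, if_true] at h1
    have h2 : ((2 : ℝ) ^ (-β)) ^ n * (2 ^ β) ^ n = 1 := by
      rw [← mul_pow, ← Real.rpow_add (by norm_num)]; simp
    have h3 := mul_le_mul_of_nonneg_left h1 (by positivity : (0 : ℝ) ≤ (2 ^ (-β)) ^ n)
    rw [← mul_assoc, h2, one_mul] at h3
    rw [mul_comm]
    exact h3
  refine (Finset.sum_le_sum fun j _ => hj j).trans (le_of_eq ?_)
  simp [mul_assoc]

end FBM

/-! ### The Hölder seminorm -/

section Seminorm

variable {m : ℕ}

lemma holderSeminorm_le {β β' X : ℝ} (hβ : 0 < β) (hββ : β ≤ β') (hX : 0 ≤ X)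
    {f : ℝ → EuclideanSpace ℝ (Fin m)}
    (hf : ∀ u v, 0 ≤ u → u ≤ v → v ≤ 1 → ‖f v - f u‖ ≤ X * (v - u) ^ β') :
    holderSeminorm β f ≤ ENNReal.ofReal X := by
  refine iSup_le fun θ => iSup_le fun r => iSup_le fun h => ?_
  have hp : 0 < (r - θ) ^ β := Real.rpow_pos_of_pos (by linarith [h.2.1]) _
  rw [ENNReal.div_le_iff (by simpa using hp) ENNReal.ofReal_ne_top, ← ENNReal.ofReal_mul hX,
    ← ofReal_norm]
  apply ENNReal.ofReal_le_ofReal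
  refine (hf θ r h.1 h.2.1.le h.2.2).trans (mul_le_mul_of_nonneg_left ?_ hX)
  exact rpow_le_rpow_of_le_one (by linarith [h.2.1]) (by linarith [h.1, h.2.2]) hβ hββ

lemma holderSeminorm_congr {β : ℝ} {f f' : ℝ → EuclideanSpace ℝ (Fin m)}
    (h : EqOn f f' (Icc (0 : ℝ) 1)) : holderSeminorm β f = holderSeminorm β f' := by
  unfold holderSeminorm
  refine iSup_congr fun θ => iSup_congr fun r => iSup_congr fun hr => ?_
  rw [h ⟨hr.1, hr.2.1.le.trans hr.2.2⟩, h ⟨hr.1.trans hr.2.1.le, hr.2.2⟩]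

/-- The Hölder seminorm of a continuous path is a supremum over pairs of rational times. -/
lemma holderSeminorm_eq_iSup_rat {β : ℝ} {f : ℝ → EuclideanSpace ℝ (Fin m)}
    (hf : ContinuousOn f (Icc (0 : ℝ) 1)) :
    holderSeminorm β f = ⨆ (θ : ℚ) (r : ℚ) (_ : (0 : ℝ) ≤ θ ∧ (θ : ℝ) < r ∧ (r : ℝ) ≤ 1),
      ‖f r - f θ‖ₑ / ENNReal.ofReal (((r : ℝ) - θ) ^ β) := by
  apply le_antisymm
  · refine iSup_le fun θ => iSup_le fun r => iSup_le fun h => ?_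
    have hθr : θ < (θ + r) / 2 := by linarith [h.2.1]
    have hrθ : (θ + r) / 2 < r := by linarith [h.2.1]
    have h1 : ∀ n : ℕ, ∃ q : ℚ, θ < q ∧ (q : ℝ) < min (θ + 1 / ((n : ℝ) + 1)) ((θ + r) / 2) :=
      fun n => exists_rat_btwn (lt_min (by linarith [Nat.one_div_pos_of_nat (α := ℝ) (n := n)]) hθr)
    have h2 : ∀ n : ℕ, ∃ q : ℚ, max (r - 1 / ((n : ℝ) + 1)) ((θ + r) / 2) < q ∧ (q : ℝ) < r :=
      fun n => exists_rat_btwn (max_lt (by linarith [Nat.one_div_pos_of_nat (α := ℝ) (n := n)]) hrθ)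
    choose a ha ha' using h1
    choose c hc hc' using h2
    have hlim := tendsto_one_div_add_atTop_nhds_zero_nat (𝕜 := ℝ)
    have hal : Tendsto (fun n => (a n : ℝ)) atTop (𝓝 θ) :=
      tendsto_of_tendsto_of_tendsto_of_le_of_le tendsto_const_nhds
        (by simpa using hlim.const_add θ) (fun n => (ha n).le)
        fun n => (ha' n).le.trans (min_le_left _ _)
    have hcl : Tendsto (fun n => (c n : ℝ)) atTop (𝓝 r) :=
      tendsto_of_tendsto_of_tendsto_of_le_of_le (by simpa using hlim.const_sub r)
        tendsto_const_nhds (fun n => (le_max_left _ _).trans (hc n).le) fun n => (hc' n).le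
    have hac : ∀ n, (0 : ℝ) ≤ a n ∧ (a n : ℝ) < c n ∧ (c n : ℝ) ≤ 1 := fun n =>
      ⟨h.1.trans (ha n).le, ((ha' n).trans_le (min_le_right _ _)).trans
        ((le_max_right _ _).trans_lt (hc n)), (hc' n).le.trans h.2.2⟩
    have hfa : Tendsto (fun n => f (a n)) atTop (𝓝 (f θ)) :=
      (hf θ ⟨h.1, h.2.1.le.trans h.2.2⟩).tendsto.comp (tendsto_nhdsWithin_iff.2
        ⟨hal, Eventually.of_forall fun n => ⟨(hac n).1, (hac n).2.1.le.trans (hac n).2.2⟩⟩)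
    have hfc : Tendsto (fun n => f (c n)) atTop (𝓝 (f r)) :=
      (hf r ⟨h.1.trans h.2.1.le, h.2.2⟩).tendsto.comp (tendsto_nhdsWithin_iff.2
        ⟨hcl, Eventually.of_forall fun n => ⟨(hac n).1.trans (hac n).2.1.le, (hac n).2.2⟩⟩)
    have hpos : 0 < (r - θ) ^ β := Real.rpow_pos_of_pos (by linarith [h.2.1]) _
    have hden : Tendsto (fun n => ENNReal.ofReal (((c n : ℝ) - a n) ^ β)) atTop
        (𝓝 (ENNReal.ofReal ((r - θ) ^ β))) :=
      ENNReal.tendsto_ofReal ((hcl.sub hal).rpow_const (Or.inl (by linarith [h.2.1])))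
    refine le_of_tendsto' (ENNReal.Tendsto.div ((hfc.sub hfa).enorm)
      (Or.inr (by simpa using hpos)) hden (Or.inl ENNReal.ofReal_ne_top)) fun n => ?_
    exact le_iSup_of_le (a n) (le_iSup_of_le (c n) (le_iSup_of_le (hac n) le_rfl))
  · refine iSup_le fun θ => iSup_le fun r => iSup_le fun h => ?_
    exact le_iSup_of_le (θ : ℝ) (le_iSup_of_le (r : ℝ) (le_iSup_of_le h le_rfl))

end Seminorm

/-! ### Measurability of the solution -/

section Measurability

variable {E V : Type*} [NormedAddCommGroup E] [NormedSpace ℝ E] [NormedAddCommGroup V]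
  [NormedSpace ℝ V]

/-- The Euler scheme up to time `t` is a measurable function of the driver up to time `t`. -/
lemma measurable_euler [MeasurableSpace E] [BorelSpace E] [SecondCountableTopology E]
    [MeasurableSpace V] [BorelSpace V] [SecondCountableTopology V] {Ω : Type*} [MeasurableSpace Ω]
    {b : ℝ → E → E} {S : ℝ → E → V →L[ℝ] E} {L M lam γ : ℝ}
    (hS : YoungCoefficients b S L M lam γ) (x₀ : E) {g : Ω → ℝ → V} {t : ℝ} (ht : t ≤ 1)
    (hg : ∀ s ∈ Icc (0 : ℝ) t, Measurable fun ω => g ω s) {n : ℕ} (hn : 0 < n) :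
    ∀ k : ℕ, (k / n : ℝ) ≤ t → Measurable fun ω => euler b S x₀ (g ω) n k := by
  intro k
  induction k with
  | zero => intro _; exact measurable_const
  | succ k ih =>
    intro hk
    have hkk : (k / n : ℝ) ≤ (k + 1 : ℕ) / n := (grid_le_iff hn).2 (Nat.le_succ k)
    have hY := ih (hkk.trans hk)
    have m1 : (k / n : ℝ) ∈ Icc (0 : ℝ) 1 := ⟨by positivity, (hkk.trans hk).trans ht⟩
    have m2 : ((k + 1 : ℕ) / n : ℝ) ∈ Icc (0 : ℝ) 1 := ⟨by positivity, hk.trans ht⟩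
    have hdrift : Continuous fun y => ∫ r in (k / n : ℝ)..((k + 1 : ℕ) / n : ℝ), b r y := by
      have hlip : LipschitzWith (Real.toNNReal L)
          fun y => ∫ r in (k / n : ℝ)..((k + 1 : ℕ) / n : ℝ), b r y := by
        refine LipschitzWith.of_dist_le_mul fun y z => ?_
        rw [dist_eq_norm, dist_eq_norm, Real.coe_toNNReal _ hS.L_nonneg,
          ← intervalIntegral.integral_sub
          (hS.intervalIntegrable_const _ m1 m2) (hS.intervalIntegrable_const _ m1 m2)]
        refine (norm_integral_le_mul_sub hkk fun r h1 h2 =>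
          hS.drift_lip r ⟨m1.1.trans h1, h2.trans m2.2⟩ y z).trans ?_
        refine mul_le_of_le_one_right ?_ (by linarith [m1.1, m2.2])
        exact mul_nonneg hS.L_nonneg (norm_nonneg _)
      exact hlip.continuous
    have hdiff : Continuous fun y => S (k / n) y := by
      have hlip : LipschitzWith (Real.toNNReal M) fun y => S (k / n) y := by
        refine LipschitzWith.of_dist_le_mul fun y z => ?_
        rw [dist_eq_norm, dist_eq_norm, Real.coe_toNNReal _ hS.M_nonneg]
        exact hS.space _ m1 y z
      exact hlip.continuous
    have happ : Continuous fun p : E × V => S (k / n) p.1 p.2 :=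
      (isBoundedBilinearMap_apply (𝕜 := ℝ) (E := V) (F := E)).continuous.comp
        ((hdiff.comp continuous_fst).prodMk continuous_snd)
    have hinc : Measurable fun ω => g ω ((k + 1 : ℕ) / n) - g ω (k / n) :=
      (hg _ ⟨m2.1, hk⟩).sub (hg _ ⟨m1.1, hkk.trans hk⟩)
    exact hY.add ((hdrift.measurable.comp hY).add (happ.measurable.comp (hY.prodMk hinc)))

lemma measurable_eulerPath [MeasurableSpace E] [BorelSpace E] [SecondCountableTopology E]
    [MeasurableSpace V] [BorelSpace V] [SecondCountableTopology V] {Ω : Type*} [MeasurableSpace Ω]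
    {b : ℝ → E → E} {S : ℝ → E → V →L[ℝ] E} {L M lam γ : ℝ}
    (hS : YoungCoefficients b S L M lam γ) (x₀ : E) {g : Ω → ℝ → V} {t : ℝ}
    (ht : t ∈ Icc (0 : ℝ) 1) (hg : ∀ s ∈ Icc (0 : ℝ) t, Measurable fun ω => g ω s) (n : ℕ) :
    Measurable fun ω => eulerPath b S x₀ (g ω) n t := by
  unfold eulerPath
  rcases Nat.eq_zero_or_pos n with rfl | hn
  · simp only [Nat.cast_zero, zero_mul, Nat.floor_zero]
    exact measurable_const
  · refine measurable_euler hS x₀ ht.2 hg hn _ ?_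
    rw [div_le_iff₀ (by positivity)]
    exact (Nat.floor_le (mul_nonneg (Nat.cast_nonneg n) ht.1)).trans_eq (mul_comm _ _)

/-- The limit of the Euler schemes, where it exists, depends measurably on the driver up to the
present time. -/
lemma stronglyMeasurable_lim_eulerPath [CompleteSpace E] [MeasurableSpace E] [BorelSpace E]
    [SecondCountableTopology E] [MeasurableSpace V] [BorelSpace V] [SecondCountableTopology V]
    {Ω : Type*} [MeasurableSpace Ω] {b : ℝ → E → E} {S : ℝ → E → V →L[ℝ] E} {L M lam γ : ℝ}
    (hS : YoungCoefficients b S L M lam γ) (x₀ : E) {g : Ω → ℝ → V} {t : ℝ}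
    (ht : t ∈ Icc (0 : ℝ) 1) (hg : ∀ s ∈ Icc (0 : ℝ) t, Measurable fun ω => g ω s) :
    StronglyMeasurable fun ω => limUnder atTop fun n => eulerPath b S x₀ (g ω) n t :=
  StronglyMeasurable.limUnder fun n => (measurable_eulerPath hS x₀ ht hg n).stronglyMeasurable

lemma IsYoungSolution.congr {b : ℝ → E → E} {S : ℝ → E → V →L[ℝ] E} {x₀ : E} {g : ℝ → V}
    {κ β : ℝ} {x y : ℝ → E} (hx : IsYoungSolution b S x₀ g κ β x)
    (h : ∀ t ∈ Icc (0 : ℝ) 1, x t = y t) : IsYoungSolution b S x₀ g κ β y := by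
  obtain ⟨X, hX, hhol⟩ := hx.holder
  obtain ⟨C, hC⟩ := hx.germ
  refine ⟨by rw [← h 0 (by simp), hx.init], ⟨X, hX, fun u v hu huv hv => ?_⟩,
    ⟨C, fun u v hu huv hv => ?_⟩⟩
  · rw [← h u ⟨hu, huv.trans hv⟩, ← h v ⟨hu.trans huv, hv⟩]
    exact hhol u v hu huv hv
  · have e : ∫ r in u..v, b r (y r) = ∫ r in u..v, b r (x r) := by
      refine intervalIntegral.integral_congr fun r hr => ?_
      rw [uIcc_of_le huv] at hr
      simp only [h r ⟨hu.trans hr.1, hr.2.trans hv⟩]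
    rw [e, ← h u ⟨hu, huv.trans hv⟩, ← h v ⟨hu.trans huv, hv⟩]
    exact hC u v hu huv hv

end Measurability

/-! ### The size of the a priori bound -/

lemma aprioriC_le {β Q : ℝ} (hβ : 0 < β) (hβ1 : β ≤ 1) (hQ : 0 ≤ Q) :
    aprioriC β Q ≤ 4 * Real.exp (3 * (2 * Q + 2) ^ (1 / β)) := by
  set w := 2 * Q + 2 with hw
  have hw1 : 1 ≤ w := by linarith
  have hwq : w ≤ w ^ (1 / β) := by
    have : (1 : ℝ) ≤ 1 / β := (one_le_div hβ).2 hβ1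
    simpa using Real.rpow_le_rpow_of_exponent_le hw1 this
  have hq0 : 0 ≤ w ^ (1 / β) := by positivity
  have h1 : w ≤ Real.exp (w ^ (1 / β)) := by
    linarith [Real.add_one_le_exp (w ^ (1 / β))]
  have h2 : (2 : ℝ) ^ ⌈2 * w ^ (1 / β)⌉₊ ≤ 2 * Real.exp (2 * w ^ (1 / β)) := by
    have e1 : ((⌈2 * w ^ (1 / β)⌉₊ : ℕ) : ℝ) ≤ 2 * w ^ (1 / β) + 1 :=
      (Nat.ceil_lt_add_one (by positivity)).le
    have e2 : (2 : ℝ) ≤ Real.exp 1 := by linarith [Real.add_one_le_exp (1 : ℝ)]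
    calc (2 : ℝ) ^ ⌈2 * w ^ (1 / β)⌉₊ = (2 : ℝ) ^ ((⌈2 * w ^ (1 / β)⌉₊ : ℕ) : ℝ) :=
          (Real.rpow_natCast _ _).symm
      _ ≤ 2 ^ (2 * w ^ (1 / β) + 1) := Real.rpow_le_rpow_of_exponent_le (by norm_num) e1
      _ = 2 * 2 ^ (2 * w ^ (1 / β)) := by rw [Real.rpow_add_one (by norm_num), mul_comm]
      _ ≤ 2 * (Real.exp 1) ^ (2 * w ^ (1 / β)) := by gcongr
      _ = _ := by rw [Real.exp_one_rpow]
  calc aprioriC β Q = 2 * w * 2 ^ ⌈2 * w ^ (1 / β)⌉₊ := by rw [aprioriC, hw]; ring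
    _ ≤ 2 * Real.exp (w ^ (1 / β)) * (2 * Real.exp (2 * w ^ (1 / β))) := by gcongr
    _ = 4 * (Real.exp (w ^ (1 / β)) * Real.exp (2 * w ^ (1 / β))) := by ring
    _ = _ := by rw [← Real.exp_add]; congr 2; ring

lemma aprioriC_nonneg {β Q : ℝ} (hQ : 0 ≤ Q) : 0 ≤ aprioriC β Q := by
  unfold aprioriC; positivity

lemma add_rpow_le_two_mul {a c q : ℝ} (ha : 0 ≤ a) (hc : 0 ≤ c) (hq : 0 ≤ q) :
    (a + c) ^ q ≤ (2 * a) ^ q + (2 * c) ^ q := by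
  have h1 : 0 ≤ (2 * a) ^ q := by positivity
  have h2 : 0 ≤ (2 * c) ^ q := by positivity
  rcases le_total a c with h | h
  · have := Real.rpow_le_rpow (by positivity) (by linarith : a + c ≤ 2 * c) hq
    linarith
  · have := Real.rpow_le_rpow (by positivity) (by linarith : a + c ≤ 2 * a) hq
    linarith

/-- Powers of the a priori bound grow with the size `k` of the driver at most like
`exp (D k ^ (1/β))`. -/
lemma exists_aprioriC_rpow_le {β A c r p : ℝ} (hβ : 0 < β) (hβ1 : β ≤ 1) (hA : 0 ≤ A)
    (hc : 0 ≤ c) (hr : 0 ≤ r) (hp : 0 ≤ p) :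
    ∃ C D : ℝ, 0 ≤ D ∧ ∀ k, 0 ≤ k →
      (aprioriC β (A + c * k) * r) ^ p ≤ C * Real.exp (D * k ^ (1 / β)) := by
  refine ⟨(4 * r) ^ p * Real.exp (3 * (2 * (2 * A + 2)) ^ (1 / β) * p),
    3 * (2 * (2 * c)) ^ (1 / β) * p, by positivity, fun k hk => ?_⟩
  have hQ : 0 ≤ A + c * k := by positivity
  have h1 := aprioriC_le hβ hβ1 hQ
  have h2 : (2 * (A + c * k) + 2) ^ (1 / β) ≤
      (2 * (2 * A + 2)) ^ (1 / β) + (2 * (2 * c)) ^ (1 / β) * k ^ (1 / β) := by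
    rw [← Real.mul_rpow (by positivity) hk]
    have := add_rpow_le_two_mul (a := 2 * A + 2) (c := 2 * c * k) (q := 1 / β) (by positivity)
      (by positivity) (by positivity)
    rwa [show 2 * (A + c * k) + 2 = 2 * A + 2 + 2 * c * k by ring,
      show 2 * (2 * c) * k = 2 * (2 * c * k) by ring]
  calc (aprioriC β (A + c * k) * r) ^ p
      ≤ (4 * Real.exp (3 * ((2 * (2 * A + 2)) ^ (1 / β) +
          (2 * (2 * c)) ^ (1 / β) * k ^ (1 / β))) * r) ^ p := by
        apply Real.rpow_le_rpow (mul_nonneg (aprioriC_nonneg hQ) hr) _ hp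
        gcongr
        exact h1.trans (by gcongr)
    _ = (4 * r) ^ p * Real.exp (3 * ((2 * (2 * A + 2)) ^ (1 / β) +
          (2 * (2 * c)) ^ (1 / β) * k ^ (1 / β)) * p) := by
        rw [show ∀ e : ℝ, 4 * e * r = 4 * r * e by intro e; ring,
          Real.mul_rpow (by positivity) (Real.exp_nonneg _), ← Real.exp_mul]
    _ = _ := by
        rw [mul_assoc ((4 * r) ^ p), ← Real.exp_add]
        congr 2; ring

end FBMSDE

open FBMSDE in
theorem mainTheorem5 {Ω : Type*} [MeasurableSpace Ω] (P : Measure Ω) [IsProbabilityMeasure P]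
    {m d : ℕ} (H : ℝ) (hH : H ∈ Ioo (1 / 2 : ℝ) 1)
    (B : ℝ → Ω → EuclideanSpace ℝ (Fin d)) (hB : FBMSDE.IsFBM H B P)
    (hBcont : ∀ᵐ ω ∂P, ContinuousOn (fun t => B t ω) (Icc (0 : ℝ) 1))
    (b : ℝ → EuclideanSpace ℝ (Fin m) → EuclideanSpace ℝ (Fin m))
    (σ : ℝ → EuclideanSpace ℝ (Fin m) → Matrix (Fin m) (Fin d) ℝ)
    (lam γ : ℝ) (hσ : FBMSDE.DiffusionAssumption H lam γ σ) (hb : FBMSDE.DriftAssumption b)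
    (x₀ : EuclideanSpace ℝ (Fin m))
    (α : ℝ) (hα : α ∈ Ioo (1 - H) (min (1 / 2) (min lam (γ / (1 + γ))))) :
    (∀ ε > 0, ∃ X : ℝ → Ω → EuclideanSpace ℝ (Fin m),
      (∀ t ∈ Icc (0 : ℝ) 1, Measurable (X t) ∧
        AEStronglyMeasurable[FBMSDE.pastSigma B t] (X t) P) ∧
      ∀ᵐ ω ∂P,
        FBMSDE.IsSolution b σ x₀ α ε (fun t => B t ω) (fun t => X t ω) ∧
        (∀ y, FBMSDE.IsSolution b σ x₀ α ε (fun t => B t ω) y →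
          EqOn y (fun t => X t ω) (Icc (0 : ℝ) 1)) ∧
        ∃ C : ℝ≥0, HolderOnWith C (1 - α).toNNReal (fun t => X t ω) (Icc (0 : ℝ) 1)) ∧
    (∀ X : ℝ → ℝ → Ω → EuclideanSpace ℝ (Fin m),
      (∀ ε ∈ Ioo (0 : ℝ) 1, ∀ᵐ ω ∂P,
        FBMSDE.IsSolution b σ x₀ α ε (fun t => B t ω) (fun t => X ε t ω)) →
      ∀ p : ℝ, 1 ≤ p →
        (∀ ε ∈ Ioo (0 : ℝ) 1,
          AEMeasurable (fun ω => FBMSDE.holderSeminorm (1 - α) (fun t => X ε t ω)) P) ∧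
        (⨆ ε ∈ Ioo (0 : ℝ) 1,
          ∫⁻ ω, FBMSDE.holderSeminorm (1 - α) (fun t => X ε t ω) ^ p ∂P) < ∞) := by
  obtain ⟨hH1, hH2⟩ := hH
  obtain ⟨hαH, hα'⟩ := hα
  have hα2 : α < 1 / 2 := hα'.trans_le (min_le_left _ _)
  have hαlam : α < lam := hα'.trans_le ((min_le_right _ _).trans (min_le_left _ _))
  have hαγ : α < γ / (1 + γ) := hα'.trans_le ((min_le_right _ _).trans (min_le_right _ _))
  have hα0 : 0 < α := by linarith
  have hγ0 : 0 < γ := by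
    have h1 : 1 < 1 / H := by rw [one_lt_div (by linarith)]; exact hH2
    linarith [hσ.gamma_mem.1]
  have hlam0 : 0 < lam := hα0.trans hαlam
  -- a Hölder exponent of the driver with `1 - α < β < H`
  set β := (1 - α + H) / 2 with hβdef
  have hαβ : 1 - α < β := by rw [hβdef]; linarith
  have hβH : β < H := by rw [hβdef]; linarith
  have hβ0 : 0 < β := by linarith
  have hβ1 : β ≤ 1 := by linarith
  have hγβ : 1 < (1 + γ) * β := by
    rw [lt_div_iff₀ (by linarith)] at hαγ
    have : (1 + γ) * (1 - α) < (1 + γ) * β := mul_lt_mul_of_pos_left hαβ (by linarith)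
    linarith
  set κ := min β (min lam (γ * β)) with hκdef
  have he : YoungExponents β κ lam γ := by
    refine ⟨?_, min_le_left _ _, hβ1, (min_le_right _ _).trans (min_le_left _ _),
      (min_le_right _ _).trans (min_le_right _ _), ?_⟩
    · rw [hκdef]; positivity
    · rw [← sub_lt_iff_lt_add, hκdef]
      refine lt_min (by linarith) (lt_min (by linarith) (by linarith))
  obtain ⟨L, M, hS⟩ := exists_youngCoefficients hlam0.le hσ hb
  have hL := hS.L_nonneg
  have hM := hS.M_nonneg
  set S : ℝ → EuclideanSpace ℝ (Fin m) → EuclideanSpace ℝ (Fin d) →L[ℝ] EuclideanSpace ℝ (Fin m) :=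
    fun t x => matCLM (σ t x) with hSdef
  set G : Ω → ℝ := fun ω => chainC β * (d * (dyadicSup β B ω).toReal) with hG
  have hG0 : ∀ ω, 0 ≤ G ω := fun ω =>
    mul_nonneg (chainC_nonneg hβ0) (mul_nonneg (Nat.cast_nonneg d) ENNReal.toReal_nonneg)
  set K : ℝ → Ω → ℝ → EuclideanSpace ℝ (Fin d) := fun ε ω t => Real.sqrt ε • B t ω with hK
  have hgood : ∀ᵐ ω ∂P, ∀ u v, 0 ≤ u → u ≤ v → v ≤ 1 → ‖B v ω - B u ω‖ ≤ G ω * (v - u) ^ β := by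
    filter_upwards [hBcont, (hB.lintegral_exp_dyadicSup (q := 1) (D := 0) (by linarith) hβH
      (by norm_num) (by norm_num) le_rfl).1] with ω hc hfin
    exact holder_of_dyadicSup hβ0 hc hfin
  have hgoodK : ∀ ε ω, (∀ u v, 0 ≤ u → u ≤ v → v ≤ 1 → ‖B v ω - B u ω‖ ≤ G ω * (v - u) ^ β) →
      ∀ u v, 0 ≤ u → u ≤ v → v ≤ 1 →
        ‖K ε ω v - K ε ω u‖ ≤ Real.sqrt ε * G ω * (v - u) ^ β := by
    intro ε ω h u v hu huv hv
    rw [hK]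
    dsimp only
    rw [← smul_sub, norm_smul, Real.norm_eq_abs, abs_of_nonneg (Real.sqrt_nonneg _), mul_assoc]
    exact mul_le_mul_of_nonneg_left (h u v hu huv hv) (Real.sqrt_nonneg _)
  have hKG : ∀ ε ω, 0 ≤ Real.sqrt ε * G ω := fun ε ω => mul_nonneg (Real.sqrt_nonneg _) (hG0 ω)
  have hyoung : ∀ ε ω, (∀ u v, 0 ≤ u → u ≤ v → v ≤ 1 → ‖B v ω - B u ω‖ ≤ G ω * (v - u) ^ β) →
      ∀ y, IsSolution b σ x₀ α ε (fun t => B t ω) y → IsYoungSolution b S x₀ (K ε ω) κ β y :=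
    fun ε ω h y hy => hy.isYoungSolution hS he hα0 (by linarith) hαlam.le (by linarith)
      (hG0 ω) h
  -- the solution is the limit of the Euler schemes; where the driver is not `β`-Hölder, a null set,
  -- `X'` may be no solution, but it depends measurably on the past of the driver everywhere
  set X' : ℝ → ℝ → Ω → EuclideanSpace ℝ (Fin m) := fun ε t ω =>
    Filter.limUnder Filter.atTop fun n => eulerPath b S x₀ (K ε ω) n t with hX'
  have hX'young : ∀ ε ω, (∀ u v, 0 ≤ u → u ≤ v → v ≤ 1 →
      ‖B v ω - B u ω‖ ≤ G ω * (v - u) ^ β) →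
      IsYoungSolution b S x₀ (K ε ω) κ β (fun t => X' ε t ω) := by
    intro ε ω h
    obtain ⟨x, hx, hlim⟩ := exists_isYoungSolution_tendsto hS he (hKG ε ω) (hgoodK ε ω h) x₀
    exact hx.congr fun t ht => (hlim t ht).limUnder_eq.symm
  have hpast : ∀ t ∈ Icc (0 : ℝ) 1, pastSigma B t ≤ ‹MeasurableSpace Ω› := fun t ht =>
    iSup₂_le fun s hs => (hB.measurable s ⟨hs.1, hs.2.trans ht.2⟩).comap_le
  have hX'past : ∀ ε, ∀ t ∈ Icc (0 : ℝ) 1, StronglyMeasurable[pastSigma B t] (X' ε t) := by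
    intro ε t ht
    refine @stronglyMeasurable_lim_eulerPath _ _ _ _ _ _ _ _ _ _ _ _ _ Ω (pastSigma B t) b S L M
      lam γ hS x₀ (K ε) t ht fun s hs => ?_
    have h1 : Measurable[pastSigma B t] (B s) :=
      (comap_measurable (B s)).mono (le_iSup₂_of_le (f := fun s (_ : s ∈ Icc (0 : ℝ) t) =>
        MeasurableSpace.comap (B s) inferInstance) s hs le_rfl) le_rfl
    exact (measurable_const_smul (Real.sqrt ε)).comp h1
  have hX'meas : ∀ ε, ∀ t ∈ Icc (0 : ℝ) 1, Measurable (X' ε t) := fun ε t ht =>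
    (hX'past ε t ht).measurable.mono (hpast t ht) le_rfl
  refine ⟨fun ε _ => ⟨X' ε, fun t ht => ⟨hX'meas ε t ht, (hX'past ε t ht).aestronglyMeasurable⟩,
    ?_⟩, fun X hX p hp => ⟨fun ε hε => ?_, ?_⟩⟩
  · filter_upwards [hgood] with ω hω
    have hsol := hX'young ε ω hω
    refine ⟨hsol.isSolution hS he hα0 (by linarith) (hG0 ω) hω, fun y hy t ht =>
      (hyoung ε ω hω y hy).unique hS he (hKG ε ω) (hgoodK ε ω hω) hsol t ht, ?_⟩
    obtain ⟨C, hC, hhol⟩ := hsol.holder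
    have hhol' : ∀ u v, 0 ≤ u → u ≤ v → v ≤ 1 →
        ‖X' ε v ω - X' ε u ω‖ ≤ C * (v - u) ^ (1 - α) := fun u v hu huv hv =>
      (hhol u v hu huv hv).trans (mul_le_mul_of_nonneg_left
        (rpow_le_rpow_of_le_one (by linarith) (by linarith) (by linarith) hαβ.le) hC)
    refine ⟨C.toNNReal, fun u hu v hv => ?_⟩
    have := norm_sub_le_of_ordered (x := fun t => X' ε t ω) hhol' hv hu
    rw [Real.coe_toNNReal _ (by linarith), edist_dist, edist_dist, dist_eq_norm, Real.dist_eq,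
      ENNReal.ofReal_rpow_of_nonneg (abs_nonneg _) (by linarith), ← ENNReal.ofReal,
      ← ENNReal.ofReal_mul hC]
    exact ENNReal.ofReal_le_ofReal this
  -- any solution agrees with `X' ε` almost surely, whose seminorm is a supremum over rational times
  · have hrat : Measurable fun ω => ⨆ (θ : ℚ) (r : ℚ)
        (_ : (0 : ℝ) ≤ θ ∧ (θ : ℝ) < r ∧ (r : ℝ) ≤ 1),
        ‖X' ε r ω - X' ε θ ω‖ₑ / ENNReal.ofReal (((r : ℝ) - θ) ^ (1 - α)) := by
      refine Measurable.iSup fun θ => Measurable.iSup fun r => Measurable.iSup fun h => ?_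
      refine Measurable.div_const ?_ _
      exact ((hX'meas ε r ⟨h.1.trans h.2.1.le, h.2.2⟩).sub
        (hX'meas ε θ ⟨h.1, h.2.1.le.trans h.2.2⟩)).enorm
    refine hrat.aemeasurable.congr ?_
    filter_upwards [hgood, hX ε hε] with ω hω hsol
    have hsol' := hX'young ε ω hω
    obtain ⟨C, _, hhol⟩ := hsol'.holder
    rw [holderSeminorm_congr fun t ht => (hyoung ε ω hω _ hsol).unique hS he (hKG ε ω)
      (hgoodK ε ω hω) hsol' t ht, holderSeminorm_eq_iSup_rat (continuousOn_of_holder hβ0 hhol)]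
  -- for `ε < 1` the driver `√ε B` is no larger than `B`, so one a priori bound serves for all `ε`
  · have hsC := (sewC_pos he.one_lt).le
    have hchain := chainC_nonneg hβ0
    obtain ⟨C, D, hD, hCD⟩ := exists_aprioriC_rpow_le (A := L)
      (c := (M + sewC (κ + β) * M) * (chainC β * d)) (r := 1 + ‖x₀‖) (p := p) hβ0 hβ1 hL
      (by positivity) (by positivity) (by linarith)
    have hmom := (hB.lintegral_exp_dyadicSup (q := 1 / β) (D := D) (by linarith) hβH
      (by positivity) (by rw [div_lt_iff₀ hβ0]; linarith) hD).2
    refine lt_of_le_of_lt (b := ENNReal.ofReal C *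
      ∫⁻ ω, ENNReal.ofReal (Real.exp (D * (dyadicSup β B ω).toReal ^ (1 / β))) ∂P)
      (iSup₂_le fun ε hε => ?_) (ENNReal.mul_lt_top ENNReal.ofReal_lt_top hmom)
    rw [← lintegral_const_mul' _ _ ENNReal.ofReal_ne_top]
    refine lintegral_mono_ae ?_
    filter_upwards [hgood, hX ε hε] with ω hω hsol
    set k := (dyadicSup β B ω).toReal with hk
    have hk0 : 0 ≤ k := ENNReal.toReal_nonneg
    have hKle : ∀ u v, 0 ≤ u → u ≤ v → v ≤ 1 → ‖K ε ω v - K ε ω u‖ ≤ G ω * (v - u) ^ β := by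
      intro u v hu huv hv
      refine (hgoodK ε ω hω u v hu huv hv).trans ?_
      apply mul_le_mul_of_nonneg_right _ (Real.rpow_nonneg (by linarith) _)
      exact mul_le_of_le_one_left (hG0 ω) (Real.sqrt_le_one.2 hε.2.le)
    have hbound := (hyoung ε ω hω _ hsol).holder_bound hS he (hG0 ω) hKle
    have hQ : L + (M + sewC (κ + β) * M) * G ω =
        L + (M + sewC (κ + β) * M) * (chainC β * d) * k := by rw [hG]; ring
    rw [hQ] at hbound
    have hQ0 : 0 ≤ L + (M + sewC (κ + β) * M) * (chainC β * d) * k := by positivity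
    have hle := holderSeminorm_le (by linarith) hαβ.le
      (mul_nonneg (aprioriC_nonneg (β := β) hQ0) (by positivity)) hbound
    calc holderSeminorm (1 - α) (fun t => X ε t ω) ^ p
        ≤ ENNReal.ofReal (aprioriC β (L + (M + sewC (κ + β) * M) * (chainC β * d) * k) *
            (1 + ‖x₀‖)) ^ p := by gcongr
      _ = ENNReal.ofReal ((aprioriC β (L + (M + sewC (κ + β) * M) * (chainC β * d) * k) *
            (1 + ‖x₀‖)) ^ p) := ENNReal.ofReal_rpow_of_nonneg
              (mul_nonneg (aprioriC_nonneg hQ0) (by positivity)) (by linarith)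
      _ ≤ ENNReal.ofReal (C * Real.exp (D * k ^ (1 / β))) :=
          ENNReal.ofReal_le_ofReal (hCD k hk0)
      _ = _ := ENNReal.ofReal_mul' (Real.exp_nonneg _)
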